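/- **Setting.** A spectral triple $(\mathcal A,\mathcal H,\mathcal D)$ is a unital $*$-algebra $\mathcal A$ faithfully represented by bounded operators on a Hilbert space $\mathcal H$, with a selfadjoint operator $\mathcal D$ such that $\langle\mathcal D\rangle^{-1}=(1+\mathcal D^2)^{-1/2}$ is compact, $a(\mathrm{Dom}\,\mathcal D)\subseteq\mathrm{Dom}\,\mathcal D$ and $[\mathcal D,a]$ is bounded for all $a\in\mathcal A$. It is $QC^\infty$ if all $a$ and $[\mathcal D,a]$ lie in the domain of every power of $\delta=[|\mathcal D|,\cdot]$. It is $\mathcal I$-summable, for an ideal $\mathcal I$ of operators, if $\langle\mathcal D\rangle^{-1}\in\mathcal I$. Its spectral dimension, when it is finitely summable, is the infimum of the $p\ge1$ such that it is $\mathcal L^s$-summable for all $s>p$. Let $\mathcal B$ be a $\mathbb Z_2$-graded unital topological $*$-algebra with (continuous) grading automorphism $\beta$, and let $(\mathcal A\otimes\mathcal B^{op},\mathcal H,\mathcal D,\Gamma)$ be an even spectral triple in the graded sense: $\mathcal A$ and $\mathcal B^{op}$ are faithfully represented on $\mathcal H$ and commute, $\Gamma$ is a selfadjoint unitary with $\Gamma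 a=a\Gamma$, $\Gamma b^{op}\Gamma=\beta(b)^{op}$, $\Gamma\mathcal D=-\mathcal D\Gamma$, and the commutators $[\mathcal D,a]$ and the graded commutators $[\mathcal D,b^{op}]_\pm=\mathcal D b^{op}-\beta(b)^{op}\mathcal D$ are bounded. The maps $b\mapsto b^{op}$ and $b\mapsto[\mathcal D,b^{op}]_\pm$ are norm-continuous, and the graded first order condition $[[\mathcal D,b^{op}]_\pm,a]=0$ holds. Assume that the triple is $QC^\infty$ for $\mathcal A$. Let $\mathcal E\cong\mathcal B^nq$, with $q=q^*=q^2\in M_n(\mathcal B)$, be a $\mathcal B$-$\mathcal C$-bimodule, where $\mathcal C$ is a unital $*$-algebra, with the inner product $(e|f)=\sum_je_jf_j^*\in\mathcal B$. The algebra $\mathcal C$ acts by adjointable operators: $(ec|f)=(e|fc^*)$. Let $\varepsilon'$ be a grading of $\mathcal E$ (a linear involution) with $\varepsilon'(be)=\beta(b)\varepsilon'(e)$, $\varepsilon'(ec)=\varepsilon'(e)c$ and $(\varepsilon'e|\varepsilon'f)=\beta((e|f))$. Let $\Omega^1\mathcal B$ be the kernel of the multiplication on the completed projective tensor product $\mathcal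 B\,\widehat\otimes\,\mathcal B$ (of the absolutely convergent series $\sum_k x_k\otimes y_k$), with $db=1\otimes b-b\otimes1$, $(db)^*=-d(b^*)$, and let $\nabla:\mathcal E\to\Omega^1\mathcal B\otimes_{\mathcal B}\mathcal E$ be a connection, $\nabla(be)=db\otimes e+b\nabla e$, which is compatible with the inner product, $d(e|f)=(\nabla e|f)-(e|\nabla f)$, and even, $\nabla\varepsilon'=(\beta\otimes\varepsilon')\nabla$. The Hilbert space $\mathcal H\otimes_{\mathcal B}\mathcal E\cong\mathcal H^nq$ has the scalar product $\langle\xi\otimes e,\eta\otimes f\rangle=\langle\xi\,(e|f),\eta\rangle$. With $\mathcal H_\infty=\bigcap_k\mathrm{Dom}\,\mathcal D^k$ and $\gamma(\xi\otimes b_0\,db_1)=[\Gamma\mathcal D,b_1^{op}](\xi b_0)$, let $\widehat{\mathcal D}$ be the closure of the operator on $\mathcal H_\infty\otimes_{\mathcal B}\mathcal E$ given by $$\widehat{\mathcal D}(\xi\otimes e)=\mathcal D\xi\otimes\varepsilon'e+(\Gamma\otimes\varepsilon')(\gamma\otimes1)(\xi\otimes\nabla e).$$ Call $\mathcal E$ *full*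 if the inner products $(e|f)$ span a subspace of $\mathcal B$ that is dense in the operator norm. Call the given triple *smooth for $\mathcal B^{op}$* if all $b^{op}$ and $[\mathcal D,b^{op}]_\pm$ lie in the domain of every power of $\delta$, and the maps $b\mapsto\delta^m(b^{op})$ and $b\mapsto\delta^m([\mathcal D,b^{op}]_\pm)$ are norm-continuous. **Theorem.** The operator $\widehat{\mathcal D}$ is well defined, and $\mathcal A$ and $\mathcal C^{op}$ are represented by bounded operators on $\mathcal H\otimes_{\mathcal B}\mathcal E$ through $a(\xi\otimes e)=a\xi\otimes e$ and $c^{op}(\xi\otimes e)=\xi\otimes ec$. Moreover: 1. $(\mathcal A,\mathcal H\otimes_{\mathcal B}\mathcal E,\widehat{\mathcal D})$ is a spectral triple, the representation of $\mathcal A$ being faithful if $\mathcal E$ is full. 2. It is $QC^\infty$ if the given triple is also smooth for $\mathcal B^{op}$. 3. If the given triple is $\mathcal I$-summable, so is this one. Here $\mathcal I$ is the Schatten ideal $\mathcal L^s$ ($s\ge1$), the ideal $\mathcal Z_p$ ($p\ge1$) of the compact $T$ with $|T|^p$ in the Dixmier ideal $\mathcal L^{1,\infty}$, or any two-sided ideal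 of operators on $\mathcal H$; in the last case the corresponding ideal on $\mathcal H\otimes_{\mathcal B}\mathcal E$ consists of the finite sums of operators $XSY$ with $S\in\mathcal I$, $Y:\mathcal H\otimes_{\mathcal B}\mathcal E\to\mathcal H$ and $X:\mathcal H\to\mathcal H\otimes_{\mathcal B}\mathcal E$ bounded. 4. If the given triple is finitely summable, so is this one, and its spectral dimension is at most that of the given triple. If $\mathcal E$ is full, then one of the two triples is finitely summable if and only if the other is, and they have the same spectral dimension. 5. If $\mathcal H_\infty$ is finitely generated and projective as a left $\mathcal A$-module and $\mathcal H=L^2(\mathcal H_\infty,\psi)$ for some positive linear functional $\psi$ on $\mathcal A$ — that is, for some $\mathcal A$-valued inner product $(\cdot|\cdot)_{\mathcal A}$ on $\mathcal H_\infty$, linear in the first entry, and some faithful bounded positive $\psi$, one has $\langle\xi,\eta\rangle=\psi((\eta|\xi)_{\mathcal A})$ on $\mathcal H_\infty$ (scalar products being linear in the second entry) — then $(\mathcal A\otimes\mathcal C^{op},\mathcal H\otimes_{\mathcal B}\mathcal E,\widehat{\mathcal D})$ is a spectral triple: the actions commute, the commutators $[\widehat{\mathcal D},c^{op}]$ are bounded,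 and $\mathcal C^{op}$ is represented faithfully if it acts faithfully on $\mathcal E$. It satisfies the first order condition $[[\widehat{\mathcal D},a],c^{op}]=0$, and under the hypothesis of item 2 it is $QC^\infty$ for $\mathcal A$. -/

import Mathlib

open MulOpposite Topology
open scoped InnerProductSpace ComplexOrder

/-! ## Unbounded operators and commutators -/

section Operators

variable {H : Type*} [NormedAddCommGroup H] [InnerProductSpace ℂ H]

/-- The bounded operator `S` extends `P T - T' P`: the operator `T` maps `Dom P` into `Dom P`, and
`P T x - T' P x = S x` for `x ∈ Dom P`. For `T' = T` this says that the commutator `[P, T]` is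
bounded, with bounded extension `S`. -/
def IsComm (P : H →ₗ.[ℂ] H) (T T' S : H →L[ℂ] H) : Prop :=
  ∀ x : P.domain, ∃ h : T x ∈ P.domain, P ⟨T x, h⟩ - T' (P x) = S x

open Classical in
/-- The bounded extension of `P T - T' P` (and `0` if there is none). -/
noncomputable def bddComm (P : H →ₗ.[ℂ] H) (T T' : H →L[ℂ] H) : H →L[ℂ] H :=
  if h : ∃ S, IsComm P T T' S then h.choose else 0

/-- The pairs `(x, z)` with `x ∈ Dom P²` and `z = P² x`. -/
def SqRel (P : H →ₗ.[ℂ] H) (x z : H) : Prop :=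
  ∃ y, (x, y) ∈ P.graph ∧ (y, z) ∈ P.graph

/-- `P = |D|`: the (unique) positive selfadjoint operator with `P² = D²`, domains included. -/
def IsModulus [CompleteSpace H] (D P : H →ₗ.[ℂ] H) : Prop :=
  IsSelfAdjoint P ∧ (∀ x : P.domain, 0 ≤ (⟪P x, (x : H)⟫_ℂ).re) ∧
    ∀ x z, SqRel P x z ↔ SqRel D x z

/-- `R = (1 + D²)^(-1/2)`: the (unique) positive bounded operator with `(1 + D²) R² = 1`. -/
def IsRegInv [CompleteSpace H] (D : H →ₗ.[ℂ] H) (R : H →L[ℂ] H) : Prop :=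
  R.IsPositive ∧ ∀ x, ∃ z, SqRel D (R (R x)) z ∧ R (R x) + z = x

/-- `T` lies in the domain of all powers of the derivation `δ = [P, ·]`; here `S m = δ^m T`. -/
def MemDomInf (P : H →ₗ.[ℂ] H) (T : H →L[ℂ] H) : Prop :=
  ∃ S : ℕ → H →L[ℂ] H, S 0 = T ∧ ∀ m, IsComm P (S m) (S m) (S (m + 1))

/-- `H_∞`, the intersection of the domains of all powers of `D`. -/
def smoothDomain (D : H →ₗ.[ℂ] H) : Submodule ℂ H where
  carrier := {x | ∃ y : ℕ → H, y 0 = x ∧ ∀ k, (y k, y (k + 1)) ∈ D.graph}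
  zero_mem' := ⟨0, rfl, fun _ => D.graph.zero_mem⟩
  add_mem' := by
    rintro _ _ ⟨y, rfl, hy⟩ ⟨z, rfl, hz⟩
    exact ⟨y + z, rfl, fun k => D.graph.add_mem (hy k) (hz k)⟩
  smul_mem' := by
    rintro c _ ⟨y, rfl, hy⟩
    exact ⟨c • y, rfl, fun k => D.graph.smul_mem c (hy k)⟩

end Operators

/-! ## Ideals of operators, summability, spectral dimension -/

section Ideals

variable {H : Type*} [NormedAddCommGroup H] [InnerProductSpace ℂ H]

/-- The `k`-th singular value (counted from `0`) of a bounded operator, as the distance to the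
operators of rank at most `k`. -/
noncomputable def singVal (T : H →L[ℂ] H) (k : ℕ) : ℝ :=
  sInf {r | ∃ F : H →L[ℂ] H, F.rank ≤ (k : Cardinal) ∧ r = ‖T - F‖}

/-- The Schatten ideal `L^s`. -/
def MemSchatten (s : ℝ) (T : H →L[ℂ] H) : Prop :=
  IsCompactOperator T ∧ Summable fun k => singVal T k ^ s

/-- The ideal `Z_p`: `|T|^p` lies in the Dixmier ideal `L^{1,∞}`. -/
def MemZ (p : ℝ) (T : H →L[ℂ] H) : Prop :=
  IsCompactOperator T ∧
    ∃ c : ℝ, ∀ N : ℕ, ∑ k ∈ Finset.range N, singVal T k ^ p ≤ c * Real.log (2 + N)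

/-- The ideal of operators on another Hilbert space `K` that corresponds to the two-sided ideal `I`
of operators on `H`: the finite sums of operators `X S Y` with `S ∈ I`. For `K = H` it is `I`, for
`K = H^n` it is `M_n(I)`. -/
def idealOn (I : TwoSidedIdeal (H →L[ℂ] H)) (K : Type*) [NormedAddCommGroup K]
    [InnerProductSpace ℂ K] : Submodule ℂ (K →L[ℂ] K) :=
  Submodule.span ℂ {T | ∃ S ∈ I, ∃ (X : H →L[ℂ] K) (Y : K →L[ℂ] H), T = X ∘L S ∘L Y}

variable [CompleteSpace H]

/-- `D` is summable for a class `J` of operators: `(1 + D²)^(-1/2)` lies in `J`. -/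
def IsSummableFor (D : H →ₗ.[ℂ] H) (J : (H →L[ℂ] H) → Prop) : Prop :=
  ∃ R, IsRegInv D R ∧ J R

/-- The `p ≥ 1` such that `D` is `L^s`-summable for all `s > p`. -/
def summabilityExponents (D : H →ₗ.[ℂ] H) : Set ℝ :=
  {p | 1 ≤ p ∧ ∀ s, p < s → IsSummableFor D (MemSchatten s)}

/-- `D` is finitely summable with spectral dimension `d`. -/
def HasSpectralDim (D : H →ₗ.[ℂ] H) (d : ℝ) : Prop :=
  (summabilityExponents D).Nonempty ∧ IsGLB (summabilityExponents D) d

end Ideals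

/-! ## Spectral triples -/

section Triples

variable {A B H : Type*} [Ring A] [StarRing A] [Algebra ℂ A] [Ring B] [StarRing B] [Algebra ℂ B]
  [NormedAddCommGroup H] [InnerProductSpace ℂ H] [CompleteSpace H]

/-- The conditions on a spectral triple `(A, H, D)`, except that the representation be faithful. -/
structure PreSpectralTriple (π : A →⋆ₐ[ℂ] (H →L[ℂ] H)) (D : H →ₗ.[ℂ] H) : Prop where
  selfAdjoint : IsSelfAdjoint D
  compact : IsSummableFor D fun R => IsCompactOperator R
  comm : ∀ a, ∃ S, IsComm D (π a) (π a) S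

/-- `(A, H, D)` is `QC^∞`: both `a` and `[D, a]` are in the domain of all powers of `[|D|, ·]`. -/
def QCInf (π : A →⋆ₐ[ℂ] (H →L[ℂ] H)) (D : H →ₗ.[ℂ] H) : Prop :=
  ∃ P, IsModulus D P ∧ ∀ a, MemDomInf P (π a) ∧ MemDomInf P (bddComm D (π a) (π a))

/-- A `ℤ/2`-grading of a topological `*`-algebra, given by its grading automorphism, which is `1`
on the even part and `-1` on the odd part. -/
structure AlgGrading (B : Type*) [Ring B] [StarRing B] [Algebra ℂ B] [TopologicalSpace B] where
  hom : B →⋆ₐ[ℂ] B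
  invol : ∀ b, hom (hom b) = b
  cont : Continuous hom

variable [TopologicalSpace B]

/-- The bounded operator `[D, b^op]_±`, the graded commutator: `D b^op - β(b)^op D`, which is
`D b^op - b^op D` for even `b` and `D b^op + b^op D` for odd `b`. -/
noncomputable def gradedComm (ρ : Bᵐᵒᵖ →⋆ₐ[ℂ] (H →L[ℂ] H)) (β : AlgGrading B) (D : H →ₗ.[ℂ] H)
    (b : B) : H →L[ℂ] H :=
  bddComm D (ρ (op b)) (ρ (op (β.hom b)))

/-- `(A ⊗ B^op, H, D, Γ)` is an even spectral triple, in the graded sense for the `ℤ/2`-graded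
algebra `B` (all of `A` being even), which satisfies the graded first order condition. The
maps `b ↦ b^op` and `b ↦ [D, b^op]_±` are continuous. -/
structure GradedEvenTriple (π : A →⋆ₐ[ℂ] (H →L[ℂ] H)) (ρ : Bᵐᵒᵖ →⋆ₐ[ℂ] (H →L[ℂ] H))
    (β : AlgGrading B) (D : H →ₗ.[ℂ] H) (Γ : H →L[ℂ] H) : Prop where
  triple : PreSpectralTriple π D
  faithful_left : Function.Injective π
  faithful_right : Function.Injective ρ
  commute : ∀ a b, Commute (π a) (ρ b)
  comm_right : ∀ b, IsComm D (ρ (op b)) (ρ (op (β.hom b))) (gradedComm ρ β D b)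
  grading_star : IsSelfAdjoint Γ
  grading_sq : Γ * Γ = 1
  grading_left : ∀ a, Commute Γ (π a)
  grading_right : ∀ b, Γ * ρ (op b) * Γ = ρ (op (β.hom b))
  grading_anti : IsComm D Γ (-Γ) 0
  firstOrder : ∀ a b, Commute (gradedComm ρ β D b) (π a)
  cont_rep : Continuous fun b => ρ (op b)
  cont_comm : Continuous (gradedComm ρ β D)

/-- The triple is also `QC^∞` for the action of `B^op`, and the topology of `B` is at least as fine
as the one that the seminorms `‖δ^m (b^op)‖` and `‖δ^m [D, b^op]_±‖` with `δ = [|D|, ·]` define. -/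
def SmoothOnRight (ρ : Bᵐᵒᵖ →⋆ₐ[ℂ] (H →L[ℂ] H)) (β : AlgGrading B) (D : H →ₗ.[ℂ] H) : Prop :=
  ∃ P, IsModulus D P ∧ ∃ S S' : ℕ → B → (H →L[ℂ] H),
    (∀ b, S 0 b = ρ (op b)) ∧ (∀ m b, IsComm P (S m b) (S m b) (S (m + 1) b)) ∧
    (∀ b, S' 0 b = gradedComm ρ β D b) ∧ (∀ m b, IsComm P (S' m b) (S' m b) (S' (m + 1) b)) ∧
    ∀ m, Continuous (S m) ∧ Continuous (S' m)

end Triples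

/-! ## The completed universal one-forms -/

section Forms

variable {B : Type*} [Ring B] [StarRing B] [Algebra ℂ B] [StarModule ℂ B] [TopologicalSpace B]
  [IsTopologicalRing B] [ContinuousStar B]

/-- The jointly continuous bilinear forms on `B`. -/
def contBilin (B : Type*) [Ring B] [Algebra ℂ B] [TopologicalSpace B] :
    Submodule ℂ (B →ₗ[ℂ] B →ₗ[ℂ] ℂ) where
  carrier := {φ | Continuous fun z : B × B => φ z.1 z.2}
  zero_mem' := by simpa using continuous_const
  add_mem' h h' := Continuous.add h h'
  smul_mem' c _ h := Continuous.const_smul h c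

/-- Functionals on the continuous bilinear forms. The completed projective tensor product of `B`
with itself consists of those that come from absolutely convergent series, where `x ⊗ y` is
evaluation at `(x, y)`; see `Represents`. -/
abbrev BilinDual (B : Type*) [Ring B] [Algebra ℂ B] [TopologicalSpace B] : Type _ :=
  contBilin B →ₗ[ℂ] ℂ

/-- The bilinear form `(x, y) ↦ φ (f x) (g y)`. -/
def pullForm (f g : B →L[ℂ] B) : contBilin B →ₗ[ℂ] contBilin B where
  toFun φ := ⟨φ.1.compl₁₂ f.toLinearMap g.toLinearMap, by
    have h : Continuous fun z : B × B => φ.1 z.1 z.2 := φ.2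
    exact h.comp ((f.continuous.comp continuous_fst).prodMk (g.continuous.comp continuous_snd))⟩
  map_add' _ _ := rfl
  map_smul' _ _ := rfl

/-- The bilinear form `(x, y) ↦ conj (φ y* x*)`. -/
noncomputable def flipStarForm (φ : contBilin B) : contBilin B :=
  ⟨LinearMap.mk₂ ℂ (fun x y => starRingEnd ℂ (φ.1 (star y) (star x)))
    (by intros; simp) (by intros; simp) (by intros; simp) (by intros; simp), by
    have h : Continuous fun z : B × B => φ.1 z.1 z.2 := φ.2
    exact Complex.continuous_conj.comp (h.comp
      ((continuous_star.comp continuous_snd).prodMk (continuous_star.comp continuous_fst)))⟩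

/-- `b · (x ⊗ y) = b x ⊗ y`. -/
def lact (b : B) (F : BilinDual B) : BilinDual B :=
  F ∘ₗ pullForm ⟨LinearMap.mulLeft ℂ b, by
    change Continuous fun x => b * x
    fun_prop⟩ (ContinuousLinearMap.id ℂ B)

/-- `(x ⊗ y) · b = x ⊗ y b`. -/
def ract (F : BilinDual B) (b : B) : BilinDual B :=
  F ∘ₗ pullForm (ContinuousLinearMap.id ℂ B) ⟨LinearMap.mulRight ℂ b, by
    change Continuous fun x => x * b
    fun_prop⟩

/-- `(x ⊗ y)* = y* ⊗ x*`, so that `(db)* = - d(b*)`. -/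
noncomputable def formStar (F : BilinDual B) : BilinDual B where
  toFun φ := starRingEnd ℂ (F (flipStarForm φ))
  map_add' φ ψ := by
    have : flipStarForm (φ + ψ) = flipStarForm φ + flipStarForm ψ := by
      ext x y; simp [flipStarForm]
    rw [this, map_add, map_add]
  map_smul' c φ := by
    have : flipStarForm (c • φ) = starRingEnd ℂ c • flipStarForm φ := by
      ext x y; simp [flipStarForm]
    rw [this, map_smul, smul_eq_mul, map_mul, Complex.conj_conj]; rfl

/-- The grading on forms, `x ⊗ y ↦ β(x) ⊗ β(y)`. -/
def formGrading (β : AlgGrading B) (F : BilinDual B) : BilinDual B :=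
  F ∘ₗ pullForm ⟨β.hom.toAlgHom.toLinearMap, β.cont⟩ ⟨β.hom.toAlgHom.toLinearMap, β.cont⟩

/-- The universal differential `db = 1 ⊗ b - b ⊗ 1`. -/
def univD (b : B) : BilinDual B where
  toFun φ := φ.1 1 b - φ.1 b 1
  map_add' φ ψ := by simp; ring
  map_smul' c φ := by simp; ring

/-- `F` is the sum of the absolutely convergent series of the tensors `x k ⊗ y k`. -/
def Represents (x y : ℕ → B) (F : BilinDual B) : Prop :=
  (∀ p r : Seminorm ℂ B, Continuous p → Continuous r → Summable fun k => p (x k) * r (y k)) ∧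
    ∀ φ : contBilin B, HasSum (fun k => φ.1 (x k) (y k)) (F φ)

/-- `F` lies in `Ω¹B`, the kernel of the multiplication map on the completed projective tensor
product: the forms `φ` with `φ x y = φ 1 (x y)` are those that factor through multiplication. -/
def IsOneForm (F : BilinDual B) : Prop :=
  (∃ x y, Represents x y F) ∧
    ∀ φ : contBilin B, (∀ x y, φ.1 x y = φ.1 1 (x * y)) → F φ = 0

variable {H : Type*} [NormedAddCommGroup H] [InnerProductSpace ℂ H] [CompleteSpace H]

/-- `S` is the operator `c(F)` on `H` by which the one-form `F` acts: the continuous linear map `c`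
on `Ω¹B` with `c(x dy) = [ΓD, y^op] x^op = Γ [D, y^op]_± x^op`. (For `F` in the kernel of the
multiplication map, `F = ∑ x_k ⊗ y_k` equals `∑ x_k dy_k`.) -/
def IsFormAction (ρ : Bᵐᵒᵖ →⋆ₐ[ℂ] (H →L[ℂ] H)) (β : AlgGrading B) (D : H →ₗ.[ℂ] H)
    (Γ : H →L[ℂ] H) (F : BilinDual B) (S : H →L[ℂ] H) : Prop :=
  ∃ x y, Represents x y F ∧ HasSum (fun k => Γ * gradedComm ρ β D (y k) * ρ (op (x k))) S

end Forms

/-! ## Finitely generated projective modules, hermitian bimodules and connections -/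

section Modules

/-- The left `B`-module `B^n q` of rows `v` with `v q = v`. -/
def rowModule {B : Type*} [Ring B] {n : ℕ} (q : Matrix (Fin n) (Fin n) B) :
    Submodule B (Fin n → B) where
  carrier := {v | Matrix.vecMul v q = v}
  zero_mem' := Matrix.zero_vecMul q
  add_mem' h h' := by
    simp only [Set.mem_ofPred_eq] at *
    rw [Matrix.add_vecMul, h, h']
  smul_mem' c v h := by
    simp only [Set.mem_ofPred_eq] at *
    rw [Matrix.smul_vecMul, h]

/-- A projector in `M_n(B)`. -/
structure Projector (B : Type*) [Ring B] [StarRing B] (n : ℕ) where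
  mat : Matrix (Fin n) (Fin n) B
  idem : mat * mat = mat
  herm : mat.conjTranspose = mat

variable {B C E : Type*} [Ring B] [StarRing B] [Algebra ℂ B] [StarModule ℂ B] [TopologicalSpace B]
  [IsTopologicalRing B] [ContinuousStar B] [Ring C] [StarRing C] [Algebra ℂ C]
  [AddCommGroup E] [Module ℂ E] [Module B E] [Module Cᵐᵒᵖ E] {n : ℕ} {q : Projector B n}

/-- The generator of `E ≅ B^n q` that corresponds to the `j`-th row of `q`. -/
def gen (κ : E ≃ₗ[B] rowModule q.mat) (j : Fin n) : E :=
  κ.symm ⟨q.mat j, by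
    ext k
    simpa [Matrix.vecMul, dotProduct, Matrix.mul_apply] using congrFun (congrFun q.idem j) k⟩

/-- The `B`-valued inner product on `E` given by `E ≅ B^n q`, linear in the first entry. -/
def pairing (κ : E ≃ₗ[B] rowModule q.mat) (e f : E) : B :=
  ∑ j, (κ e).1 j * star ((κ f).1 j)

/-- `E` is a `B`-`C`-bimodule, `ℤ/2`-graded by `g` over the graded algebra `B`, with inner product
given by the identification `κ` with `B^n q`: the grading is compatible with the action of `B` and
with the inner product and it commutes with `C`, and `C` acts by adjointable operators. -/
structure GradedBimodule (C : Type*) [Ring C] [StarRing C] [Module Cᵐᵒᵖ E]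
    (β : AlgGrading B) (κ : E ≃ₗ[B] rowModule q.mat)
    (g : E →ₗ[ℂ] E) : Prop where
  invol : ∀ e, g (g e) = e
  grading_left : ∀ (b : B) e, g (b • e) = β.hom b • g e
  grading_right : ∀ (c : C) e, g (op c • e) = op c • g e
  grading_pairing : ∀ e f, pairing κ (g e) (g f) = β.hom (pairing κ e f)
  adjointable : ∀ (c : C) e f, pairing κ (op c • e) f = pairing κ e (op (star c) • f)

/-- A connection `∇ : E → Ω¹B ⊗_B E`, compatible with the inner product and with the gradings. The
space `Ω¹B ⊗_B E` is `(Ω¹B)^n q`: the row `ω` with `ω q = ω` stands for the sum of the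
`ω j ⊗ gen κ j`, and `ω ⊗ e` is the row of the `ω · (κ e) j`. -/
structure HermitianConnection (β : AlgGrading B) (κ : E ≃ₗ[B] rowModule q.mat) (g : E →ₗ[ℂ] E)
    (nabla : E →ₗ[ℂ] (Fin n → BilinDual B)) : Prop where
  form : ∀ e j, IsOneForm (nabla e j)
  row : ∀ e k, ∑ j, ract (nabla e j) (q.mat j k) = nabla e k
  leibniz : ∀ (b : B) e j, nabla (b • e) j = ract (univD b) ((κ e).1 j) + lact b (nabla e j)
  compatible : ∀ e f, univD (pairing κ e f) =
    ∑ j, ract (nabla e j) (star ((κ f).1 j)) - ∑ j, lact ((κ e).1 j) (formStar (nabla f j))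
  even : ∀ e k, nabla (g e) k = ∑ j, ract (formGrading β (nabla e j)) ((κ (g (gen κ j))).1 k)

end Modules

/-! ## The twisted triple -/

section Twist

variable {B E H : Type*} [Ring B] [StarRing B] [Algebra ℂ B] [StarModule ℂ B] [TopologicalSpace B]
  [IsTopologicalRing B] [ContinuousStar B] [AddCommGroup E] [Module ℂ E] [Module B E]
  [NormedAddCommGroup H] [InnerProductSpace ℂ H] [CompleteSpace H] {n : ℕ} {q : Projector B n}

/-- The Hilbert space `H ⊗_B E`, as the closed subspace `H^n q` of `H^n`. -/
def TwistSpace (ρ : Bᵐᵒᵖ →⋆ₐ[ℂ] (H →L[ℂ] H)) (q : Projector B n) :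
    Submodule ℂ (PiLp 2 fun _ : Fin n => H) where
  carrier := {x | ∀ k, ∑ j, ρ (op (q.mat j k)) (x j) = x k}
  zero_mem' := by simp
  add_mem' h h' k := by simp [Finset.sum_add_distrib, h k, h' k]
  smul_mem' c x h k := by simp [← Finset.smul_sum, h k]

instance (ρ : Bᵐᵒᵖ →⋆ₐ[ℂ] (H →L[ℂ] H)) (q : Projector B n) : CompleteSpace (TwistSpace ρ q) := by
  have : IsClosed (TwistSpace ρ q : Set (PiLp 2 fun _ : Fin n => H)) := by
    have h : (TwistSpace ρ q : Set (PiLp 2 fun _ : Fin n => H)) =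
        ⋂ k, {x | ∑ j, ρ (op (q.mat j k)) (x j) = x k} := by
      ext x; simp [TwistSpace]
    rw [h]
    exact isClosed_iInter fun k => isClosed_eq (by fun_prop) (by fun_prop)
  exact this.completeSpace_coe

/-- The elementary tensor `ξ ⊗ e` in `H ⊗_B E = H^n q`: the row of the vectors `ξ · (κ e) j`. -/
noncomputable def tens (ρ : Bᵐᵒᵖ →⋆ₐ[ℂ] (H →L[ℂ] H)) (κ : E ≃ₗ[B] rowModule q.mat) (ξ : H) (e : E) :
    TwistSpace ρ q :=
  ⟨WithLp.toLp 2 fun j => ρ (op ((κ e).1 j)) ξ, fun k => by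
    have h : ∑ j, (κ e).1 j * q.mat j k = (κ e).1 k := congrFun (κ e).2 k
    have h' : ∀ j, ρ (op (q.mat j k)) (ρ (op ((κ e).1 j)) ξ) = ρ (op ((κ e).1 j * q.mat j k)) ξ := by
      intro j
      rw [op_mul, map_mul]
      rfl
    simp only [h']
    conv_rhs => rw [← h]
    rw [Finset.op_sum, map_sum, _root_.sum_apply]⟩

/-- The inner product of `H ⊗_B E` is `⟨ξ · (e|f), η⟩` on elementary tensors. -/
theorem inner_tens (ρ : Bᵐᵒᵖ →⋆ₐ[ℂ] (H →L[ℂ] H)) (κ : E ≃ₗ[B] rowModule q.mat) (ξ η : H) (e f : E) :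
    ⟪tens ρ κ ξ e, tens ρ κ η f⟫_ℂ = ⟪ρ (op (pairing κ e f)) ξ, η⟫_ℂ := by
  have h : ∀ j, ρ (op ((κ e).1 j * star ((κ f).1 j))) ξ =
      ContinuousLinearMap.adjoint (ρ (op ((κ f).1 j))) (ρ (op ((κ e).1 j)) ξ) := by
    intro j
    rw [op_mul, map_mul, op_star, map_star]
    rfl
  rw [pairing, Finset.op_sum, map_sum, _root_.sum_apply, sum_inner]
  simp only [h, ContinuousLinearMap.adjoint_inner_left]
  rfl

/-- Every element of `H ⊗_B E` is a finite sum of elementary tensors. -/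
theorem eq_sum_tens (ρ : Bᵐᵒᵖ →⋆ₐ[ℂ] (H →L[ℂ] H)) (κ : E ≃ₗ[B] rowModule q.mat)
    (x : TwistSpace ρ q) : x = ∑ j, tens ρ κ (x.1 j) (gen κ j) := by
  ext k
  have h := x.2 k
  simpa [tens, gen] using h.symm

/-- The inner products `(e|f)` span a dense subspace of `B` in the operator norm (equivalently, as
this subspace is an ideal, `1` is in its closure). -/
def IsFull (ρ : Bᵐᵒᵖ →⋆ₐ[ℂ] (H →L[ℂ] H)) (κ : E ≃ₗ[B] rowModule q.mat) : Prop :=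
  ∀ b : B, ρ (op b) ∈ closure ((fun z => ρ (op z)) ''
    (Submodule.span ℂ {z | ∃ e f, z = pairing κ e f} : Set B))

/-- The graph of the operator `D̂`, the closure of the operator on `H_∞ ⊗_B E` that sends `ξ ⊗ e` to
`Dξ ⊗ g e + (Γ ⊗ g) (γ ⊗ 1) (ξ ⊗ ∇e)`, with `γ(ξ ⊗ b₀ db₁) = [ΓD, b₁^op] (ξ b₀)`. If `∇e` is the sum
of the `ω j ⊗ gen κ j`, then `(γ ⊗ 1) (ξ ⊗ ∇e)` is the sum of the `S j ξ ⊗ gen κ j` where `ω j` acts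
as `S j`.

If `D = Γ (γ ∘ ∇') + Γ T` on `H_∞`, for a connection `∇'` on the right `B`-module `H_∞` and a
`B`-linear map `T`, then this is the operator
`(Γ ⊗ g) (γ ⊗ 1) (∇' ξ ⊗ e + ξ ⊗ ∇e) + Γ T ξ ⊗ g e`, whatever `∇'` and `T` are. -/
def twistGraph (ρ : Bᵐᵒᵖ →⋆ₐ[ℂ] (H →L[ℂ] H)) (β : AlgGrading B) (D : H →ₗ.[ℂ] H) (Γ : H →L[ℂ] H)
    (κ : E ≃ₗ[B] rowModule q.mat) (g : E →ₗ[ℂ] E) (nabla : E →ₗ[ℂ] (Fin n → BilinDual B)) :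
    Submodule ℂ (TwistSpace ρ q × TwistSpace ρ q) :=
  (Submodule.span ℂ {z | ∃ ξ ∈ smoothDomain D, ∃ (η : H) (e : E) (S : Fin n → (H →L[ℂ] H)),
    (ξ, η) ∈ D.graph ∧ (∀ j, IsFormAction ρ β D Γ (nabla e j) (S j)) ∧
    z = (tens ρ κ ξ e, tens ρ κ η (g e) + ∑ j, tens ρ κ (Γ (S j ξ)) (g (gen κ j)))}
    ).topologicalClosure

end Twist

/-! ## Finite projectivity of `H_∞` over `A` -/

section LeftModule

variable {A H : Type*} [Ring A] [StarRing A] [Algebra ℂ A] [NormedAddCommGroup H]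
  [InnerProductSpace ℂ H] [CompleteSpace H]

/-- `H_∞` is finitely generated and projective as a left `A`-module: it is isomorphic to `A^m p` for
an idempotent `p ∈ M_m(A)`. -/
def SmoothDomainProjective (π : A →⋆ₐ[ℂ] (H →L[ℂ] H)) (D : H →ₗ.[ℂ] H) : Prop :=
  ∃ (m : ℕ) (p : Matrix (Fin m) (Fin m) A) (θ : smoothDomain D →+ (Fin m → A)),
    p * p = p ∧ Function.Injective θ ∧ Set.range θ = rowModule p ∧
    ∀ (a : A) (ξ : smoothDomain D), ∃ h : π a ξ ∈ smoothDomain D, θ ⟨π a ξ, h⟩ = a • θ ξ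

/-- `H = L²(H_∞, ψ)`: for an `A`-valued inner product on the left `A`-module `H_∞`, linear in the
first entry, and a faithful bounded positive linear functional `ψ` on `A`, the scalar product of
`H` on `H_∞` is `ψ` of the `A`-valued one. -/
def IsLTwoSpace (π : A →⋆ₐ[ℂ] (H →L[ℂ] H)) (D : H →ₗ.[ℂ] H) : Prop :=
  ∃ (h : smoothDomain D → smoothDomain D → A) (ψ : A →ₗ[ℂ] ℂ),
    (∀ ξ ξ' η, h (ξ + ξ') η = h ξ η + h ξ' η) ∧
    (∀ (a : A) (ξ η : smoothDomain D), ∃ m : π a ξ ∈ smoothDomain D, h ⟨π a ξ, m⟩ η = a * h ξ η) ∧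
    (∀ ξ η, star (h ξ η) = h η ξ) ∧ (∀ ξ, (π (h ξ ξ)).IsPositive) ∧ (∀ ξ, h ξ ξ = 0 → ξ = 0) ∧
    (∀ a, 0 ≤ ψ (star a * a)) ∧ (∀ a, ψ (star a * a) = 0 → a = 0) ∧
    (∃ c : ℝ, ∀ a, ‖ψ a‖ ≤ c * ‖π a‖) ∧
    ∀ ξ η : smoothDomain D, ⟪(ξ : H), (η : H)⟫_ℂ = ψ (h η ξ)

end LeftModule

set_option linter.unusedSectionVars false

/-! ## Graphs of unbounded operators and bounded commutators -/

section Graphs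

variable {H : Type*} [NormedAddCommGroup H] [InnerProductSpace ℂ H]

/-! The projector supplies a finite frame: every x in H ⊗_B E is the sum of the x_j ⊗ e_j with e_j =
`gen κ j` and x_j = `coord ρ q j x`, and the coordinate maps are the adjoints of ξ ↦ ξ ⊗ e_j. So D̂
can be prescribed on the frame, as `dhat`, for all x with coordinates in Dom D. By the Leibniz rule
for ∇ the formula then holds on every ξ ⊗ e (`connPart_smul`, `tensL_mem_dhat_graph`). One-forms
enter only through matrix coefficients (`Acts`): F acts as the operator with coefficients F(φ),
where φ(x, y) = ⟨η, [ΓD, y^op] x^op ξ⟩. Hence the action does not depend on the series representing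
F, and the rules for products and adjoints hold modulo bilinear forms that factor through the
multiplication, on which one-forms vanish.

Compatibility and evenness of ∇ make D̂ symmetric (`dhat_symmetric`). Pairing a vector of the
adjoint domain with ξ ⊗ g e_j puts its j-th coordinate into Dom D* = Dom D (`coord_mem_graph`), so
the adjoint is no larger than D̂. Spectral cutoffs show that H_∞ is a core of D
(`mem_closure_smooth_graph`), which identifies `dhat` with the closure in the statement.

For summability, the coordinates of a vector in the range of R̂ = (1 + D̂²)^(-1/2) lie in Dom D, the
range of R = (1 + D²)^(-1/2). The closed graph theorem therefore writes R̂ as a finite sum of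
operators X R Z (`factorsThrough_regInv`), and singular values and ideals follow. If E is full, R is
likewise a finite sum of operators X R̂ Z (`factorsThrough_regInv_of_isFull`).

For QC^∞, the modulus of D̂ has no convenient form in coordinates, but D̂² has. If the matrix
entries of T are smooth for |D|, then [D̂², T] = T₁ D̂ + T₀ with T₁, T₀ of the same kind
(`IsExpansionAlgebra.hasExpansion`). With r = R̂ this says that T is smooth for X ↦ [r⁻², X] r. A
Sylvester equation, solved by a series that respects this smoothness (`exists_sylvester`), passes
from r⁻² to r⁻¹, and |D̂| differs from r⁻¹ by a bounded function of r (`memDomInf_of_sqSmooth`).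

Finally, e ↦ ∇(ec) - (∇e)c is B-linear, so [D̂, c^op] is bounded (`exists_isComm_rightHat`). -/

theorem isComm_iff_graph {P : H →ₗ.[ℂ] H} {T T' S : H →L[ℂ] H} :
    IsComm P T T' S ↔ ∀ x y, (x, y) ∈ P.graph → (T x, T' y + S x) ∈ P.graph := by
  constructor
  · intro h x y hxy
    obtain ⟨u, rfl, rfl⟩ := (LinearPMap.mem_graph_iff P).1 hxy
    obtain ⟨hu, h⟩ := h u
    rw [← h, add_sub_cancel]
    exact P.mem_graph ⟨T u, hu⟩
  · intro h x
    obtain ⟨u, hu, hu'⟩ := (LinearPMap.mem_graph_iff P).1 (h x (P x) (P.mem_graph x))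
    simp only at hu hu'
    have hx : T x ∈ P.domain := hu ▸ u.2
    have hxu : (⟨T x, hx⟩ : P.domain) = u := Subtype.ext hu.symm
    exact ⟨hx, by rw [hxu, hu', add_sub_cancel_left]⟩

theorem LinearPMap.graph_unique {P : H →ₗ.[ℂ] H} {x y y' : H} (h : (x, y) ∈ P.graph)
    (h' : (x, y') ∈ P.graph) : y = y' :=
  P.mem_graph_snd_inj h h' rfl

namespace IsComm

variable {P : H →ₗ.[ℂ] H} {T T' S U U' V : H →L[ℂ] H}

theorem add (h : IsComm P T T' S) (h' : IsComm P U U' V) :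
    IsComm P (T + U) (T' + U') (S + V) := by
  rw [isComm_iff_graph] at *
  intro x y hxy
  convert P.graph.add_mem (h x y hxy) (h' x y hxy) using 1
  ext
  · simp
  · simp
    abel

theorem smul (c : ℂ) (h : IsComm P T T' S) : IsComm P (c • T) (c • T') (c • S) := by
  rw [isComm_iff_graph] at *
  intro x y hxy
  convert P.graph.smul_mem c (h x y hxy) using 1
  ext <;> simp

theorem zero : IsComm P 0 0 0 := by
  rw [isComm_iff_graph]
  intro x y _
  simp

theorem one : IsComm P 1 1 0 := by
  rw [isComm_iff_graph]
  intro x y h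
  simpa using h

theorem mul (h : IsComm P T T' S) (h' : IsComm P U U' V) :
    IsComm P (T * U) (T' * U') (S * U + T' * V) := by
  rw [isComm_iff_graph] at *
  intro x y hxy
  convert h _ _ (h' x y hxy) using 1
  ext
  · simp
  · simp
    abel

theorem unique (hd : Dense (P.domain : Set H)) (h : IsComm P T T' S) (h' : IsComm P T T' U) :
    S = U := by
  refine ContinuousLinearMap.ext fun x => ?_
  refine hd.induction (P := fun x => S x = U x) ?_ ?_ x
  · intro x hx
    obtain ⟨_, h⟩ := h ⟨x, hx⟩
    obtain ⟨_, h'⟩ := h' ⟨x, hx⟩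
    exact h.symm.trans h'
  · exact isClosed_eq S.continuous U.continuous

theorem bddComm_eq (hd : Dense (P.domain : Set H)) (h : IsComm P T T' S) :
    bddComm P T T' = S := by
  have hex : ∃ S, IsComm P T T' S := ⟨S, h⟩
  rw [bddComm, dif_pos hex]
  exact unique hd hex.choose_spec h

end IsComm

variable [CompleteSpace H]

theorem isSelfAdjoint_iff_graph {D : H →ₗ.[ℂ] H} (hd : Dense (D.domain : Set H)) :
    IsSelfAdjoint D ↔
      ∀ x y, (x, y) ∈ D.graph ↔ ∀ u v, (u, v) ∈ D.graph → ⟪v, x⟫_ℂ = ⟪u, y⟫_ℂ := by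
  have hg : ∀ x y, (x, y) ∈ D.adjoint.graph ↔
      ∀ u v, (u, v) ∈ D.graph → ⟪v, x⟫_ℂ = ⟪u, y⟫_ℂ := by
    intro x y
    rw [LinearPMap.adjoint_graph_eq_graph_adjoint hd, Submodule.mem_adjoint_iff]
    simp only [sub_eq_zero]
  rw [LinearPMap.isSelfAdjoint_def]
  constructor
  · intro h x y
    rw [← hg, h]
  · intro h
    refine LinearPMap.eq_of_eq_graph ?_
    ext ⟨x, y⟩
    rw [hg, h]

namespace IsSelfAdjoint

variable {D : H →ₗ.[ℂ] H} (hD : IsSelfAdjoint D)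
include hD

theorem mem_graph_iff_inner {x y : H} :
    (x, y) ∈ D.graph ↔ ∀ u v, (u, v) ∈ D.graph → ⟪v, x⟫_ℂ = ⟪u, y⟫_ℂ :=
  (isSelfAdjoint_iff_graph hD.dense_domain).1 hD x y

theorem graph_symm {x y u v : H} (h : (x, y) ∈ D.graph) (h' : (u, v) ∈ D.graph) :
    ⟪y, u⟫_ℂ = ⟪x, v⟫_ℂ :=
  hD.mem_graph_iff_inner.1 h' x y h

theorem isClosed_graph : IsClosed (D.graph : Set (H × H)) :=
  IsSelfAdjoint.isClosed hD

/-- Moving the operators across the inner product gives the defining relation of the adjoint of D,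
which is D itself. -/
theorem isComm_adjoint {T T' S : H →L[ℂ] H} (h : IsComm D T T' S) :
    IsComm D (star T') (star T) (-star S) := by
  rw [isComm_iff_graph] at *
  intro x y hxy
  rw [hD.mem_graph_iff_inner]
  intro u v huv
  have h1 := hD.graph_symm (h u v huv) hxy
  have e : ∀ (A : H →L[ℂ] H) a b, ⟪a, (star A) b⟫_ℂ = ⟪A a, b⟫_ℂ := fun A a b =>
    ContinuousLinearMap.adjoint_inner_right A a b
  rw [inner_add_left] at h1
  simp only [inner_add_right, neg_apply, inner_neg_right, e, ← h1]
  ring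

end IsSelfAdjoint

end Graphs

/-! ## The bounded transform of a selfadjoint operator -/

section BoundedTransform

variable {H : Type*} [NormedAddCommGroup H] [InnerProductSpace ℂ H] [CompleteSpace H]

theorem IsSelfAdjoint.inner_symm {A : H →L[ℂ] H} (hA : IsSelfAdjoint A) (x y : H) :
    ⟪A x, y⟫_ℂ = ⟪x, A y⟫_ℂ :=
  hA.isSymmetric x y

/-- R is the positive square root of R², hence lies in the functional calculus of R². -/
theorem commute_of_commute_mul_self {R X : H →L[ℂ] H} (hR : 0 ≤ R) (h : Commute (R * R) X) :
    Commute R X := by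
  have := h.cfc_nnreal NNReal.sqrt
  rwa [← CFC.sqrt_eq_cfc, CFC.sqrt_mul_self R hR] at this

theorem denseRange_of_isSelfAdjoint {R : H →L[ℂ] H} (hR : IsSelfAdjoint R)
    (hi : Function.Injective R) : DenseRange R := by
  have h := R.orthogonal_range
  rw [hR.adjoint_eq, LinearMap.ker_eq_bot.2 hi, ← Submodule.topologicalClosure_eq_top_iff,
    ← Submodule.dense_iff_topologicalClosure_eq_top] at h
  exact h

theorem isPositive_of_inner_nonneg {K : Type*} [NormedAddCommGroup K] [InnerProductSpace ℂ K]
    {T : K →L[ℂ] K} (h : ∀ x, 0 ≤ ⟪T x, x⟫_ℂ) : 0 ≤ T := by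
  rw [ContinuousLinearMap.nonneg_iff_isPositive, ContinuousLinearMap.isPositive_iff_complex]
  intro x
  obtain ⟨h1, h2⟩ := Complex.nonneg_iff.1 (h x)
  refine ⟨?_, h1⟩
  apply Complex.ext <;> simp [← h2]

/-- `D` is the selfadjoint operator with graph `{(R z, F z)}`, that is `R = (1 + D²)^(-1/2)` and
`F = D (1 + D²)^(-1/2)`. -/
structure IsBoundedTransform (D : H →ₗ.[ℂ] H) (R F : H →L[ℂ] H) : Prop where
  nonneg : 0 ≤ R
  inj : Function.Injective R
  selfAdjoint : IsSelfAdjoint F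
  comm : Commute R F
  sq : F * F + R * R = 1
  graph : ∀ x y, (x, y) ∈ D.graph ↔ ∃ z, R z = x ∧ F z = y

/-- Injectivity of 1 + D²: the difference w = u - u' has D² w = -w, so ‖D w‖² = ⟨w, D² w⟩ = -‖w‖²
and w vanishes. -/
theorem SqRel.unique {D : H →ₗ.[ℂ] H} (hD : IsSelfAdjoint D) {u u' z z' : H}
    (h : SqRel D u z) (h' : SqRel D u' z') (he : u + z = u' + z') : u = u' := by
  obtain ⟨y, h1, h2⟩ := h
  obtain ⟨y', h1', h2'⟩ := h'
  have e1 := D.graph.sub_mem h1 h1'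
  have e2 := D.graph.sub_mem h2 h2'
  have e3 := hD.graph_symm e1 e2
  change ⟪y - y', y - y'⟫_ℂ = ⟪u - u', z - z'⟫_ℂ at e3
  have : z - z' = -(u - u') := by
    have : z = u' + z' - u := by rw [← he]; abel
    rw [this]; abel
  rw [this, inner_neg_right, inner_self_eq_norm_sq_to_K, inner_self_eq_norm_sq_to_K] at e3
  have e4 : ‖y - y'‖ ^ 2 + ‖u - u'‖ ^ 2 = 0 := by
    have : ((‖y - y'‖ ^ 2 + ‖u - u'‖ ^ 2 : ℝ) : ℂ) = 0 := by
      push_cast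
      exact (congrArg (· + (‖u - u'‖ : ℂ) ^ 2) e3).trans (neg_add_cancel _)
    exact_mod_cast this
  have : ‖u - u'‖ = 0 := by nlinarith [sq_nonneg ‖y - y'‖, sq_nonneg ‖u - u'‖]
  exact sub_eq_zero.1 (norm_eq_zero.1 this)

/-- Von Neumann's argument: the orthogonal projection of (x, 0) onto the closed graph of D has first
component (1 + D²)⁻¹ x. Then R is the square root of this positive operator. -/
theorem exists_isRegInv {D : H →ₗ.[ℂ] H} (hD : IsSelfAdjoint D) : ∃ R, IsRegInv D R := by
  let e := WithLp.prodContinuousLinearEquiv 2 ℂ H H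
  let G : Submodule ℂ (WithLp 2 (H × H)) := D.graph.comap e.toLinearMap
  have hG : IsClosed (G : Set (WithLp 2 (H × H))) := hD.isClosed_graph.preimage e.continuous
  have : CompleteSpace G := hG.completeSpace_coe
  let q : H →L[ℂ] H × H := e.toContinuousLinearMap ∘L G.starProjection ∘L
    e.symm.toContinuousLinearMap ∘L ContinuousLinearMap.inl ℂ H H
  have h1 : ∀ x, ((q x).1, (q x).2) ∈ D.graph := fun x =>
    G.starProjection_apply_mem (e.symm (x, 0))
  -- Orthogonality of the remainder to the graph says that the second component lies in the domain
  -- of the adjoint of D.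
  have h2 : ∀ x, ((q x).2, x - (q x).1) ∈ D.graph := by
    intro x
    rw [hD.mem_graph_iff_inner]
    intro u v huv
    have := G.sub_starProjection_mem_orthogonal (e.symm (x, 0)) (e.symm (u, v)) huv
    rw [WithLp.prod_inner_apply] at this
    have h3 : ⟪u, x - (q x).1⟫_ℂ + ⟪v, 0 - (q x).2⟫_ℂ = 0 := this
    rw [zero_sub, inner_neg_right] at h3
    linear_combination -h3
  let Lo : H →L[ℂ] H := ContinuousLinearMap.fst ℂ H H ∘L q
  have hL : 0 ≤ Lo := by
    refine isPositive_of_inner_nonneg fun x => ?_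
    have : ⟪(q x).1, x⟫_ℂ = ⟪(q x).1, (q x).1⟫_ℂ + ⟪(q x).2, (q x).2⟫_ℂ := by
      rw [hD.graph_symm (h1 x) (h2 x), ← inner_add_right, add_sub_cancel]
    change 0 ≤ ⟪(q x).1, x⟫_ℂ
    rw [this]
    rw [inner_self_eq_norm_sq_to_K, inner_self_eq_norm_sq_to_K]
    norm_cast
    exact Complex.zero_le_real.2 (by positivity)
  refine ⟨CFC.sqrt Lo, (ContinuousLinearMap.nonneg_iff_isPositive _).1 (CFC.sqrt_nonneg Lo),
    fun x => ?_⟩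
  have h3 : CFC.sqrt Lo (CFC.sqrt Lo x) = (q x).1 :=
    congrArg (fun T : H →L[ℂ] H => T x) (CFC.sqrt_mul_sqrt_self Lo hL)
  rw [h3]
  exact ⟨x - (q x).1, ⟨(q x).2, h1 x, h2 x⟩, by abel⟩

/-- Since ‖D R² w‖² = ‖R w‖² - ‖R² w‖², the map R w ↦ D R² w is contractive on the dense range of R.
Its extension is F = D R. -/
theorem IsRegInv.exists_isBoundedTransform {D : H →ₗ.[ℂ] H} (hD : IsSelfAdjoint D)
    {R : H →L[ℂ] H} (h : IsRegInv D R) : ∃ F, IsBoundedTransform D R F := by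
  have hR := (ContinuousLinearMap.nonneg_iff_isPositive R).2 h.1
  have hRs : IsSelfAdjoint R := hR.isSelfAdjoint
  have hinj : Function.Injective R := by
    rw [injective_iff_map_eq_zero]
    intro x hx
    obtain ⟨z, ⟨y, h1, h2⟩, he⟩ := h.2 x
    rw [hx, map_zero] at h1 he
    have hy := LinearPMap.graph_unique h1 D.graph.zero_mem
    have hz := LinearPMap.graph_unique (hy ▸ h2) D.graph.zero_mem
    rw [← he, hz]
    simp
  have hdense := denseRange_of_isSelfAdjoint hRs hinj
  -- `Y w = D R² w`
  have hS : ∀ w, ∃ y, (R (R w), y) ∈ D.graph ∧ (y, w - R (R w)) ∈ D.graph := by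
    intro w
    obtain ⟨z, ⟨y, h1, h2⟩, he⟩ := h.2 w
    exact ⟨y, h1, by rwa [← eq_sub_of_add_eq' he]⟩
  choose Y hY1 hY2 using hS
  let Yl : H →ₗ[ℂ] H :=
    { toFun := Y
      map_add' := fun a b => LinearPMap.graph_unique (hY1 (a + b))
        (by simpa using D.graph.add_mem (hY1 a) (hY1 b))
      map_smul' := fun c a => LinearPMap.graph_unique (hY1 (c • a))
        (by simpa using D.graph.smul_mem c (hY1 a)) }
  have hYn : ∀ w, ‖Yl w‖ ≤ 1 * ‖(R : H →ₗ[ℂ] H) w‖ := by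
    intro w
    have e1 := hD.graph_symm (hY1 w) (hY2 w)
    rw [inner_sub_right, hRs.inner_symm (R w) w, inner_self_eq_norm_sq_to_K,
      inner_self_eq_norm_sq_to_K, inner_self_eq_norm_sq_to_K] at e1
    have e2 : ‖Y w‖ ^ 2 = ‖R w‖ ^ 2 - ‖R (R w)‖ ^ 2 := by exact_mod_cast e1
    rw [one_mul]
    exact abs_le_of_sq_le_sq' (by simpa [Yl] using (by nlinarith [sq_nonneg ‖R (R w)‖] :
      ‖Y w‖ ^ 2 ≤ ‖R w‖ ^ 2)) (norm_nonneg _) |>.2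
  let F : H →L[ℂ] H := Yl.extendOfNorm (R : H →ₗ[ℂ] H)
  have hF : ∀ w, F (R w) = Y w := LinearMap.extendOfNorm_eq hdense ⟨1, hYn⟩
  have hgr : ∀ z, (R z, F z) ∈ D.graph := by
    intro z
    refine hdense.induction_on (p := fun z => (R z, F z) ∈ D.graph) z
      (hD.isClosed_graph.preimage (R.continuous.prodMk F.continuous)) fun w => ?_
    rw [hF]
    exact hY1 w
  -- For x = R z and y = F z the candidate is R² z + F* F z, which is z once F² + R² = 1 is known.
  -- The adjoint is kept because F is not yet known to be selfadjoint.
  have hgr' : ∀ x y, (x, y) ∈ D.graph → R (R x + star F y) = x ∧ F (R x + star F y) = y := by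
    intro x y hxy
    have : R (R x + star F y) = x := by
      refine ext_inner_right ℂ fun w => ?_
      rw [hRs.inner_symm, inner_add_left, hRs.inner_symm]
      erw [ContinuousLinearMap.adjoint_inner_left]
      rw [hF, hD.graph_symm hxy (hY2 w), ← inner_add_right, add_sub_cancel]
    have h1 := hgr (R x + star F y)
    rw [this] at h1
    exact ⟨this, LinearPMap.graph_unique h1 hxy⟩
  -- Both R² F z and F R² z solve (1 + D²) u = F z.
  have hcomm2 : Commute (R * R) F := by
    refine ContinuousLinearMap.ext fun z => ?_
    change R (R (F z)) = F (R (R z))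
    rw [hF]
    have h1 : SqRel D (R (R (F z))) (F z - R (R (F z))) := ⟨_, hY1 _, hY2 _⟩
    have h2 := D.graph.sub_mem (hgr z) (hY1 (R z))
    have h3 : SqRel D (Y (R z)) (F z - Y (R z)) := ⟨_, hY2 _, h2⟩
    exact SqRel.unique hD h1 h3 (by abel)
  have hcomm := commute_of_commute_mul_self hR hcomm2
  have hcomm' : ∀ z, R (F z) = F (R z) := fun z => congrArg (fun T : H →L[ℂ] H => T z) hcomm.eq
  refine ⟨F, hR, hinj, ?_, hcomm, ?_, fun x y => ⟨fun hxy => ⟨_, hgr' x y hxy⟩, ?_⟩⟩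
  · rw [ContinuousLinearMap.isSelfAdjoint_iff_isSymmetric]
    intro x y
    refine hdense.induction_on (p := fun x => ⟪F x, y⟫_ℂ = ⟪x, F y⟫_ℂ) x
      (isClosed_eq (by fun_prop) (by fun_prop)) fun w => ?_
    refine hdense.induction_on (p := fun y => ⟪F (R w), y⟫_ℂ = ⟪R w, F y⟫_ℂ) y
      (isClosed_eq (by fun_prop) (by fun_prop)) fun v => ?_
    rw [hF, hD.graph_symm (hY1 w) (hgr v), hRs.inner_symm, hcomm']
  · refine ContinuousLinearMap.ext fun w => ?_
    have h1 := hgr (F w)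
    rw [hcomm', hF] at h1
    change F (F w) + R (R w) = w
    rw [LinearPMap.graph_unique h1 (hY2 w), sub_add_cancel]
  · rintro ⟨z, rfl, rfl⟩
    exact hgr z

namespace IsBoundedTransform

variable {D : H →ₗ.[ℂ] H} {R F : H →L[ℂ] H} (h : IsBoundedTransform D R F)
include h

theorem isSelfAdjoint_left : IsSelfAdjoint R := h.nonneg.isSelfAdjoint

theorem comm_apply (z : H) : R (F z) = F (R z) :=
  congrArg (fun T : H →L[ℂ] H => T z) h.comm.eq

theorem sq_apply (z : H) : F (F z) + R (R z) = z :=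
  congrArg (fun T : H →L[ℂ] H => T z) h.sq

theorem mem_graph (z : H) : (R z, F z) ∈ D.graph := (h.graph _ _).2 ⟨z, rfl, rfl⟩

theorem denseRange : DenseRange R := denseRange_of_isSelfAdjoint h.isSelfAdjoint_left h.inj

theorem mem_domain_iff {x : H} : x ∈ D.domain ↔ ∃ z, R z = x := by
  rw [LinearPMap.mem_domain_iff]
  constructor
  · rintro ⟨y, hy⟩
    obtain ⟨z, hz, _⟩ := (h.graph x y).1 hy
    exact ⟨z, hz⟩
  · rintro ⟨z, rfl⟩
    exact ⟨_, h.mem_graph z⟩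

theorem dense_domain : Dense (D.domain : Set H) :=
  h.denseRange.mono (by rintro _ ⟨z, rfl⟩; exact h.mem_domain_iff.2 ⟨z, rfl⟩)

/-- The vector `z` with `x = R z` is `R x + F D x`. -/
theorem eq_of_mem_graph {x y : H} (hxy : (x, y) ∈ D.graph) :
    R (R x + F y) = x ∧ F (R x + F y) = y := by
  obtain ⟨z, rfl, rfl⟩ := (h.graph x y).1 hxy
  have : R (R z) + F (F z) = z := by rw [add_comm, h.sq_apply]
  rw [this]
  exact ⟨rfl, rfl⟩

/-- A pair (x, y) in the graph of the adjoint satisfies F x = R y, as pairing with all (R z, F z)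
shows. Then z = R x + F y is mapped to (x, y) because F² + R² = 1. -/
theorem isSelfAdjoint : IsSelfAdjoint D := by
  rw [isSelfAdjoint_iff_graph h.dense_domain]
  have hRs := h.isSelfAdjoint_left
  intro x y
  constructor
  · intro hxy u v huv
    obtain ⟨z, rfl, rfl⟩ := (h.graph x y).1 hxy
    obtain ⟨w, rfl, rfl⟩ := (h.graph u v).1 huv
    rw [h.selfAdjoint.inner_symm, ← h.comm_apply, ← hRs.inner_symm]
  · intro hxy
    have e : F x = R y := by
      refine ext_inner_left ℂ fun z => ?_
      rw [← h.selfAdjoint.inner_symm, ← hRs.inner_symm]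
      exact hxy _ _ (h.mem_graph z)
    refine (h.graph x y).2 ⟨R x + F y, ?_, ?_⟩
    · rw [map_add, h.comm_apply, ← e, add_comm, h.sq_apply]
    · rw [map_add, ← h.comm_apply, e, add_comm, h.sq_apply]

theorem sqRel_iff {x z : H} : SqRel D x z ↔ ∃ w, R (R w) = x ∧ F (F w) = z := by
  constructor
  · rintro ⟨y, h1, h2⟩
    obtain ⟨a, rfl, rfl⟩ := (h.graph _ _).1 h1
    obtain ⟨b, hb, rfl⟩ := (h.graph _ _).1 h2
    refine ⟨R a + F b, ?_⟩
    have : R (R a + F b) = a := by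
      rw [map_add, h.comm_apply, hb, add_comm, h.sq_apply]
    rw [this]
    refine ⟨rfl, ?_⟩
    have : F (R a + F b) = b := by
      rw [map_add, ← h.comm_apply, ← hb, add_comm, h.sq_apply]
    rw [this]
  · rintro ⟨w, rfl, rfl⟩
    exact ⟨F (R w), h.mem_graph _, h.comm_apply w ▸ h.mem_graph _⟩

theorem isRegInv : IsRegInv D R :=
  ⟨(ContinuousLinearMap.nonneg_iff_isPositive R).1 h.nonneg, fun x =>
    ⟨F (F x), h.sqRel_iff.2 ⟨x, rfl, rfl⟩, by rw [add_comm, h.sq_apply]⟩⟩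

end IsBoundedTransform

theorem exists_isBoundedTransform {D : H →ₗ.[ℂ] H} (hD : IsSelfAdjoint D) :
    ∃ R F, IsBoundedTransform D R F := by
  obtain ⟨R, hR⟩ := exists_isRegInv hD
  exact ⟨R, hR.exists_isBoundedTransform hD⟩

/-- The operator with graph `{(R z, F z)}`. -/
theorem exists_of_boundedTransform {R F : H →L[ℂ] H} (hR : 0 ≤ R) (hi : Function.Injective R)
    (hF : IsSelfAdjoint F) (hc : Commute R F) (hsq : F * F + R * R = 1) :
    ∃ D, IsBoundedTransform D R F := by
  let G : Submodule ℂ (H × H) := LinearMap.range ((R : H →ₗ[ℂ] H).prod (F : H →ₗ[ℂ] H))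
  have hG : G.toLinearPMap.graph = G := by
    refine Submodule.toLinearPMap_graph_eq G ?_
    rintro _ ⟨z, rfl⟩ hz
    have : z = 0 := hi (by simpa using hz)
    simp [this]
  refine ⟨G.toLinearPMap, hR, hi, hF, hc, hsq, fun x y => ?_⟩
  rw [hG]
  simp [G, Prod.ext_iff]

theorem nonneg_sub_sq {D : H →ₗ.[ℂ] H} {R F : H →L[ℂ] H} (h : IsBoundedTransform D R F) :
    0 ≤ F * F := by
  have := star_mul_self_nonneg F
  rwa [h.selfAdjoint.star_eq] at this

theorem IsModulus.exists_isBoundedTransform {D P : H →ₗ.[ℂ] H} {R F : H →L[ℂ] H}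
    (h : IsBoundedTransform D R F) (hP : IsModulus D P) :
    ∃ G, 0 ≤ G ∧ IsBoundedTransform P R G := by
  obtain ⟨hsa, hpos, hsq⟩ := hP
  have hR : IsRegInv P R := by
    refine ⟨h.isRegInv.1, fun x => ?_⟩
    obtain ⟨z, hz, he⟩ := h.isRegInv.2 x
    exact ⟨z, (hsq _ _).2 hz, he⟩
  obtain ⟨G, hG⟩ := hR.exists_isBoundedTransform hsa
  refine ⟨G, ?_, hG⟩
  -- For s = √R one has ⟨G s z, s z⟩ = ⟨P R z, R z⟩, so positivity of P on its domain gives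
  -- positivity of G on the dense range of s.
  let s := CFC.sqrt R
  have hs : 0 ≤ s := CFC.sqrt_nonneg R
  have hss : s * s = R := CFC.sqrt_mul_sqrt_self R h.nonneg
  have hsinj : Function.Injective s := by
    have : Function.Injective (s * s) := hss ▸ h.inj
    exact fun a b hab => this (by simp [hab])
  have hsG : Commute s G := commute_of_commute_mul_self hs (hss ▸ hG.comm)
  have hsG' : ∀ z, s (G z) = G (s z) := fun z => congrArg (fun T : H →L[ℂ] H => T z) hsG.eq
  have hss' : ∀ z, s (s z) = R z := fun z => congrArg (fun T : H →L[ℂ] H => T z) hss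
  refine isPositive_of_inner_nonneg fun x => ?_
  refine (denseRange_of_isSelfAdjoint hs.isSelfAdjoint hsinj).induction_on
    (p := fun x => 0 ≤ ⟪G x, x⟫_ℂ) x ?_ fun z => ?_
  · exact isClosed_le continuous_const (by fun_prop)
  · rw [← hs.isSelfAdjoint.inner_symm, hsG', hss', hG.selfAdjoint.inner_symm]
    have h1 := hpos ⟨R z, hG.mem_domain_iff.2 ⟨z, rfl⟩⟩
    have h2 : P ⟨R z, hG.mem_domain_iff.2 ⟨z, rfl⟩⟩ = G z :=
      LinearPMap.graph_unique (P.mem_graph ⟨R z, _⟩) (hG.mem_graph z)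
    rw [h2] at h1
    have h3 : ⟪R z, G z⟫_ℂ = ⟪G z, R z⟫_ℂ := by
      rw [h.isSelfAdjoint_left.inner_symm, hG.comm_apply, ← hG.selfAdjoint.inner_symm]
    rw [h3]
    refine Complex.nonneg_iff.2 ⟨h1, ?_⟩
    have h4 := congrArg Complex.im (inner_conj_symm (𝕜 := ℂ) (R z) (G z))
    rw [h3] at h4
    simp only [Complex.conj_im] at h4
    linarith

/-- The modulus is the operator whose bounded transform is (R, √(F²)). -/
theorem IsBoundedTransform.exists_isModulus {D : H →ₗ.[ℂ] H} {R F : H →L[ℂ] H}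
    (h : IsBoundedTransform D R F) :
    ∃ P G, IsModulus D P ∧ 0 ≤ G ∧ IsBoundedTransform P R G := by
  have hFF := nonneg_sub_sq h
  let G := CFC.sqrt (F * F)
  have hG : 0 ≤ G := CFC.sqrt_nonneg _
  have hGG : G * G = F * F := CFC.sqrt_mul_sqrt_self _ hFF
  have hc : Commute G R := by
    refine commute_of_commute_mul_self hG ?_
    rw [hGG]
    exact (h.comm.mul_right h.comm).symm
  obtain ⟨P, hP⟩ := exists_of_boundedTransform h.nonneg h.inj hG.isSelfAdjoint hc.symm
    (by rw [hGG, h.sq])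
  refine ⟨P, G, ⟨hP.isSelfAdjoint, fun x => ?_, fun x z => ?_⟩, hG, hP⟩
  · obtain ⟨z, hz1, hz2⟩ := (hP.graph _ _).1 (P.mem_graph x)
    rw [← hz1, ← hz2]
    have : 0 ≤ R * G := Commute.mul_nonneg h.nonneg hG hc.symm
    have h1 := ((ContinuousLinearMap.nonneg_iff_isPositive _).1 this).inner_nonneg_left z
    have h2 : ⟪G z, R z⟫_ℂ = ⟪(R * G) z, z⟫_ℂ := (h.isSelfAdjoint_left.inner_symm _ _).symm
    rw [h2]
    exact (Complex.nonneg_iff.1 h1).1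
  · rw [hP.sqRel_iff, h.sqRel_iff]
    have : ∀ w, G (G w) = F (F w) := fun w => congrArg (fun T : H →L[ℂ] H => T w) hGG
    simp only [this]

end BoundedTransform

/-! ## The smooth domain is a core -/

section Core

variable {H : Type*} [NormedAddCommGroup H] [InnerProductSpace ℂ H] [CompleteSpace H]

/-- A continuous function of R that vanishes near 0 has range inside the range of every power of R,
hence inside H_∞. Such functions approximate R uniformly on its spectrum. -/
theorem IsBoundedTransform.dense_smooth {D : H →ₗ.[ℂ] H} {R F : H →L[ℂ] H}
    (h : IsBoundedTransform D R F) : Dense {z | R z ∈ smoothDomain D} := by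
  have hRs := h.isSelfAdjoint_left
  have key : ∀ ε : ℝ, 0 < ε → ∀ w, ∃ z, R z ∈ smoothDomain D ∧ ‖z - R w‖ ≤ ε * ‖w‖ := by
    intro ε hε w
    let f : ℝ → ℝ := fun s => max (s - ε) 0
    -- On the spectrum this is s^(1-k) f(s) made continuous at 0: the denominator differs from s^k
    -- only where f vanishes. Thus D^k R f(R) w = F^k g_k(R) w.
    let g : ℕ → ℝ → ℝ := fun k s => s * f s / max s ε ^ k
    have hmax : ∀ s, 0 < max s ε := fun s => lt_max_of_lt_right hε
    have hf : Continuous f := by fun_prop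
    have hg : ∀ k, Continuous (g k) := fun k =>
      (continuous_id.mul hf).div (by fun_prop) fun s => (pow_pos (hmax s) k).ne'
    have h0 : cfc (g 0) R = R * cfc f R := by
      have : g 0 = fun s => id s * f s := by ext s; simp [g]
      rw [this, cfc_mul id f R continuous_id.continuousOn hf.continuousOn, cfc_id ℝ R]
    have hs : ∀ k, cfc (g k) R = R * cfc (g (k + 1)) R := by
      intro k
      have : g k = fun s => id s * g (k + 1) s := by
        ext s
        have := (hmax s).ne'
        by_cases hse : s ≤ ε
        · have : f s = 0 := max_eq_right (by linarith)
          simp [g, this]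
        · have hm : max s ε = s := max_eq_left (by linarith)
          have : s ≠ 0 := by linarith
          simp only [g, hm, id]
          field_simp
          ring
      rw [this, cfc_mul id (g (k + 1)) R continuous_id.continuousOn (hg _).continuousOn,
        cfc_id ℝ R]
    have hn : ‖cfc f R - R‖ ≤ ε := by
      have : cfc f R - R = cfc (fun s => f s - id s) R := by
        rw [cfc_sub f id R hf.continuousOn continuous_id.continuousOn, cfc_id ℝ R]
      rw [this]
      refine norm_cfc_le hε.le fun s hs => ?_
      have hs0 : 0 ≤ s := spectrum_nonneg_of_nonneg h.nonneg hs
      rw [Real.norm_eq_abs, abs_le]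
      simp only [f, id]
      constructor
      · linarith [le_max_left (s - ε) 0]
      · rcases max_cases (s - ε) 0 with h | h <;> linarith
    refine ⟨cfc f R w, ⟨fun k => (F ^ k) (cfc (g k) R w), ?_, fun k => ?_⟩, ?_⟩
    · simp only [h0, pow_zero]
      rfl
    · refine (h.graph _ _).2 ⟨(F ^ k) (cfc (g (k + 1)) R w), ?_, ?_⟩
      · have : R * F ^ k = F ^ k * R := (h.comm.pow_right k).eq
        simp only [hs k]
        exact congrArg (fun T : H →L[ℂ] H => T (cfc (g (k + 1)) R w)) this
      · simp only [pow_succ']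
        rfl
    · have : cfc f R w - R w = (cfc f R - R) w := rfl
      rw [this]
      exact (ContinuousLinearMap.le_opNorm _ _).trans (by gcongr)
  have h1 : Set.range R ⊆ closure {z | R z ∈ smoothDomain D} := by
    rintro _ ⟨w, rfl⟩
    rw [Metric.mem_closure_iff]
    intro ε hε
    obtain ⟨z, hz, hzn⟩ := key (ε / (‖w‖ + 1)) (by positivity) w
    refine ⟨z, hz, ?_⟩
    rw [dist_comm, dist_eq_norm]
    refine hzn.trans_lt ?_
    rw [div_mul_eq_mul_div, div_lt_iff₀ (by positivity)]
    nlinarith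
  have h2 := closure_minimal h1 isClosed_closure
  rw [h.denseRange.closure_range] at h2
  exact fun x => h2 (Set.mem_univ x)

/-- The graph is the continuous image of H under z ↦ (R z, F z), so density of the z with R z in H_∞
suffices. -/
theorem mem_closure_smooth_graph {D : H →ₗ.[ℂ] H} (hD : IsSelfAdjoint D) {x y : H}
    (hxy : (x, y) ∈ D.graph) :
    (x, y) ∈ closure {z : H × H | z.1 ∈ smoothDomain D ∧ z ∈ D.graph} := by
  obtain ⟨R, F, h⟩ := exists_isBoundedTransform hD
  obtain ⟨z, rfl, rfl⟩ := (h.graph x y).1 hxy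
  have hc : Continuous fun z => (R z, F z) := by fun_prop
  exact map_mem_closure (f := fun z => (R z, F z)) hc (h.dense_smooth z) fun w hw => ⟨hw, h.mem_graph w⟩

end Core

/-! ## Operators that factor through others -/

section Ideals

universe u

variable {H K : Type u} [NormedAddCommGroup H] [InnerProductSpace ℂ H]
  [NormedAddCommGroup K] [InnerProductSpace ℂ K]

/-- `T` is a finite sum of operators `X S Z`. -/
def FactorsThrough (T : K →L[ℂ] K) (S : H →L[ℂ] H) : Prop :=
  ∃ (n : ℕ) (X : Fin n → (H →L[ℂ] K)) (Z : Fin n → (K →L[ℂ] H)),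
    T = ∑ j, X j ∘L S ∘L Z j

theorem singVal_nonneg (T : H →L[ℂ] H) (k : ℕ) : 0 ≤ singVal T k :=
  Real.sInf_nonneg (by rintro _ ⟨F, _, rfl⟩; exact norm_nonneg _)

theorem singVal_le (T : H →L[ℂ] H) {k : ℕ} {F : H →L[ℂ] H} (hF : F.rank ≤ (k : Cardinal)) :
    singVal T k ≤ ‖T - F‖ :=
  csInf_le ⟨0, by rintro _ ⟨F, _, rfl⟩; exact norm_nonneg _⟩ ⟨F, hF, rfl⟩

namespace FactorsThrough

variable {T : K →L[ℂ] K} {S : H →L[ℂ] H} (h : FactorsThrough T S)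
include h

theorem isCompactOperator (hS : IsCompactOperator S) : IsCompactOperator T := by
  obtain ⟨n, X, Z, rfl⟩ := h
  have : ∀ s : Finset (Fin n),
      IsCompactOperator (∑ j ∈ s, X j ∘L S ∘L Z j : K →L[ℂ] K) := by
    intro s
    induction s using Finset.induction_on with
    | empty => simpa using isCompactOperator_zero
    | insert a s ha ih =>
      rw [Finset.sum_insert ha]
      exact ((hS.comp_clm (Z a)).clm_comp (X a)).add ih
  exact this Finset.univ

theorem mem_idealOn {I : TwoSidedIdeal (H →L[ℂ] H)} (hS : S ∈ I) : T ∈ idealOn I K := by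
  obtain ⟨n, X, Z, rfl⟩ := h
  exact Submodule.sum_mem _ fun j _ => Submodule.subset_span ⟨S, hS, X j, Z j, rfl⟩

/-- If F has rank at most m / (n + 1), then the sum of the n operators X_j F Z_j has rank at most m
and approximates T up to a constant times ‖S - F‖. -/
theorem exists_singVal_le :
    ∃ (a : ℕ) (C : ℝ), 0 < a ∧ 0 < C ∧ ∀ m, singVal T m ≤ C * singVal S (m / a) := by
  obtain ⟨n, X, Z, rfl⟩ := h
  -- The extra 1 in both constants keeps them positive when the sum is empty or zero.
  refine ⟨n + 1, 1 + ∑ j, ‖X j‖ * ‖Z j‖, n.succ_pos, by positivity, fun m => ?_⟩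
  set C := 1 + ∑ j, ‖X j‖ * ‖Z j‖ with hC
  have hC0 : 0 < C := by positivity
  rw [← div_le_iff₀' hC0]
  refine le_csInf ⟨_, 0, by simp, rfl⟩ ?_
  rintro _ ⟨F, hF, rfl⟩
  rw [div_le_iff₀' hC0]
  have hrank : (∑ j, X j ∘L F ∘L Z j).rank ≤ (m : Cardinal) := by
    have h1 : ∀ s : Finset (Fin n), (∑ j ∈ s, X j ∘L F ∘L Z j).rank ≤
        ((s.card * (m / (n + 1)) : ℕ) : Cardinal) := by
      intro s
      induction s using Finset.induction_on with
      | empty => simp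
      | insert a s ha ih =>
        rw [Finset.sum_insert ha, Finset.card_insert_of_notMem ha, add_mul, one_mul, add_comm,
          Nat.cast_add]
        refine (LinearMap.rank_add_le _ _).trans (add_le_add ?_ ?_)
        · exact ih
        · have h2 : LinearMap.rank ((X a).toLinearMap ∘ₗ (F.toLinearMap ∘ₗ (Z a).toLinearMap)) ≤
              LinearMap.rank F.toLinearMap :=
            (LinearMap.rank_comp_le_right _ _).trans (LinearMap.rank_comp_le_left _ _)
          exact h2.trans hF
    refine (h1 Finset.univ).trans ?_
    rw [Finset.card_univ, Fintype.card_fin]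
    exact_mod_cast (Nat.mul_le_mul_right _ (Nat.le_succ n)).trans (Nat.mul_div_le m (n + 1))
  refine (singVal_le _ hrank).trans ?_
  rw [← Finset.sum_sub_distrib]
  have h3 : ∀ j, ‖X j ∘L S ∘L Z j - X j ∘L F ∘L Z j‖ ≤ ‖X j‖ * ‖Z j‖ * ‖S - F‖ := by
    intro j
    have : X j ∘L S ∘L Z j - X j ∘L F ∘L Z j = X j ∘L (S - F) ∘L Z j := by
      ext x; simp
    rw [this]
    calc _ ≤ ‖X j‖ * (‖S - F‖ * ‖Z j‖) :=
          (ContinuousLinearMap.opNorm_comp_le _ _).trans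
            (by gcongr; exact ContinuousLinearMap.opNorm_comp_le _ _)
      _ = _ := by ring
  calc _ ≤ ∑ j, ‖X j‖ * ‖Z j‖ * ‖S - F‖ := (norm_sum_le _ _).trans (Finset.sum_le_sum fun j _ => h3 j)
    _ = (∑ j, ‖X j‖ * ‖Z j‖) * ‖S - F‖ := by rw [Finset.sum_mul]
    _ ≤ C * ‖S - F‖ := by gcongr; simp [hC]

theorem exists_sum_le {s : ℝ} (hs : 0 ≤ s) :
    ∃ C : ℝ, 0 ≤ C ∧ ∀ N : ℕ, ∑ k ∈ Finset.range N, singVal T k ^ s ≤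
      C * ∑ k ∈ Finset.range N, singVal S k ^ s := by
  obtain ⟨a, C, ha, hC, hle⟩ := h.exists_singVal_le
  refine ⟨a * C ^ s, by positivity, fun N => ?_⟩
  have h0 : ∀ k, 0 ≤ singVal S k ^ s := fun k => Real.rpow_nonneg (singVal_nonneg S k) s
  -- In blocks of length a the index m / a is constant, so each singular value of S is counted a
  -- times.
  have h1 : ∀ N, ∑ m ∈ Finset.range (a * N), singVal S (m / a) ^ s =
      a * ∑ k ∈ Finset.range N, singVal S k ^ s := by
    intro N
    induction N with
    | zero => simp
    | succ N ih =>
      rw [mul_add, mul_one, Finset.sum_range_add, ih, Finset.sum_range_succ, mul_add]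
      congr 1
      rw [Finset.sum_congr rfl (g := fun _ => singVal S N ^ s)]
      · simp
      · intro i hi
        rw [Nat.mul_add_div ha, Nat.div_eq_of_lt (Finset.mem_range.1 hi), add_zero]
  calc _ ≤ ∑ m ∈ Finset.range N, C ^ s * singVal S (m / a) ^ s := by
        refine Finset.sum_le_sum fun m _ => ?_
        rw [← Real.mul_rpow hC.le (singVal_nonneg _ _)]
        exact Real.rpow_le_rpow (singVal_nonneg _ _) (hle m) hs
    _ ≤ ∑ m ∈ Finset.range (a * N), C ^ s * singVal S (m / a) ^ s := by
        refine Finset.sum_le_sum_of_subset_of_nonneg ?_ fun m _ _ => ?_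
        · exact Finset.range_subset_range.2 (Nat.le_mul_of_pos_left N ha)
        · exact mul_nonneg (Real.rpow_nonneg hC.le s) (h0 _)
    _ = _ := by rw [← Finset.mul_sum, h1]; ring

theorem memSchatten {s : ℝ} (hs : 0 ≤ s) (hS : MemSchatten s S) : MemSchatten s T := by
  obtain ⟨C, hC, hle⟩ := h.exists_sum_le hs
  have h0 : ∀ k, 0 ≤ singVal S k ^ s := fun k => Real.rpow_nonneg (singVal_nonneg S k) s
  refine ⟨h.isCompactOperator hS.1, summable_of_sum_range_le
    (c := C * ∑' k, singVal S k ^ s) (fun k => Real.rpow_nonneg (singVal_nonneg T k) s) fun N => ?_⟩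
  refine (hle N).trans ?_
  gcongr
  exact hS.2.sum_le_tsum _ fun k _ => h0 k

theorem memZ {p : ℝ} (hp : 0 ≤ p) (hS : MemZ p S) : MemZ p T := by
  obtain ⟨C, hC, hle⟩ := h.exists_sum_le hp
  obtain ⟨hc, c, hN⟩ := hS
  refine ⟨h.isCompactOperator hc, C * c, fun N => (hle N).trans ?_⟩
  rw [mul_assoc]
  gcongr
  exact hN N

end FactorsThrough

/-- The graph of Z = R⁻¹ T is the closed set where R z = T x, so Z is bounded by the closed graph
theorem. -/
theorem exists_comp_eq [CompleteSpace H] [CompleteSpace K] {R : H →L[ℂ] H}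
    (hR : Function.Injective R) (T : K →L[ℂ] H) (h : ∀ x, ∃ z, R z = T x) :
    ∃ Z : K →L[ℂ] H, R ∘L Z = T := by
  choose Z hZ using h
  let Zl : K →ₗ[ℂ] H :=
    { toFun := Z
      map_add' := fun x y => hR (by simp [hZ])
      map_smul' := fun c x => hR (by simp [hZ]) }
  have hc : IsClosed (Zl.graph : Set (K × H)) := by
    have : (Zl.graph : Set (K × H)) = {p | R p.2 = T p.1} := by
      ext p
      rw [SetLike.mem_coe, LinearMap.mem_graph_iff]
      exact ⟨fun h => by rw [Set.mem_ofPred_eq, h]; exact hZ _, fun h => hR (h.trans (hZ _).symm)⟩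
    rw [this]
    exact isClosed_eq (by fun_prop) (by fun_prop)
  refine ⟨⟨Zl, Zl.continuous_of_isClosed_graph hc⟩, ?_⟩
  ext x
  exact hZ x

end Ideals

/-! ## Commutators with `r⁻²` and with `r⁻¹` -/

section Sylvester

variable {H : Type*} [NormedAddCommGroup H] [InnerProductSpace ℂ H] [CompleteSpace H]

theorem mul_left_cancel_of_injective {K : Type*} [NormedAddCommGroup K] [InnerProductSpace ℂ K]
    {r X Y : K →L[ℂ] K} (hi : Function.Injective r)
    (h : r * X = r * Y) : X = Y :=
  ContinuousLinearMap.ext fun x => hi (congrArg (fun T : K →L[ℂ] K => T x) h)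

/-- Anticommuting with r implies commuting with r², hence with r = √(r²). Therefore 2 r Z = 0. -/
theorem sylvester_eq_zero {r Z : H →L[ℂ] H} (hr : 0 ≤ r) (hi : Function.Injective r)
    (h : r * Z + Z * r = 0) : Z = 0 := by
  have h1 : Z * r = -(r * Z) := eq_neg_of_add_eq_zero_right h
  have h2 : Commute (r * r) Z := by
    change r * r * Z = Z * (r * r)
    rw [← mul_assoc, h1, neg_mul, mul_assoc, mul_assoc, h1, mul_neg, neg_neg]
  have h3 := (commute_of_commute_mul_self hr h2).eq
  rw [← h3, ← two_smul ℂ, smul_eq_zero] at h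
  have h4 : r * Z = r * 0 := by simpa using h
  exact mul_left_cancel_of_injective hi h4

/-- Bernoulli gives (1 - t)^k (1 + k t) ≤ (1 - t²)^k ≤ 1, and 1 - 2t is at most 1 - t and (1 - t)².
The bounds make the series for the Sylvester equation converge. -/
theorem pow_mul_bounds {t : ℝ} (h0 : 0 ≤ t) (h1 : t ≤ 1 / 2) (k : ℕ) :
    (1 - 2 * t) ^ k * t ≤ 1 / (k + 1) ∧ (1 - 2 * t) ^ k * t ^ 2 ≤ (1 / (k + 1)) ^ 2 := by
  have hk : (0 : ℝ) ≤ k := Nat.cast_nonneg k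
  have ha : (1 - t) ^ k * (1 + k * t) ≤ 1 := by
    calc (1 - t) ^ k * (1 + k * t) ≤ (1 - t) ^ k * (1 + t) ^ k := by
          gcongr
          · exact pow_nonneg (by linarith) k
          · exact one_add_mul_le_pow (by linarith) k
      _ = (1 - t ^ 2) ^ k := by rw [← mul_pow]; ring
      _ ≤ 1 := pow_le_one₀ (by nlinarith) (by nlinarith)
  have hp : 0 ≤ (1 - t) ^ k := pow_nonneg (by linarith) k
  have hb : (1 - t) ^ k * t ≤ 1 / (k + 1) := by
    rw [le_div_iff₀ (by positivity)]
    nlinarith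
  constructor
  · refine le_trans ?_ hb
    gcongr
    · linarith
    · linarith
  · calc (1 - 2 * t) ^ k * t ^ 2 ≤ ((1 - t) ^ 2) ^ k * t ^ 2 := by
          gcongr
          · linarith
          · nlinarith
      _ = ((1 - t) ^ k * t) ^ 2 := by rw [mul_pow, ← pow_mul, ← pow_mul, mul_comm 2 k]
      _ ≤ _ := by gcongr

/-- `e = r / (1 + r)` and the bounds for the powers of `1 - 2 e = (1 - r) / (1 + r)`. -/
theorem exists_cayley {r : H →L[ℂ] H} (hr : 0 ≤ r) (hn : ‖r‖ ≤ 1) :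
    ∃ e : H →L[ℂ] H, Commute r e ∧ e + r * e = r ∧ (∀ X, Commute r X → Commute e X) ∧
      ∀ k : ℕ, ‖(1 - 2 * e) ^ k * e‖ ≤ 1 / (k + 1) ∧
        ‖(1 - 2 * e) ^ k * e ^ 2‖ ≤ (1 / (k + 1)) ^ 2 := by
  have hrs := hr.isSelfAdjoint
  let σ : ℝ → ℝ := fun s => s / (1 + |s|)
  have hσ : Continuous σ := continuous_id.div (by fun_prop) fun s => by positivity
  have hs : ∀ s ∈ spectrum ℝ r, 0 ≤ s ∧ s ≤ 1 := by
    intro s hs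
    refine ⟨spectrum_nonneg_of_nonneg hr hs, ?_⟩
    have h1 := spectrum.norm_le_norm_mul_of_mem hs
    have h2 : ‖(1 : H →L[ℂ] H)‖ ≤ 1 := ContinuousLinearMap.norm_id_le
    rw [Real.norm_eq_abs] at h1
    nlinarith [le_abs_self s, norm_nonneg r, norm_nonneg (1 : H →L[ℂ] H)]
  have hσs : ∀ s ∈ spectrum ℝ r, 0 ≤ σ s ∧ σ s ≤ 1 / 2 := by
    intro s hs'
    obtain ⟨h0, h1⟩ := hs s hs'
    have : σ s = s / (1 + s) := by simp only [σ, abs_of_nonneg h0]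
    rw [this]
    exact ⟨by positivity, by rw [div_le_div_iff₀ (by positivity) (by norm_num)]; linarith⟩
  have hpow : ∀ (k l : ℕ), (1 - 2 * cfc σ r) ^ k * cfc σ r ^ l =
      cfc (fun s => (1 - 2 * σ s) ^ k * σ s ^ l) r := by
    intro k l
    have h1 : cfc (fun s => 1 - 2 * σ s) r = 1 - 2 * cfc σ r := by
      rw [cfc_sub (fun _ => 1) (fun s => 2 * σ s) r (by fun_prop) (by fun_prop),
        cfc_const_mul 2 σ r (by fun_prop), cfc_const_one ℝ r, two_mul, two_smul]
    rw [cfc_mul (fun s => (1 - 2 * σ s) ^ k) (fun s => σ s ^ l) r (by fun_prop) (by fun_prop),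
      cfc_pow (fun s => 1 - 2 * σ s) k r (by fun_prop), cfc_pow σ l r (by fun_prop), h1]
  refine ⟨cfc σ r, (cfc_commute_cfc id σ r |> fun h => by rwa [cfc_id ℝ r] at h), ?_,
    fun X hX => hX.cfc_real σ, fun k => ⟨?_, ?_⟩⟩
  · have h1 : cfc (fun s => id s * σ s) r = r * cfc σ r := by
      rw [cfc_mul id σ r (by fun_prop) (by fun_prop), cfc_id ℝ r]
    rw [← h1, ← cfc_add r σ (fun s => id s * σ s) (by fun_prop) (by fun_prop)]
    conv_rhs => rw [← cfc_id ℝ r]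
    refine cfc_congr fun s hs' => ?_
    have h0 := (hs s hs').1
    have : 1 + s ≠ 0 := by positivity
    simp only [σ, abs_of_nonneg h0, id]
    field_simp
  · have := hpow k 1
    rw [pow_one] at this
    rw [this]
    refine norm_cfc_le (by positivity) fun s hs' => ?_
    obtain ⟨h0, h1⟩ := hσs s hs'
    rw [Real.norm_of_nonneg (mul_nonneg (pow_nonneg (by linarith) k) (by positivity)), pow_one]
    exact (pow_mul_bounds h0 h1 k).1
  · rw [hpow k 2]
    refine norm_cfc_le (by positivity) fun s hs' => ?_
    obtain ⟨h0, h1⟩ := hσs s hs'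
    rw [Real.norm_of_nonneg (mul_nonneg (pow_nonneg (by linarith) k) (by positivity))]
    exact (pow_mul_bounds h0 h1 k).2

/-- `X` lies in the domain of all powers of the map `X ↦ [r⁻², X] r`. -/
def SqSmooth (r X : H →L[ℂ] H) : Prop :=
  ∃ Xs : ℕ → H →L[ℂ] H, Xs 0 = X ∧
    ∀ k, Xs k * (r * r) - r * r * Xs k = r * r * Xs (k + 1) * r

/-- A solution of the equation `r Y + Y r = r X₁` that depends naturally on `X₁`. -/
theorem exists_sylvester {r : H →L[ℂ] H} (hr : 0 ≤ r) (hi : Function.Injective r)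
    (hn : ‖r‖ ≤ 1) :
    ∃ Θ : (H →L[ℂ] H) → (H →L[ℂ] H),
      (∀ Z Z', Z * (r * r) - r * r * Z = r * r * Z' * r →
        Θ Z * (r * r) - r * r * Θ Z = r * r * Θ Z' * r) ∧
      ∀ X Z, X * (r * r) - r * r * X = r * r * Z * r →
        r * Θ Z + Θ Z * r = -(X * r - r * X) := by
  obtain ⟨e, hre, he, -, hb⟩ := exists_cayley hr hn
  obtain ⟨c, hc⟩ : ∃ c, c = 1 - 2 * e := ⟨_, rfl⟩
  obtain ⟨d, hd⟩ : ∃ d, d = 1 - e := ⟨_, rfl⟩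
  rw [← hc] at hb
  have hrd : r * d = e := by rw [hd, mul_sub, mul_one, sub_eq_iff_eq_add]; exact he.symm
  have hcr : Commute r d := hd ▸ (Commute.one_right r).sub_right hre
  have hdr : d * r = e := by rw [← hcr.eq, hrd]
  have hd1 : (1 + r) * d = 1 := by rw [add_mul, one_mul, hrd, hd]; abel
  have hd2 : d * (1 + r) = 1 := by rw [mul_add, mul_one, hdr, hd]; abel
  have he1 : (1 + r) * e = r := by rw [add_mul, one_mul, he]
  have hc1 : (1 + r) * c = 1 - r := by
    have : c = d - e := by rw [hc, hd, two_mul]; abel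
    rw [this, mul_sub, hd1, he1]
  have hrc : Commute r c :=
    hc ▸ (Commute.one_right r).sub_right ((Commute.ofNat_right r 2).mul_right hre)
  have hc2 : c * (1 + r) = 1 - r := by
    rw [← hc1, mul_add, add_mul, mul_one, one_mul, hrc.eq]
  have hec : Commute c e :=
    hc ▸ (Commute.one_left e).sub_left ((Commute.ofNat_left 2 e).mul_left (Commute.refl e))
  have hdc : Commute d c := hd ▸ (Commute.one_left c).sub_left hec.symm
  -- With the Cayley transform c = (1 - r)/(1 + r), the equation for r N + N r becomes one for N - c
  -- N c, which is solved by summing c^k M c^k. Here r need not be bounded below, and the factors e²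
  -- and e = r/(1 + r) supply the decay.
  let a : ℕ → H →L[ℂ] H := fun k => c ^ k * e ^ 2
  let b : ℕ → H →L[ℂ] H := fun k => c ^ k * e
  have ha : ∀ k, ‖a k‖ ≤ (1 / ((k : ℝ) + 1)) ^ 2 := fun k => (hb k).2
  have hbb : ∀ k, ‖b k‖ ≤ 1 / ((k : ℝ) + 1) := fun k => (hb k).1
  have hra : ∀ k, Commute r (a k) := fun k => (hrc.pow_right k).mul_right (hre.pow_right 2)
  have hrb : ∀ k, Commute r (b k) := fun k => (hrc.pow_right k).mul_right hre
  have hca : ∀ k, c * a k = a (k + 1) := fun k => by simp only [a, pow_succ', mul_assoc]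
  have hcb : ∀ k, b k * c = b (k + 1) := fun k => by
    simp only [b, pow_succ, mul_assoc, hec.eq]
  have hsq : Summable fun k : ℕ => (1 / ((k : ℝ) + 1)) ^ 2 := by
    have := (summable_nat_add_iff 1).2 (Real.summable_one_div_nat_pow.2 one_lt_two)
    simpa using this
  -- The weight k + 1 comes from inverting N ↦ N - c N c twice. The norm of the k-th term is at most
  -- ‖Z‖/(k + 1)².
  let g : (H →L[ℂ] H) → ℕ → H →L[ℂ] H := fun Z k => ((k : ℂ) + 1) • (a k * Z * b k)
  let f : (H →L[ℂ] H) → ℕ → H →L[ℂ] H := fun Z k => a k * Z * b k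
  have hfn : ∀ Z (k : ℕ), ((k : ℝ) + 1) * ‖f Z k‖ ≤ ‖Z‖ * (1 / ((k : ℝ) + 1)) ^ 2 := by
    intro Z k
    have h1 : ‖f Z k‖ ≤ (1 / ((k : ℝ) + 1)) ^ 2 * ‖Z‖ * (1 / ((k : ℝ) + 1)) := by
      refine (norm_mul_le _ _).trans ?_
      gcongr
      · refine (norm_mul_le _ _).trans ?_
        gcongr
        exact ha k
      · exact hbb k
    calc _ ≤ ((k : ℝ) + 1) * ((1 / ((k : ℝ) + 1)) ^ 2 * ‖Z‖ * (1 / ((k : ℝ) + 1))) := by gcongr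
      _ = _ := by field_simp
  have hg : ∀ Z, Summable (g Z) := by
    intro Z
    refine Summable.of_norm_bounded (hsq.mul_left ‖Z‖) fun k => ?_
    refine le_trans (le_of_eq ?_) (hfn Z k)
    rw [norm_smul]
    congr 1
    exact_mod_cast Complex.norm_natCast (k + 1)
  have hf : ∀ Z, Summable (f Z) := by
    intro Z
    refine Summable.of_norm_bounded (hsq.mul_left ‖Z‖) fun k => ?_
    refine le_trans ?_ (hfn Z k)
    exact le_mul_of_one_le_left (norm_nonneg _) (by simp)
  let G := fun Z => ∑' k, g Z k
  let S := fun Z => ∑' k, f Z k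
  have hS : ∀ Z, S Z - c * S Z * c = e ^ 2 * Z * e := by
    intro Z
    have h1 : c * S Z * c = ∑' k, f Z (k + 1) := by
      rw [← (hf Z).tsum_mul_left, ← ((hf Z).mul_left c).tsum_mul_right]
      refine tsum_congr fun k => ?_
      simp only [f]
      rw [← hca, ← hcb]
      simp only [mul_assoc]
    rw [h1]
    have h2 : S Z = f Z 0 + ∑' k, f Z (k + 1) := (hf Z).tsum_eq_zero_add
    rw [h2, add_sub_cancel_right]
    simp [f, a, b]
  have hG : ∀ Z, G Z - c * G Z * c = S Z := by
    intro Z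
    have h1 : c * G Z * c = ∑' k : ℕ, (k : ℂ) • f Z k := by
      have h0 : Summable fun k : ℕ => (k : ℂ) • f Z k := by
        have : (fun k : ℕ => (k : ℂ) • f Z k) = fun k => g Z k - f Z k := by
          ext1 k
          simp only [g, f, add_smul, one_smul, add_sub_cancel_right]
        rw [this]
        exact (hg Z).sub (hf Z)
      rw [h0.tsum_eq_zero_add, ← (hg Z).tsum_mul_left, ← ((hg Z).mul_left c).tsum_mul_right]
      rw [Nat.cast_zero, zero_smul, zero_add]
      refine tsum_congr fun k => ?_
      simp only [f, g]
      rw [← hca, ← hcb]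
      simp only [mul_assoc, mul_smul_comm, smul_mul_assoc, Nat.cast_add, Nat.cast_one]
    have h0 : Summable fun k : ℕ => (k : ℂ) • f Z k := by
      have : (fun k : ℕ => (k : ℂ) • f Z k) = fun k => g Z k - f Z k := by
        ext1 k
        simp only [g, f, add_smul, one_smul, add_sub_cancel_right]
      rw [this]
      exact (hg Z).sub (hf Z)
    rw [h1, ← (hg Z).tsum_sub h0]
    refine tsum_congr fun k => ?_
    simp only [f, g, add_smul, one_smul, add_sub_cancel_left]
  -- Compatibility of the series with multiplication by powers of r is what carries the relation
  -- between Z and Z' over to the solutions.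
  have hGm : ∀ A B Z, Commute r A → Commute r B → (∀ k, Commute A (a k)) →
      (∀ k, Commute B (b k)) → G (A * Z * B) = A * G Z * B := by
    intro A B Z _ _ hA hB
    rw [← (hg Z).tsum_mul_left, ← ((hg Z).mul_left A).tsum_mul_right]
    refine tsum_congr fun k => ?_
    simp only [g, mul_smul_comm, smul_mul_assoc, mul_assoc, (hB k).eq]
    rw [← mul_assoc, ← (hA k).eq, mul_assoc]
  have hGs : ∀ Z Z', G (Z - Z') = G Z - G Z' := by
    intro Z Z'
    rw [← (hg Z).tsum_sub (hg Z')]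
    refine tsum_congr fun k => ?_
    simp only [g, mul_sub, sub_mul, smul_sub]
  have hrr : ∀ k, Commute (r * r) (a k) := fun k => (hra k).mul_left (hra k)
  have hrrb : ∀ k, Commute (r * r) (b k) := fun k => (hrb k).mul_left (hrb k)
  have hstein : ∀ N, (1 + r) * (N - c * N * c) * (1 + r) = 2 * (r * N + N * r) := by
    intro N
    have : (1 + r) * (N - c * N * c) * (1 + r) =
        (1 + r) * N * (1 + r) - ((1 + r) * c) * N * (c * (1 + r)) := by noncomm_ring
    rw [this, hc1, hc2]
    noncomm_ring
  -- C = X r - r X satisfies r C + C r = r² Z r, so one inversion gives d C d = 2 S(Z) d. A second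
  -- one, with right-hand side -C, gives -4 G(Z) d.
  refine ⟨fun Z => -(4 * (G Z * d)), ?_, ?_⟩
  · intro Z Z' h
    have h1 : G Z * (r * r) - r * r * G Z = r * r * G Z' * r := by
      have e1 := hGm 1 (r * r) Z (Commute.one_right r) (Commute.mul_right rfl rfl)
        (fun k => Commute.one_left _) hrrb
      have e2 := hGm (r * r) 1 Z (Commute.mul_right rfl rfl) (Commute.one_right r) hrr
        (fun k => Commute.one_left _)
      rw [one_mul, one_mul] at e1
      rw [mul_one, mul_one] at e2
      rw [← e1, ← e2, ← hGs, h, hGm _ _ _ (Commute.mul_right rfl rfl) rfl hrr hrb]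
    have h2 : (r * r) * d = d * (r * r) := (hcr.mul_left hcr).eq
    have h3 : -(4 * (G Z * d)) * (r * r) - r * r * -(4 * (G Z * d)) =
        -(4 * ((G Z * (r * r) - r * r * G Z) * d)) := by
      have : G Z * d * (r * r) = G Z * (r * r) * d := by
        rw [mul_assoc, ← h2, ← mul_assoc]
      calc _ = -(4 * (G Z * d * (r * r) - r * r * G Z * d)) := by noncomm_ring
        _ = _ := by rw [this, sub_mul]
    rw [h3, h1]
    have : r * r * G Z' * r * d = r * r * (G Z' * d) * r := by
      simp only [mul_assoc, hcr.eq]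
    rw [this]
    noncomm_ring
  · intro X Z h
    set C := X * r - r * X with hC
    have hCr : r * C + C * r = r * r * Z * r := by
      rw [← h, hC]
      noncomm_ring
    -- the two solutions of the same equation agree
    have hSd : 2 * (S Z * d) = d * C * d := by
      rw [← sub_eq_zero]
      refine sylvester_eq_zero hr hi ?_
      have e1 : S Z * d - c * (S Z * d) * c = e ^ 2 * Z * e * d := by
        have : c * (S Z * d) * c = c * S Z * c * d := by
          rw [mul_assoc c, mul_assoc (S Z), hdc.eq]
          simp only [mul_assoc]
        rw [← hS, sub_mul, this]
      have e2 := hstein (S Z * d)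
      rw [e1] at e2
      have e3 : (1 + r) * (e ^ 2 * Z * e * d) * (1 + r) = r * e * Z * e := by
        calc _ = ((1 + r) * e) * e * Z * e * (d * (1 + r)) := by rw [pow_two]; noncomm_ring
          _ = _ := by rw [he1, hd2, mul_one]
      have e4 : r * (d * C * d) + d * C * d * r = d * (r * C + C * r) * d := by
        have h1 : r * (d * C * d) = d * (r * C) * d := by
          rw [← mul_assoc, ← mul_assoc, hcr.eq]; simp only [mul_assoc]
        have h2 : d * C * d * r = d * (C * r) * d := by
          rw [mul_assoc, ← hcr.eq]; simp only [mul_assoc]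
        rw [h1, h2]
        noncomm_ring
      have e5 : d * (r * r * Z * r) * d = r * e * Z * e := by
        calc _ = (d * r) * r * Z * (r * d) := by simp only [mul_assoc]
          _ = _ := by rw [hdr, hrd, hre.eq]
      calc _ = 2 * (r * (S Z * d) + S Z * d * r) - (r * (d * C * d) + d * C * d * r) := by
            noncomm_ring
        _ = 0 := by rw [← e2, e3, e4, hCr, e5, sub_self]
    have e1 : -(2 * (G Z * d)) - c * -(2 * (G Z * d)) * c = -(d * C * d) := by
      rw [← hSd, ← hG]
      have : c * (G Z * d) * c = c * G Z * c * d := by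
        rw [mul_assoc c, mul_assoc (G Z), hdc.eq]
        simp only [mul_assoc]
      calc _ = -(2 * (G Z * d - c * (G Z * d) * c)) := by noncomm_ring
        _ = _ := by rw [this, sub_mul]
    have e2 := hstein (-(2 * (G Z * d)))
    rw [e1] at e2
    have e3 : (1 + r) * -(d * C * d) * (1 + r) = -C := by
      calc _ = -(((1 + r) * d) * C * (d * (1 + r))) := by noncomm_ring
        _ = _ := by rw [hd1, hd2, one_mul, mul_one]
    rw [e3] at e2
    calc _ = 2 * (r * -(2 * (G Z * d)) + -(2 * (G Z * d)) * r) := by noncomm_ring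
      _ = -C := e2.symm

end Sylvester

/-! ### Smoothness for [r⁻², ·] r, for [r⁻¹, ·] and for the modulus -/

section SmoothOperators

variable {H : Type*} [NormedAddCommGroup H] [InnerProductSpace ℂ H] [CompleteSpace H]

namespace SqSmooth

variable {r X Y b : H →L[ℂ] H}

theorem sub (hX : SqSmooth r X) (hY : SqSmooth r Y) : SqSmooth r (X - Y) := by
  obtain ⟨Xs, rfl, hX⟩ := hX
  obtain ⟨Ys, rfl, hY⟩ := hY
  refine ⟨fun k => Xs k - Ys k, rfl, fun k => ?_⟩
  calc _ = (Xs k * (r * r) - r * r * Xs k) - (Ys k * (r * r) - r * r * Ys k) := by noncomm_ring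
    _ = _ := by rw [hX, hY, mul_sub, sub_mul]

theorem mul_of_commute (hX : SqSmooth r X) (hb : Commute r b) : SqSmooth r (X * b) := by
  obtain ⟨Xs, rfl, hX⟩ := hX
  have hbb : b * (r * r) = r * r * b := (hb.mul_left hb).eq.symm
  refine ⟨fun k => Xs k * b, rfl, fun k => ?_⟩
  calc _ = (Xs k * (r * r) - r * r * Xs k) * b := by
        rw [sub_mul, mul_assoc, hbb]; simp only [mul_assoc]
    _ = _ := by rw [hX]; simp only [mul_assoc, hb.eq]

theorem commute_mul (hX : SqSmooth r X) (hb : Commute r b) : SqSmooth r (b * X) := by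
  obtain ⟨Xs, rfl, hX⟩ := hX
  have hbb : b * (r * r) = r * r * b := (hb.mul_left hb).eq.symm
  refine ⟨fun k => b * Xs k, rfl, fun k => ?_⟩
  calc _ = b * (Xs k * (r * r) - r * r * Xs k) := by
        rw [mul_sub, ← mul_assoc b (r * r), hbb]; simp only [mul_assoc]
    _ = b * (r * r) * Xs (k + 1) * r := by rw [hX]; simp only [mul_assoc]
    _ = _ := by rw [hbb]; simp only [mul_assoc]

/-- The operator Y stands for [r⁻¹, X]. By the Leibniz rule for r⁻² = r⁻¹ r⁻¹ it must solve r Y + Y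
r = r X₁ with X₁ = [r⁻², X] r. -/
theorem exists_comm (hr : 0 ≤ r) (hi : Function.Injective r) (hn : ‖r‖ ≤ 1)
    (hX : SqSmooth r X) : ∃ Y, SqSmooth r Y ∧ X * r - r * X = r * Y * r := by
  obtain ⟨Xs, rfl, hX⟩ := hX
  obtain ⟨Θ, h1, h2⟩ := exists_sylvester hr hi hn
  -- The first guess X₁/2 misses the equation by half of -(X₁ r - r X₁), which Θ(X₂)/2 corrects. The
  -- same formula shifted by k exhibits Y as smooth.
  let Ys : ℕ → H →L[ℂ] H := fun k => (2⁻¹ : ℂ) • (Xs (k + 1) + Θ (Xs (k + 2)))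
  refine ⟨Ys 0, ⟨Ys, rfl, fun k => ?_⟩, ?_⟩
  · have e1 := hX (k + 1)
    have e2 := h1 _ _ (hX (k + 2))
    calc _ = (2⁻¹ : ℂ) • ((Xs (k + 1) * (r * r) - r * r * Xs (k + 1)) +
          (Θ (Xs (k + 2)) * (r * r) - r * r * Θ (Xs (k + 2)))) := by
          simp only [Ys, smul_mul_assoc, mul_smul_comm, ← smul_sub]
          congr 1
          noncomm_ring
      _ = _ := by
          rw [e1, e2]
          simp only [Ys, smul_mul_assoc, mul_smul_comm]
          congr 1
          noncomm_ring
  · have e1 : r * Ys 0 + Ys 0 * r = r * Xs 1 := by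
      have := h2 _ _ (hX 1)
      calc _ = (2⁻¹ : ℂ) • (r * Xs 1 + Xs 1 * r + (r * Θ (Xs 2) + Θ (Xs 2) * r)) := by
            simp only [Ys, smul_mul_assoc, mul_smul_comm, ← smul_add]
            congr 1
            noncomm_ring
        _ = (2⁻¹ : ℂ) • ((2 : ℂ) • (r * Xs 1)) := by
            rw [this, two_smul]
            congr 1
            abel
        _ = _ := by rw [smul_smul]; norm_num
    rw [← sub_eq_zero]
    refine sylvester_eq_zero hr hi ?_
    calc _ = (Xs 0 * (r * r) - r * r * Xs 0) - r * (r * Ys 0 + Ys 0 * r) * r := by noncomm_ring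
      _ = 0 := by rw [hX 0, e1, ← mul_assoc, sub_self]

end SqSmooth

theorem memDomInf_of_class {P : H →ₗ.[ℂ] H} {s : Set (H →L[ℂ] H)}
    (hs : ∀ T ∈ s, ∃ S ∈ s, IsComm P T T S) {T : H →L[ℂ] H} (hT : T ∈ s) : MemDomInf P T := by
  choose! f hf hc using hs
  have h : ∀ m, f^[m] T ∈ s := by
    intro m
    induction m with
    | zero => exact hT
    | succ m ih => rw [Function.iterate_succ_apply']; exact hf _ ih
  refine ⟨fun m => f^[m] T, rfl, fun m => ?_⟩
  simp only [Function.iterate_succ_apply']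
  exact hc _ (h m)

namespace IsBoundedTransform

variable {P : H →ₗ.[ℂ] H} {r G : H →L[ℂ] H} (h : IsBoundedTransform P r G)
include h

theorem norm_le_one : ‖r‖ ≤ 1 := by
  refine ContinuousLinearMap.opNorm_le_bound _ zero_le_one fun z => ?_
  have e1 : ⟪z, z⟫_ℂ = ⟪G z, G z⟫_ℂ + ⟪r z, r z⟫_ℂ := by
    rw [h.selfAdjoint.inner_symm, h.isSelfAdjoint_left.inner_symm, ← inner_add_right, h.sq_apply]
  simp only [inner_self_eq_norm_sq_to_K] at e1
  have e2 : ‖z‖ ^ 2 = ‖G z‖ ^ 2 + ‖r z‖ ^ 2 := by exact_mod_cast e1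
  rw [one_mul]
  exact (abs_le_of_sq_le_sq' (by nlinarith [sq_nonneg ‖G z‖]) (norm_nonneg _)).2

/-- From 1 - G² = r² one gets 1 - G = r² (1 + G)⁻¹. Formally this says P = r⁻¹ - b with b = r (1 +
G)⁻¹ bounded. -/
theorem exists_one_sub_eq (hG : 0 ≤ G) :
    ∃ b, Commute r b ∧ Commute G b ∧ 1 - G = r * b := by
  have hu : IsUnit (1 + G) :=
    CStarAlgebra.isUnit_of_le 1 (le_add_of_nonneg_right hG)
  obtain ⟨u, hu⟩ := hu
  have hc : Commute r (u : H →L[ℂ] H) := hu ▸ (Commute.one_right r).add_right h.comm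
  have hc' : Commute G (u : H →L[ℂ] H) := hu ▸ (Commute.one_right G).add_right rfl
  refine ⟨r * (u⁻¹ : (H →L[ℂ] H)ˣ), (Commute.refl r).mul_right hc.units_inv_right,
    h.comm.symm.mul_right hc'.units_inv_right, ?_⟩
  have e : (1 - G) * (u : H →L[ℂ] H) = r * r := by
    rw [hu, eq_sub_of_add_eq' h.sq]
    noncomm_ring
  rw [← mul_assoc, ← e, Units.mul_inv_cancel_right]

/-- Smoothness with respect to `[r⁻², ·] r` implies smoothness with respect to `[P, ·]`. -/
theorem memDomInf_of_sqSmooth (hG : 0 ≤ G) {X : H →L[ℂ] H} (hX : SqSmooth r X) :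
    MemDomInf P X := by
  obtain ⟨b, hb, -, hGb⟩ := h.exists_one_sub_eq hG
  refine memDomInf_of_class (s := {X | SqSmooth r X}) (fun T hT => ?_) hX
  obtain ⟨Y, hY, he⟩ := SqSmooth.exists_comm h.nonneg h.inj h.norm_le_one hT
  -- As P = r⁻¹ - b, the commutator [P, T] is [r⁻¹, T] - [b, T].
  refine ⟨Y - (b * T - T * b), hY.sub ((hT.commute_mul hb).sub (hT.mul_of_commute hb)), ?_⟩
  rw [isComm_iff_graph]
  intro x y hxy
  obtain ⟨z, rfl, rfl⟩ := (h.graph x y).1 hxy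
  have e0 : ∀ w, G w = w - b (r w) := fun w => by
    have : (1 - G) w = (b * r) w := by rw [hGb, hb.eq]
    change w - G w = b (r w) at this
    rw [← this, sub_sub_cancel]
  have e1 : r (T z + Y (r z)) = T (r z) := by
    have := congrArg (fun T : H →L[ℂ] H => T z) he
    change T (r z) - r (T z) = r (Y (r z)) at this
    rw [map_add, ← this, add_sub_cancel]
  refine (h.graph _ _).2 ⟨T z + Y (r z), e1, ?_⟩
  rw [e0, e1, e0 z, map_sub]
  change _ = T z - T (b (r z)) + (Y (r z) - (b (T (r z)) - T (b (r z))))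
  abel

end IsBoundedTransform

namespace MemDomInf

variable {P : H →ₗ.[ℂ] H} {T S : H →L[ℂ] H}

theorem exists_isComm (h : MemDomInf P T) : ∃ S, MemDomInf P S ∧ IsComm P T T S := by
  obtain ⟨Ts, rfl, h⟩ := h
  exact ⟨Ts 1, ⟨fun m => Ts (m + 1), rfl, fun m => h (m + 1)⟩, h 0⟩

theorem add (h : MemDomInf P T) (h' : MemDomInf P S) : MemDomInf P (T + S) := by
  obtain ⟨Ts, rfl, h⟩ := h
  obtain ⟨Ss, rfl, h'⟩ := h'
  exact ⟨fun m => Ts m + Ss m, rfl, fun m => (h m).add (h' m)⟩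

theorem smul (c : ℂ) (h : MemDomInf P T) : MemDomInf P (c • T) := by
  obtain ⟨Ts, rfl, h⟩ := h
  exact ⟨fun m => c • Ts m, rfl, fun m => (h m).smul c⟩

theorem of_isComm_zero (h : IsComm P T T 0) : MemDomInf P T :=
  ⟨fun m => if m = 0 then T else 0, rfl, fun m => by
    cases m with
    | zero => simpa using h
    | succ m => simpa using IsComm.zero⟩

/-- The span of all products of smooth operators is stable under commutation with P by the Leibniz
rule, so no binomial formula is needed. -/
theorem mul (h : MemDomInf P T) (h' : MemDomInf P S) : MemDomInf P (T * S) := by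
  let V : Submodule ℂ (H →L[ℂ] H) :=
    Submodule.span ℂ {X | ∃ T S, MemDomInf P T ∧ MemDomInf P S ∧ X = T * S}
  have hV : T * S ∈ V := Submodule.subset_span ⟨T, S, h, h', rfl⟩
  refine memDomInf_of_class (s := V) (fun X hX => ?_) hV
  induction hX using Submodule.span_induction with
  | mem X hX =>
    obtain ⟨T, S, hT, hS, rfl⟩ := hX
    obtain ⟨T', hT', hc⟩ := hT.exists_isComm
    obtain ⟨S', hS', hc'⟩ := hS.exists_isComm
    exact ⟨T' * S + T * S', Submodule.add_mem _ (Submodule.subset_span ⟨T', S, hT', hS, rfl⟩)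
      (Submodule.subset_span ⟨T, S', hT, hS', rfl⟩), hc.mul hc'⟩
  | zero => exact ⟨0, Submodule.zero_mem _, IsComm.zero⟩
  | add X Y _ _ hX hY =>
    obtain ⟨X', hX', hc⟩ := hX
    obtain ⟨Y', hY', hc'⟩ := hY
    exact ⟨X' + Y', Submodule.add_mem _ hX' hY', hc.add hc'⟩
  | smul c X _ hX =>
    obtain ⟨X', hX', hc⟩ := hX
    exact ⟨c • X', Submodule.smul_mem _ c hX', hc.smul c⟩

end MemDomInf

/-- The operators in the domain of all powers of `[P, ·]` form an algebra. -/
def smoothAlgebra (P : H →ₗ.[ℂ] H) : Subalgebra ℂ (H →L[ℂ] H) where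
  carrier := {T | MemDomInf P T}
  mul_mem' h h' := h.mul h'
  add_mem' h h' := h.add h'
  algebraMap_mem' c := by
    rw [Algebra.algebraMap_eq_smul_one]
    exact (MemDomInf.of_isComm_zero IsComm.one).smul c

theorem mem_smoothAlgebra {P : H →ₗ.[ℂ] H} {T : H →L[ℂ] H} :
    T ∈ smoothAlgebra P ↔ MemDomInf P T := Iff.rfl

theorem IsBoundedTransform.isComm_of_commute {P : H →ₗ.[ℂ] H} {r G X : H →L[ℂ] H}
    (h : IsBoundedTransform P r G) (hr : Commute r X) (hG : Commute G X) : IsComm P X X 0 := by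
  rw [isComm_iff_graph]
  intro x y hxy
  obtain ⟨z, rfl, rfl⟩ := (h.graph x y).1 hxy
  refine (h.graph _ _).2 ⟨X z, congrArg (fun T : H →L[ℂ] H => T z) hr.eq, ?_⟩
  simpa using congrArg (fun T : H →L[ℂ] H => T z) hG.eq

end SmoothOperators

/-! ## The action of one-forms -/

section FormAction

variable {A B H : Type*} [Ring A] [StarRing A] [Algebra ℂ A]
  [Ring B] [StarRing B] [Algebra ℂ B] [StarModule ℂ B] [TopologicalSpace B]
  [IsTopologicalRing B] [ContinuousStar B]
  [NormedAddCommGroup H] [InnerProductSpace ℂ H] [CompleteSpace H]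

/-- The linear map `b ↦ b^op`. -/
def rightRep (ρ : Bᵐᵒᵖ →⋆ₐ[ℂ] (H →L[ℂ] H)) : B →ₗ[ℂ] (H →L[ℂ] H) :=
  ρ.toAlgHom.toLinearMap ∘ₗ (opLinearEquiv ℂ : B ≃ₗ[ℂ] Bᵐᵒᵖ).toLinearMap

theorem rightRep_apply (ρ : Bᵐᵒᵖ →⋆ₐ[ℂ] (H →L[ℂ] H)) (b : B) : rightRep ρ b = ρ (op b) := rfl

theorem rightRep_mul (ρ : Bᵐᵒᵖ →⋆ₐ[ℂ] (H →L[ℂ] H)) (b b' : B) :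
    rightRep ρ (b * b') = rightRep ρ b' * rightRep ρ b := by
  simp only [rightRep_apply, op_mul, map_mul]

theorem rightRep_one (ρ : Bᵐᵒᵖ →⋆ₐ[ℂ] (H →L[ℂ] H)) : rightRep ρ (1 : B) = 1 := by
  simp only [rightRep_apply, op_one, map_one]

theorem rightRep_star (ρ : Bᵐᵒᵖ →⋆ₐ[ℂ] (H →L[ℂ] H)) (b : B) :
    rightRep ρ (star b) = star (rightRep ρ b) := by
  simp only [rightRep_apply, op_star, map_star]

/-- `F` vanishes on the bilinear forms that factor through the multiplication. -/
def VanishesOnMul (F : BilinDual B) : Prop :=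
  ∀ φ : contBilin B, (∀ x y, φ.1 x y = φ.1 1 (x * y)) → F φ = 0

theorem vanishesOnMul_univD (b : B) : VanishesOnMul (univD b) := fun φ h => by
  change φ.1 1 b - φ.1 b 1 = 0
  rw [h b 1, mul_one, sub_self]

theorem VanishesOnMul.formGrading {F : BilinDual B} (h : VanishesOnMul F) (β : AlgGrading B) :
    VanishesOnMul (formGrading β F) := fun φ hφ => h _ fun x y => by
  change φ.1 (β.hom x) (β.hom y) = φ.1 (β.hom 1) (β.hom (x * y))
  rw [hφ, map_one β.hom, map_mul β.hom]

theorem Represents.summable_mul {x y : ℕ → B} {F : BilinDual B} (h : Represents x y F)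
    {f g : B →ₗ[ℂ] (H →L[ℂ] H)} (hf : Continuous f) (hg : Continuous g) :
    Summable fun k => g (y k) * f (x k) := by
  have h1 := h.1 ((normSeminorm ℂ (H →L[ℂ] H)).comp f) ((normSeminorm ℂ (H →L[ℂ] H)).comp g)
    hf.norm hg.norm
  refine Summable.of_norm_bounded h1 fun k => ?_
  rw [mul_comm]
  exact norm_mul_le _ _

variable {π : A →⋆ₐ[ℂ] (H →L[ℂ] H)} {ρ : Bᵐᵒᵖ →⋆ₐ[ℂ] (H →L[ℂ] H)} {β : AlgGrading B}
  {D : H →ₗ.[ℂ] H} {Γ : H →L[ℂ] H}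

namespace GradedEvenTriple

variable (hT : GradedEvenTriple π ρ β D Γ)
include hT

theorem dense : Dense (D.domain : Set H) := hT.triple.selfAdjoint.dense_domain

theorem isComm_right (b : B) :
    IsComm D (rightRep ρ b) (rightRep ρ (β.hom b)) (gradedComm ρ β D b) := hT.comm_right b

theorem gradedComm_eq {b : B} {S : H →L[ℂ] H}
    (h : IsComm D (rightRep ρ b) (rightRep ρ (β.hom b)) S) : gradedComm ρ β D b = S :=
  h.bddComm_eq hT.dense

theorem gradedComm_add (b b' : B) :
    gradedComm ρ β D (b + b') = gradedComm ρ β D b + gradedComm ρ β D b' := by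
  refine hT.gradedComm_eq ?_
  simpa only [map_add] using (hT.isComm_right b).add (hT.isComm_right b')

theorem gradedComm_smul (c : ℂ) (b : B) :
    gradedComm ρ β D (c • b) = c • gradedComm ρ β D b := by
  refine hT.gradedComm_eq ?_
  simpa only [map_smul] using (hT.isComm_right b).smul c

theorem gradedComm_mul (b b' : B) : gradedComm ρ β D (b * b') =
    gradedComm ρ β D b' * rightRep ρ b + rightRep ρ (β.hom b') * gradedComm ρ β D b := by
  refine hT.gradedComm_eq ?_
  simpa only [map_mul, rightRep_mul] using (hT.isComm_right b').mul (hT.isComm_right b)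

theorem star_gradedComm (b : B) :
    star (gradedComm ρ β D b) = -gradedComm ρ β D (β.hom (star b)) := by
  rw [eq_neg_iff_add_eq_zero, add_comm, ← eq_neg_iff_add_eq_zero]
  refine hT.gradedComm_eq ?_
  have := hT.triple.selfAdjoint.isComm_adjoint (hT.isComm_right b)
  simpa only [← rightRep_star, ← map_star, β.invol] using this

theorem grading_mul_rightRep (b : B) : Γ * rightRep ρ b = rightRep ρ (β.hom b) * Γ := by
  have := hT.grading_right b
  rw [rightRep_apply, rightRep_apply, ← this, mul_assoc, hT.grading_sq, mul_one]

theorem grading_mul_gradedComm (b : B) :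
    Γ * gradedComm ρ β D b = -(gradedComm ρ β D (β.hom b) * Γ) := by
  have h1 : gradedComm ρ β D (β.hom b) = -(Γ * gradedComm ρ β D b * Γ) := by
    refine hT.gradedComm_eq ?_
    have h2 := (hT.grading_anti.mul (hT.isComm_right b)).mul hT.grading_anti
    convert h2 using 1
    · exact (hT.grading_right b).symm
    · rw [mul_neg, neg_mul, neg_mul, neg_neg, rightRep_apply, rightRep_apply, hT.grading_right]
    · simp
  rw [h1, neg_mul, neg_neg, mul_assoc, hT.grading_sq, mul_one]

/-- The derivation `b ↦ [ΓD, b^op]`. -/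
noncomputable def deriv : B →ₗ[ℂ] (H →L[ℂ] H) where
  toFun b := Γ * gradedComm ρ β D b
  map_add' b b' := by rw [hT.gradedComm_add, mul_add]
  map_smul' c b := by rw [hT.gradedComm_smul, mul_smul_comm]; rfl

theorem deriv_apply (b : B) : hT.deriv b = Γ * gradedComm ρ β D b := rfl

theorem continuous_deriv : Continuous hT.deriv := continuous_const.mul hT.cont_comm

theorem continuous_rightRep : Continuous (rightRep ρ) := hT.cont_rep

/-- Multiplying by Γ turns the graded Leibniz rule into the ordinary one, since Γ carries β(b') back
to b'. -/
theorem deriv_mul (b b' : B) :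
    hT.deriv (b * b') = hT.deriv b' * rightRep ρ b + rightRep ρ b' * hT.deriv b := by
  simp only [deriv_apply, hT.gradedComm_mul, mul_add, ← mul_assoc, hT.grading_mul_rightRep,
    β.invol]

theorem deriv_one : hT.deriv 1 = 0 := by
  have := hT.deriv_mul 1 1
  rw [mul_one, rightRep_one, mul_one, one_mul] at this
  exact left_eq_add.1 this

theorem grading_mul_deriv (b : B) : Γ * hT.deriv b = gradedComm ρ β D b := by
  rw [deriv_apply, ← mul_assoc, hT.grading_sq, one_mul]

theorem grading_deriv_grading (b : B) : Γ * hT.deriv b * Γ = -hT.deriv (β.hom b) := by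
  rw [grading_mul_deriv, deriv_apply, hT.grading_mul_gradedComm, β.invol, neg_neg]

/-- Two signs cancel: one from the adjoint of the graded commutator, one from moving Γ past it. -/
theorem star_deriv (b : B) : star (hT.deriv b) = hT.deriv (star b) := by
  rw [deriv_apply, star_mul, hT.grading_star.star_eq, hT.star_gradedComm, deriv_apply,
    hT.grading_mul_gradedComm, neg_mul]

theorem commute_deriv (a : A) (b : B) : Commute (hT.deriv b) (π a) :=
  (hT.grading_left a).mul_left (hT.firstOrder a b)

theorem commute_rightRep (a : A) (b : B) : Commute (π a) (rightRep ρ b) := hT.commute a (op b)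

/-- The bilinear form `(x, y) ↦ ⟪η, [ΓD, y^op] x^op ξ⟫`. -/
noncomputable def form (ξ η : H) : contBilin B :=
  ⟨LinearMap.mk₂ ℂ (fun x y => ⟪η, hT.deriv y (rightRep ρ x ξ)⟫_ℂ)
    (by intros; simp) (by intros; simp) (by intros; simp) (by intros; simp), by
    change Continuous fun z : B × B => ⟪η, hT.deriv z.2 (rightRep ρ z.1 ξ)⟫_ℂ
    exact continuous_const.inner ((hT.continuous_deriv.comp continuous_snd).clm_apply
      ((hT.continuous_rightRep.comp continuous_fst).clm_apply continuous_const))⟩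

theorem form_apply (ξ η : H) (x y : B) :
    (hT.form ξ η).1 x y = ⟪η, hT.deriv y (rightRep ρ x ξ)⟫_ℂ := rfl

/-- `S` is the operator by which the form `F` acts, in the weak sense. -/
def Acts (F : BilinDual B) (S : H →L[ℂ] H) : Prop :=
  ∀ ξ η, ⟪η, S ξ⟫_ℂ = F (hT.form ξ η)

/-- Matrix coefficients of the series are values of F on a fixed bilinear form. Hence the operator
depends only on F, not on the chosen representation. -/
theorem acts_of_isFormAction {F : BilinDual B} {S : H →L[ℂ] H}
    (h : IsFormAction ρ β D Γ F S) : hT.Acts F S := by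
  obtain ⟨x, y, hr, hs⟩ := h
  intro ξ η
  have h1 := hs.mapL ((innerSL ℂ η) ∘L (ContinuousLinearMap.apply ℂ H ξ))
  exact h1.unique (hr.2 (hT.form ξ η))

theorem exists_isFormAction {F : BilinDual B} (h : IsOneForm F) :
    ∃ S, IsFormAction ρ β D Γ F S := by
  obtain ⟨⟨x, y, hr⟩, -⟩ := h
  exact ⟨_, x, y, hr, (hr.summable_mul hT.continuous_rightRep hT.continuous_deriv).hasSum⟩

namespace Acts

variable {hT} {F F' : BilinDual B} {S S' : H →L[ℂ] H}

theorem unique (h : hT.Acts F S) (h' : hT.Acts F S') :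
    S = S' := by
  ext ξ
  exact ext_inner_left ℂ fun η => (h ξ η).trans (h' ξ η).symm

theorem add (h : hT.Acts F S) (h' : hT.Acts F' S') : hT.Acts (F + F') (S + S') := by
  intro ξ η
  rw [LinearMap.add_apply, ← h, ← h', ← inner_add_right]
  rfl

theorem neg (h : hT.Acts F S) : hT.Acts (-F) (-S) := by
  intro ξ η
  rw [LinearMap.neg_apply, ← h, ← inner_neg_right]
  rfl

theorem sub (h : hT.Acts F S) (h' : hT.Acts F' S') : hT.Acts (F - F') (S - S') := by
  rw [sub_eq_add_neg, sub_eq_add_neg]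
  exact h.add h'.neg

theorem sum {ι : Type*} (s : Finset ι) {F : ι → BilinDual B} {S : ι → H →L[ℂ] H}
    (h : ∀ i ∈ s, hT.Acts (F i) (S i)) : hT.Acts (∑ i ∈ s, F i) (∑ i ∈ s, S i) := by
  intro ξ η
  rw [LinearMap.sum_apply, _root_.sum_apply, inner_sum]
  exact Finset.sum_congr rfl fun i hi => h i hi ξ η

theorem univD (b : B) : hT.Acts (univD b) (hT.deriv b) := by
  intro ξ η
  change _ = (hT.form ξ η).1 1 b - (hT.form ξ η).1 b 1
  simp [form_apply, deriv_one, rightRep_one]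

theorem lact (h : hT.Acts F S) (b : B) : hT.Acts (lact b F) (S * rightRep ρ b) := by
  intro ξ η
  have : pullForm ⟨LinearMap.mulLeft ℂ b, by change Continuous fun x => b * x; fun_prop⟩
      (ContinuousLinearMap.id ℂ B) (hT.form ξ η) = hT.form (rightRep ρ b ξ) η := by
    ext x y
    change (hT.form ξ η).1 (b * x) y = _
    rw [form_apply, form_apply, rightRep_mul]
    rfl
  exact (h (rightRep ρ b ξ) η).trans (congrArg F this.symm)

/-- Expanding [ΓD, (yb)^op] x^op gives the desired term b^op [ΓD, y^op] x^op and [ΓD, b^op] (xy)^op.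
The latter factors through the multiplication, so F kills it. -/
theorem ract (h : hT.Acts F S) (hF : VanishesOnMul F) (b : B) :
    hT.Acts (ract F b) (rightRep ρ b * S) := by
  intro ξ η
  let φ : contBilin B :=
    ⟨LinearMap.mk₂ ℂ (fun x y => ⟪η, hT.deriv b (rightRep ρ (x * y) ξ)⟫_ℂ)
      (by intros; simp [add_mul]) (by intros; simp)
      (by intros; simp [mul_add]) (by intros; simp), by
      change Continuous fun z : B × B => ⟪η, hT.deriv b (rightRep ρ (z.1 * z.2) ξ)⟫_ℂ
      exact continuous_const.inner ((hT.deriv b).continuous.comp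
        ((hT.continuous_rightRep.comp (continuous_fst.mul continuous_snd)).clm_apply
          continuous_const))⟩
  have hφ : F φ = 0 := hF φ fun x y => by
    change ⟪η, hT.deriv b (rightRep ρ (x * y) ξ)⟫_ℂ = ⟪η, hT.deriv b (rightRep ρ (1 * (x * y)) ξ)⟫_ℂ
    rw [one_mul]
  have : pullForm (ContinuousLinearMap.id ℂ B) ⟨LinearMap.mulRight ℂ b, by
      change Continuous fun x => x * b
      fun_prop⟩ (hT.form ξ η) = φ + hT.form ξ (star (rightRep ρ b) η) := by
    ext x y
    change (hT.form ξ η).1 x (y * b) = ⟪η, hT.deriv b (rightRep ρ (x * y) ξ)⟫_ℂ +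
      ⟪star (rightRep ρ b) η, hT.deriv y (rightRep ρ x ξ)⟫_ℂ
    rw [form_apply, hT.deriv_mul, rightRep_mul]
    change _ = _ + ⟪ContinuousLinearMap.adjoint (rightRep ρ b) η, _⟫_ℂ
    rw [ContinuousLinearMap.adjoint_inner_left, ← inner_add_right]
    rfl
  have h1 := h ξ (star (rightRep ρ b) η)
  have h2 : ⟪star (rightRep ρ b) η, S ξ⟫_ℂ = ⟪η, rightRep ρ b (S ξ)⟫_ℂ :=
    ContinuousLinearMap.adjoint_inner_left _ _ _
  rw [h2] at h1
  refine h1.trans (Eq.trans ?_ (congrArg F this.symm))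
  rw [map_add, hφ, zero_add]

/-- The flipped form and the original one with ξ, η exchanged add up to ⟨ξ, [ΓD, (xy)^op] η⟩, on
which F vanishes. This is the source of the sign. -/
theorem formStar (h : hT.Acts F S) (hF : VanishesOnMul F) : hT.Acts (formStar F) (-star S) := by
  intro ξ η
  let φ : contBilin B :=
    ⟨LinearMap.mk₂ ℂ (fun x y => ⟪ξ, hT.deriv (x * y) η⟫_ℂ)
      (by intros; simp [add_mul]) (by intros; simp)
      (by intros; simp [mul_add]) (by intros; simp), by
      change Continuous fun z : B × B => ⟪ξ, hT.deriv (z.1 * z.2) η⟫_ℂ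
      exact continuous_const.inner ((hT.continuous_deriv.comp
        (continuous_fst.mul continuous_snd)).clm_apply continuous_const)⟩
  have hφ : F φ = 0 := hF φ fun x y => by
    change ⟪ξ, hT.deriv (x * y) η⟫_ℂ = ⟪ξ, hT.deriv (1 * (x * y)) η⟫_ℂ
    rw [one_mul]
  have : flipStarForm (hT.form ξ η) + hT.form η ξ = φ := by
    ext x y
    change starRingEnd ℂ ((hT.form ξ η).1 (star y) (star x)) +
      ⟪ξ, hT.deriv y (rightRep ρ x η)⟫_ℂ = ⟪ξ, hT.deriv (x * y) η⟫_ℂ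
    rw [form_apply, inner_conj_symm, rightRep_star, ← star_deriv]
    change ⟪ContinuousLinearMap.adjoint (hT.deriv x)
      (ContinuousLinearMap.adjoint (rightRep ρ y) ξ), η⟫_ℂ + _ = _
    rw [ContinuousLinearMap.adjoint_inner_left, ContinuousLinearMap.adjoint_inner_left,
      ← inner_add_right, hT.deriv_mul, add_comm]
    rfl
  change _ = starRingEnd ℂ (F (flipStarForm (hT.form ξ η)))
  rw [← this, map_add] at hφ
  rw [eq_neg_of_add_eq_zero_left hφ, map_neg, ← h, inner_conj_symm]
  change ⟪η, -(ContinuousLinearMap.adjoint S ξ)⟫_ℂ = _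
  rw [inner_neg_right, ContinuousLinearMap.adjoint_inner_right]

theorem formGrading (h : hT.Acts F S) : hT.Acts (formGrading β F) (-(Γ * S * Γ)) := by
  intro ξ η
  have hsym : ∀ u v, ⟪Γ u, v⟫_ℂ = ⟪u, Γ v⟫_ℂ := hT.grading_star.inner_symm
  have : pullForm ⟨β.hom.toAlgHom.toLinearMap, β.cont⟩ ⟨β.hom.toAlgHom.toLinearMap, β.cont⟩
      (hT.form ξ η) = (-1 : ℂ) • hT.form (Γ ξ) (Γ η) := by
    ext x y
    change (hT.form ξ η).1 (β.hom x) (β.hom y) = (-1 : ℂ) * (hT.form (Γ ξ) (Γ η)).1 x y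
    rw [form_apply, form_apply, neg_one_mul, ← neg_eq_iff_eq_neg, ← inner_neg_right, hsym]
    congr 1
    have e : -(hT.deriv (β.hom y)) * rightRep ρ (β.hom x) = Γ * hT.deriv y * rightRep ρ x * Γ := by
      rw [← hT.grading_deriv_grading, mul_assoc _ Γ, hT.grading_mul_rightRep, β.invol]
      simp only [mul_assoc]
    exact congrArg (fun T : H →L[ℂ] H => T ξ) e
  refine Eq.trans ?_ (congrArg F this.symm)
  rw [map_smul, smul_eq_mul, neg_one_mul, ← h, hsym, ← inner_neg_right]
  rfl

theorem commute (h : hT.Acts F S) (a : A) : Commute S (π a) := by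
  refine ContinuousLinearMap.ext fun ξ => ext_inner_left ℂ fun η => ?_
  change ⟪η, S (π a ξ)⟫_ℂ = ⟪η, π a (S ξ)⟫_ℂ
  have e : ∀ v, ⟪η, π a v⟫_ℂ = ⟪star (π a) η, v⟫_ℂ := fun v =>
    (ContinuousLinearMap.adjoint_inner_left _ _ _).symm
  rw [e, h, h]
  congr 1
  ext x y
  rw [form_apply, form_apply, ← e]
  congr 1
  have := ((hT.commute_deriv a y).mul_left (hT.commute_rightRep a x).symm).eq
  exact congrArg (fun T : H →L[ℂ] H => T ξ) this

end Acts

end GradedEvenTriple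

end FormAction

/-! ## The frame of `H ⊗_B E` -/

section Frame

variable {B E H : Type*} [Ring B] [StarRing B] [Algebra ℂ B] [StarModule ℂ B] [TopologicalSpace B]
  [IsTopologicalRing B] [ContinuousStar B] [AddCommGroup E] [Module ℂ E] [Module B E]
  [NormedAddCommGroup H] [InnerProductSpace ℂ H] [CompleteSpace H] {n : ℕ} {q : Projector B n}
  (ρ : Bᵐᵒᵖ →⋆ₐ[ℂ] (H →L[ℂ] H)) (κ : E ≃ₗ[B] rowModule q.mat)

/-- The operator `ξ ↦ ξ ⊗ e`. -/
noncomputable def tensL (e : E) : H →L[ℂ] TwistSpace ρ q where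
  toFun ξ := tens ρ κ ξ e
  map_add' ξ η := by ext j; simp [tens]
  map_smul' c ξ := by ext j; simp [tens]
  cont := by
    refine Continuous.subtype_mk ?_ _
    exact (PiLp.continuous_toLp 2 _).comp (by fun_prop)

/-- The `j`-th coordinate of an element of `H ⊗_B E = H^n q`. -/
noncomputable def coord (q : Projector B n) (j : Fin n) : TwistSpace ρ q →L[ℂ] H :=
  (PiLp.proj 2 (fun _ : Fin n => H) j) ∘L (TwistSpace ρ q).subtypeL

theorem coord_tensL (ξ : H) (e : E) (j : Fin n) :
    coord ρ q j (tensL ρ κ e ξ) = rightRep ρ ((κ e).1 j) ξ := rfl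

theorem sum_tensL_coord (x : TwistSpace ρ q) :
    ∑ j, tensL ρ κ (gen κ j) (coord ρ q j x) = x :=
  (eq_sum_tens ρ κ x).symm

theorem tensL_add (e f : E) : tensL ρ κ (e + f) = tensL ρ κ e + tensL ρ κ f := by
  ext ξ j
  change rightRep ρ ((κ (e + f)).1 j) ξ = rightRep ρ ((κ e).1 j) ξ + rightRep ρ ((κ f).1 j) ξ
  rw [map_add]
  change rightRep ρ ((κ e).1 j + (κ f).1 j) ξ = _
  rw [map_add]
  rfl

theorem tensL_zero : tensL ρ κ (0 : E) = 0 := by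
  have := tensL_add ρ κ (0 : E) 0
  rw [add_zero] at this
  exact left_eq_add.1 this

theorem tensL_sum {ι : Type*} (s : Finset ι) (e : ι → E) :
    tensL ρ κ (∑ i ∈ s, e i) = ∑ i ∈ s, tensL ρ κ (e i) := by
  classical
  induction s using Finset.induction_on with
  | empty => simp [tensL_zero]
  | insert a s ha ih => rw [Finset.sum_insert ha, Finset.sum_insert ha, tensL_add, ih]

theorem tensL_smul (b : B) (e : E) (ξ : H) :
    tensL ρ κ (b • e) ξ = tensL ρ κ e (rightRep ρ b ξ) := by
  ext j
  change rightRep ρ ((κ (b • e)).1 j) ξ = rightRep ρ ((κ e).1 j) (rightRep ρ b ξ)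
  rw [map_smul]
  change rightRep ρ (b * (κ e).1 j) ξ = _
  rw [rightRep_mul]
  rfl

theorem sum_smul_gen (e : E) : ∑ j, (κ e).1 j • gen κ j = e := by
  apply κ.injective
  ext k
  rw [map_sum]
  have h : ∑ j, (κ e).1 j * q.mat j k = (κ e).1 k := congrFun (κ e).2 k
  rw [← h, AddSubmonoidClass.coe_finsetSum, Finset.sum_apply]
  refine Finset.sum_congr rfl fun j _ => ?_
  rw [map_smul, gen, LinearEquiv.apply_symm_apply]
  rfl

theorem coe_gen (i j : Fin n) : (κ (gen κ i)).1 j = q.mat i j := by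
  rw [gen, LinearEquiv.apply_symm_apply]

theorem star_mat (i j : Fin n) : star (q.mat i j) = q.mat j i :=
  congrFun (congrFun q.herm j) i

theorem pairing_gen_right (e : E) (j : Fin n) : pairing κ e (gen κ j) = (κ e).1 j := by
  have h : ∑ k, (κ e).1 k * q.mat k j = (κ e).1 j := congrFun (κ e).2 j
  rw [pairing, ← h]
  simp only [coe_gen, star_mat]

theorem star_pairing (e f : E) : star (pairing κ e f) = pairing κ f e := by
  simp [pairing]

theorem pairing_gen_left (e : E) (j : Fin n) : pairing κ (gen κ j) e = star ((κ e).1 j) := by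
  rw [← star_pairing, pairing_gen_right]

theorem inner_tensL (ξ η : H) (e f : E) :
    ⟪tensL ρ κ e ξ, tensL ρ κ f η⟫_ℂ = ⟪rightRep ρ (pairing κ e f) ξ, η⟫_ℂ :=
  inner_tens ρ κ ξ η e f

theorem inner_coord (x : TwistSpace ρ q) (η : H) (j : Fin n) :
    ⟪coord ρ q j x, η⟫_ℂ = ⟪x, tensL ρ κ (gen κ j) η⟫_ℂ := by
  conv_rhs => rw [← sum_tensL_coord ρ κ x]
  conv_lhs => rw [← sum_tensL_coord ρ κ x]
  rw [map_sum, sum_inner, sum_inner]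
  refine Finset.sum_congr rfl fun k _ => ?_
  rw [inner_tensL, pairing_gen_right, coord_tensL]

theorem adjoint_tensL_comp (e f : E) (ξ : H) :
    ContinuousLinearMap.adjoint (tensL ρ κ f) (tensL ρ κ e ξ) =
      rightRep ρ (pairing κ e f) ξ := by
  refine ext_inner_right ℂ fun η => ?_
  rw [ContinuousLinearMap.adjoint_inner_left, inner_tensL]

theorem adjoint_tensL_gen (j : Fin n) :
    ContinuousLinearMap.adjoint (tensL ρ κ (gen κ j)) = coord ρ q j := by
  refine ContinuousLinearMap.ext fun x => ext_inner_right ℂ fun η => ?_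
  rw [ContinuousLinearMap.adjoint_inner_left, inner_coord ρ κ]

theorem twist_ext {F : Type*} [AddCommGroup F] [Module ℂ F] [TopologicalSpace F]
    {S T : TwistSpace ρ q →L[ℂ] F}
    (h : ∀ j ξ, S (tensL ρ κ (gen κ j) ξ) = T (tensL ρ κ (gen κ j) ξ)) : S = T := by
  ext x
  rw [← sum_tensL_coord ρ κ x, map_sum, map_sum]
  exact Finset.sum_congr rfl fun j _ => h j _

/-- The operator `ξ ⊗ e ↦ ∑ (W j ξ) (κ e)_j`, for operators `W j : H → H ⊗_B E`. -/
noncomputable def ofColumns (q : Projector B n) (W : Fin n → (H →L[ℂ] TwistSpace ρ q)) :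
    TwistSpace ρ q →L[ℂ] TwistSpace ρ q :=
  ∑ j, W j ∘L coord ρ q j

theorem ofColumns_apply (W : Fin n → (H →L[ℂ] TwistSpace ρ q)) (x : TwistSpace ρ q) :
    ofColumns ρ q W x = ∑ j, W j (coord ρ q j x) := by
  simp [ofColumns]

theorem ofColumns_tensL (W : Fin n → (H →L[ℂ] TwistSpace ρ q)) (e : E) (ξ : H) :
    ofColumns ρ q W (tensL ρ κ e ξ) = ∑ j, W j (rightRep ρ ((κ e).1 j) ξ) := by
  simp only [ofColumns_apply, coord_tensL]

end Frame

/-! ## The operator `D̂` -/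

section Twist

variable {A B C E H : Type*} [Ring A] [StarRing A] [Algebra ℂ A]
  [Ring B] [StarRing B] [Algebra ℂ B] [StarModule ℂ B] [TopologicalSpace B]
  [IsTopologicalRing B] [ContinuousStar B] [Ring C] [StarRing C]
  [AddCommGroup E] [Module ℂ E] [Module B E] [Module Cᵐᵒᵖ E]
  [NormedAddCommGroup H] [InnerProductSpace ℂ H] [CompleteSpace H] {n : ℕ} {q : Projector B n}
  {π : A →⋆ₐ[ℂ] (H →L[ℂ] H)} {ρ : Bᵐᵒᵖ →⋆ₐ[ℂ] (H →L[ℂ] H)} {β : AlgGrading B}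
  {D : H →ₗ.[ℂ] H} {Γ : H →L[ℂ] H} (hT : GradedEvenTriple π ρ β D Γ)
  {κ : E ≃ₗ[B] rowModule q.mat} {g : E →ₗ[ℂ] E} (hE : GradedBimodule C β κ g)
  {nabla : E →ₗ[ℂ] (Fin n → BilinDual B)} (hnabla : HermitianConnection β κ g nabla)

/-- The operator by which the `j`-th component of `∇ e` acts. -/
noncomputable def connOp (e : E) (j : Fin n) : H →L[ℂ] H :=
  (hT.exists_isFormAction (hnabla.form e j)).choose

theorem isFormAction_connOp (e : E) (j : Fin n) :
    IsFormAction ρ β D Γ (nabla e j) (connOp hT hnabla e j) :=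
  (hT.exists_isFormAction (hnabla.form e j)).choose_spec

theorem acts_connOp (e : E) (j : Fin n) : hT.Acts (nabla e j) (connOp hT hnabla e j) :=
  hT.acts_of_isFormAction (isFormAction_connOp hT hnabla e j)

theorem connOp_add (e f : E) (j : Fin n) :
    connOp hT hnabla (e + f) j = connOp hT hnabla e j + connOp hT hnabla f j := by
  have h := (acts_connOp hT hnabla e j).add (acts_connOp hT hnabla f j)
  refine (acts_connOp hT hnabla (e + f) j).unique ?_
  rwa [map_add, Pi.add_apply]

theorem connOp_smul (b : B) (e : E) (j : Fin n) : connOp hT hnabla (b • e) j =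
    rightRep ρ ((κ e).1 j) * hT.deriv b + connOp hT hnabla e j * rightRep ρ b := by
  have h := (((GradedEvenTriple.Acts.univD (hT := hT) b).ract (vanishesOnMul_univD b)
    ((κ e).1 j))).add ((acts_connOp hT hnabla e j).lact b)
  refine (acts_connOp hT hnabla (b • e) j).unique ?_
  rwa [hnabla.leibniz]

theorem connOp_grading (e : E) (k : Fin n) : connOp hT hnabla (g e) k =
    ∑ j, rightRep ρ ((κ (g (gen κ j))).1 k) * -(Γ * connOp hT hnabla e j * Γ) := by
  refine (acts_connOp hT hnabla (g e) k).unique ?_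
  rw [hnabla.even]
  exact .sum _ fun j _ => (acts_connOp hT hnabla e j).formGrading.ract
    (VanishesOnMul.formGrading (hnabla.form e j).2 β) _

theorem deriv_pairing (e f : E) : hT.deriv (pairing κ e f) =
    ∑ j, rightRep ρ (star ((κ f).1 j)) * connOp hT hnabla e j +
      ∑ j, star (connOp hT hnabla f j) * rightRep ρ ((κ e).1 j) := by
  have h1 : ∑ j, star (connOp hT hnabla f j) * rightRep ρ ((κ e).1 j) =
      -∑ j, -star (connOp hT hnabla f j) * rightRep ρ ((κ e).1 j) := by
    simp only [neg_mul, Finset.sum_neg_distrib, neg_neg]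
  refine (GradedEvenTriple.Acts.univD (hT := hT) (pairing κ e f)).unique ?_
  rw [hnabla.compatible, h1, ← sub_eq_add_neg]
  exact (GradedEvenTriple.Acts.sum _ fun j _ =>
    (acts_connOp hT hnabla e j).ract (hnabla.form e j).2 _).sub
    (GradedEvenTriple.Acts.sum _ fun j _ =>
      ((acts_connOp hT hnabla f j).formStar (hnabla.form f j).2).lact _)

theorem commute_connOp (e : E) (j : Fin n) (a : A) : Commute (connOp hT hnabla e j) (π a) :=
  (acts_connOp hT hnabla e j).commute a

/-- The operator `ξ ↦ (Γ ⊗ g) (γ ⊗ 1) (ξ ⊗ ∇ e)`. -/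
noncomputable def connPart (e : E) : H →L[ℂ] TwistSpace ρ q :=
  ∑ j, tensL ρ κ (g (gen κ j)) ∘L Γ ∘L connOp hT hnabla e j

theorem connPart_apply (e : E) (ξ : H) : connPart hT hnabla e ξ =
    ∑ j, tensL ρ κ (g (gen κ j)) (Γ (connOp hT hnabla e j ξ)) := by
  simp [connPart]

theorem connPart_add (e f : E) :
    connPart hT hnabla (e + f) = connPart hT hnabla e + connPart hT hnabla f := by
  ext1 ξ
  rw [_root_.add_apply]
  simp only [connPart_apply, connOp_add, ← Finset.sum_add_distrib, ← map_add]
  rfl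

theorem connPart_zero : connPart hT hnabla 0 = 0 := by
  have := connPart_add hT hnabla 0 0
  rw [add_zero] at this
  exact left_eq_add.1 this

theorem connPart_sum {ι : Type*} (s : Finset ι) (e : ι → E) :
    connPart hT hnabla (∑ i ∈ s, e i) = ∑ i ∈ s, connPart hT hnabla (e i) := by
  classical
  induction s using Finset.induction_on with
  | empty => simp [connPart_zero]
  | insert a s ha ih => rw [Finset.sum_insert ha, Finset.sum_insert ha, connPart_add, ih]

include hE

theorem sum_smul_grading_gen (e : E) : ∑ j, β.hom ((κ e).1 j) • g (gen κ j) = g e := by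
  conv_rhs => rw [← sum_smul_gen κ e, map_sum]
  simp only [hE.grading_left]

/-- The Leibniz rule for ∇ yields exactly the graded commutator that appears when D ⊗ g is moved
past b, so D̂ is balanced over B. -/
theorem connPart_smul (b : B) (e : E) (ξ : H) : connPart hT hnabla (b • e) ξ =
    tensL ρ κ (g e) (gradedComm ρ β D b ξ) + connPart hT hnabla e (rightRep ρ b ξ) := by
  have h1 : tensL ρ κ (g e) (gradedComm ρ β D b ξ) =
      ∑ j, tensL ρ κ (g (gen κ j)) (Γ (rightRep ρ ((κ e).1 j) (hT.deriv b ξ))) := by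
    rw [← sum_smul_grading_gen hE e, tensL_sum, _root_.sum_apply]
    refine Finset.sum_congr rfl fun j _ => ?_
    rw [tensL_smul, ← hT.grading_mul_deriv]
    congr 1
    exact (congrArg (fun T : H →L[ℂ] H => T (hT.deriv b ξ))
      (hT.grading_mul_rightRep ((κ e).1 j))).symm
  rw [h1, connPart_apply, connPart_apply, ← Finset.sum_add_distrib]
  refine Finset.sum_congr rfl fun j _ => ?_
  rw [connOp_smul, ← map_add, ← map_add]
  rfl

omit hE

variable (κ g) in
/-- The graph of `D̂`: the elements of the domain are those with coordinates in `Dom D`. -/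
def dhatGraph : Submodule ℂ (TwistSpace ρ q × TwistSpace ρ q) where
  carrier := {p | ∃ η : Fin n → H, (∀ j, (coord ρ q j p.1, η j) ∈ D.graph) ∧
    p.2 = ∑ j, (tensL ρ κ (g (gen κ j)) (η j) + connPart hT hnabla (gen κ j) (coord ρ q j p.1))}
  zero_mem' := ⟨0, fun j => by simp, by simp⟩
  add_mem' := by
    rintro p p' ⟨η, h1, h2⟩ ⟨η', h1', h2'⟩
    refine ⟨η + η', fun j => ?_, ?_⟩
    · exact D.graph.add_mem (h1 j) (h1' j)
    · rw [Prod.snd_add, h2, h2', ← Finset.sum_add_distrib]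
      refine Finset.sum_congr rfl fun j _ => ?_
      simp only [Pi.add_apply, map_add, Prod.fst_add]
      abel
  smul_mem' := by
    rintro c p ⟨η, h1, h2⟩
    refine ⟨c • η, fun j => ?_, ?_⟩
    · exact D.graph.smul_mem c (h1 j)
    · rw [Prod.smul_snd, h2, Finset.smul_sum]
      refine Finset.sum_congr rfl fun j _ => ?_
      simp only [Pi.smul_apply, map_smul, Prod.smul_fst, smul_add]

/-- The twisted operator. -/
noncomputable def dhat : TwistSpace ρ q →ₗ.[ℂ] TwistSpace ρ q :=
  (dhatGraph hT κ g hnabla).toLinearPMap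

theorem dhat_graph : (dhat hT hnabla).graph = dhatGraph hT κ g hnabla := by
  refine Submodule.toLinearPMap_graph_eq _ ?_
  rintro ⟨x, y⟩ ⟨η, h1, h2⟩ (rfl : x = 0)
  have h3 : ∀ j, η j = 0 := fun j =>
    D.graph_fst_eq_zero_snd (h1 j) (map_zero _)
  simpa [h3] using h2

theorem mem_dhat_domain {x : TwistSpace ρ q} :
    x ∈ (dhat hT hnabla).domain ↔ ∀ j, coord ρ q j x ∈ D.domain := by
  rw [LinearPMap.mem_domain_iff, dhat_graph]
  constructor
  · rintro ⟨y, η, h1, -⟩ j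
    exact LinearPMap.mem_domain_iff.2 ⟨η j, h1 j⟩
  · intro h
    let η : Fin n → H := fun j => D ⟨_, h j⟩
    exact ⟨∑ j, (tensL ρ κ (g (gen κ j)) (η j) +
      connPart hT hnabla (gen κ j) (coord ρ q j x)), η, fun j => D.mem_graph ⟨_, h j⟩, rfl⟩

include hE

theorem tensL_mem_dhat_graph (e : E) {ξ η : H} (h : (ξ, η) ∈ D.graph) :
    (tensL ρ κ e ξ, tensL ρ κ (g e) η + connPart hT hnabla e ξ) ∈ (dhat hT hnabla).graph := by
  rw [dhat_graph]
  refine ⟨fun j => rightRep ρ (β.hom ((κ e).1 j)) η + gradedComm ρ β D ((κ e).1 j) ξ,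
    fun j => isComm_iff_graph.1 (hT.isComm_right ((κ e).1 j)) ξ η h, ?_⟩
  change tensL ρ κ (g e) η + connPart hT hnabla e ξ = _
  have h1 : connPart hT hnabla e ξ = ∑ j, (tensL ρ κ (g (gen κ j)) (gradedComm ρ β D ((κ e).1 j) ξ)
      + connPart hT hnabla (gen κ j) (rightRep ρ ((κ e).1 j) ξ)) := by
    conv_lhs => rw [← sum_smul_gen κ e, connPart_sum, _root_.sum_apply]
    exact Finset.sum_congr rfl fun j _ => connPart_smul hT hE hnabla _ _ _
  have h2 : tensL ρ κ (g e) η =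
      ∑ j, tensL ρ κ (g (gen κ j)) (rightRep ρ (β.hom ((κ e).1 j)) η) := by
    rw [← sum_smul_grading_gen hE e, tensL_sum, _root_.sum_apply]
    exact Finset.sum_congr rfl fun j _ => tensL_smul _ _ _ _ _
  rw [h1, h2, ← Finset.sum_add_distrib]
  refine Finset.sum_congr rfl fun j _ => ?_
  simp only [coord_tensL, map_add]
  abel

omit hE

/-- The graph is spanned by its elements over ξ ⊗ e_j, so symmetry, commutators and inclusions need
only be checked there. -/
theorem dhat_graph_le {V : Submodule ℂ (TwistSpace ρ q × TwistSpace ρ q)}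
    (hV : ∀ j ξ η, (ξ, η) ∈ D.graph → (tensL ρ κ (gen κ j) ξ,
      tensL ρ κ (g (gen κ j)) η + connPart hT hnabla (gen κ j) ξ) ∈ V) :
    (dhat hT hnabla).graph ≤ V := by
  rw [dhat_graph]
  rintro ⟨x, y⟩ ⟨η, h1, h2⟩
  have : (x, y) = ∑ j, (tensL ρ κ (gen κ j) (coord ρ q j x), tensL ρ κ (g (gen κ j)) (η j) +
      connPart hT hnabla (gen κ j) (coord ρ q j x)) := by
    ext1
    · rw [Prod.fst_sum]
      exact (sum_tensL_coord ρ κ x).symm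
    · rw [Prod.snd_sum]
      exact h2
  rw [this]
  exact V.sum_mem fun j _ => hV j _ _ (h1 j)

theorem dhat_isComm {T T' S : TwistSpace ρ q →L[ℂ] TwistSpace ρ q}
    (h : ∀ j ξ η, (ξ, η) ∈ D.graph → (T (tensL ρ κ (gen κ j) ξ),
      T' (tensL ρ κ (g (gen κ j)) η + connPart hT hnabla (gen κ j) ξ) +
        S (tensL ρ κ (gen κ j) ξ)) ∈ (dhat hT hnabla).graph) :
    IsComm (dhat hT hnabla) T T' S := by
  rw [isComm_iff_graph]
  intro x y hxy
  let L : (TwistSpace ρ q × TwistSpace ρ q) →ₗ[ℂ] (TwistSpace ρ q × TwistSpace ρ q) :=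
    ((T ∘L ContinuousLinearMap.fst ℂ _ _).prod
      (T' ∘L ContinuousLinearMap.snd ℂ _ _ + S ∘L ContinuousLinearMap.fst ℂ _ _)).toLinearMap
  exact dhat_graph_le (V := (dhat hT hnabla).graph.comap L) hT hnabla h hxy

theorem dense_dhat_domain : Dense ((dhat hT hnabla).domain : Set (TwistSpace ρ q)) := by
  let Φ : (Fin n → H) → TwistSpace ρ q := fun v => ∑ j, tensL ρ κ (gen κ j) (v j)
  have hΦ : Continuous Φ := by fun_prop
  have hs : Function.Surjective Φ := fun x => ⟨_, sum_tensL_coord ρ κ x⟩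
  have hd : Dense (Set.univ.pi fun _ : Fin n => (D.domain : Set H)) :=
    dense_pi _ fun _ _ => hT.dense
  refine (hs.denseRange.dense_image hΦ hd).mono ?_
  rintro _ ⟨v, hv, rfl⟩
  refine Submodule.sum_mem _ fun j _ => (mem_dhat_domain hT hnabla).2 fun i => ?_
  exact (hT.isComm_right ((κ (gen κ j)).1 i) ⟨v j, hv j trivial⟩).1

end Twist

/-! ### Symmetry and selfadjointness of the twisted operator -/

section Twist

variable {A B C E H : Type*} [Ring A] [StarRing A] [Algebra ℂ A]
  [Ring B] [StarRing B] [Algebra ℂ B] [StarModule ℂ B] [TopologicalSpace B]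
  [IsTopologicalRing B] [ContinuousStar B] [Ring C] [StarRing C]
  [AddCommGroup E] [Module ℂ E] [Module B E] [Module Cᵐᵒᵖ E]
  [NormedAddCommGroup H] [InnerProductSpace ℂ H] [CompleteSpace H] {n : ℕ} {q : Projector B n}
  {π : A →⋆ₐ[ℂ] (H →L[ℂ] H)} {ρ : Bᵐᵒᵖ →⋆ₐ[ℂ] (H →L[ℂ] H)} {β : AlgGrading B}
  {D : H →ₗ.[ℂ] H} {Γ : H →L[ℂ] H} (hT : GradedEvenTriple π ρ β D Γ)
  {κ : E ≃ₗ[B] rowModule q.mat} {g : E →ₗ[ℂ] E} (hE : GradedBimodule C β κ g)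
  {nabla : E →ₗ[ℂ] (Fin n → BilinDual B)} (hnabla : HermitianConnection β κ g nabla)

include hE

theorem grading_pairing_right (e f : E) : β.hom (pairing κ e (g f)) = pairing κ (g e) f := by
  rw [← hE.grading_pairing, hE.invol]

/-- This is compatibility of ∇ with the inner product for the pair e, g f, with evenness used to
express ∇(g f) through ∇f. -/
theorem gradedComm_pairing (e f : E) : gradedComm ρ β D (pairing κ e (g f)) =
    ∑ j, rightRep ρ (pairing κ (g (gen κ j)) f) * Γ * connOp hT hnabla e j -
      ∑ j, star (connOp hT hnabla f j) * Γ * rightRep ρ (pairing κ e (g (gen κ j))) := by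
  have h1 : ∀ j, rightRep ρ (pairing κ (g (gen κ j)) f) * Γ =
      Γ * rightRep ρ (star ((κ (g f)).1 j)) := fun j => by
    rw [hT.grading_mul_rightRep, ← pairing_gen_left, grading_pairing_right hE]
  have h2 : ∀ k, Γ * star (connOp hT hnabla (g f) k) = -∑ j, star (connOp hT hnabla f j) * Γ *
      rightRep ρ (star ((κ (g (gen κ j))).1 k)) := fun k => by
    rw [connOp_grading, star_sum, Finset.mul_sum, ← Finset.sum_neg_distrib]
    refine Finset.sum_congr rfl fun j _ => ?_
    rw [star_mul, star_neg, star_mul, star_mul, hT.grading_star.star_eq, ← rightRep_star]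
    simp only [neg_mul, mul_neg, ← mul_assoc, hT.grading_sq, one_mul]
  rw [← hT.grading_mul_deriv, deriv_pairing hT hnabla, mul_add, Finset.mul_sum, Finset.mul_sum,
    sub_eq_add_neg]
  simp only [h1, ← mul_assoc, h2]
  congr 1
  simp only [neg_mul, Finset.sum_neg_distrib, Finset.sum_mul]
  rw [Finset.sum_comm]
  congr 1
  refine Finset.sum_congr rfl fun j _ => ?_
  rw [pairing, map_sum, Finset.mul_sum]
  refine Finset.sum_congr rfl fun k _ => ?_
  rw [rightRep_mul, mul_assoc]

theorem inner_connPart (e f : E) (ξ u : H) :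
    ⟪connPart hT hnabla e ξ, tensL ρ κ f u⟫_ℂ =
      ⟪gradedComm ρ β D (pairing κ e (g f)) ξ, u⟫_ℂ +
        ⟪tensL ρ κ e ξ, connPart hT hnabla f u⟫_ℂ := by
  rw [gradedComm_pairing hT hE hnabla, connPart_apply, connPart_apply, sum_inner, inner_sum]
  simp only [inner_tensL]
  rw [_root_.sub_apply, _root_.sum_apply, _root_.sum_apply, inner_sub_left, sum_inner, sum_inner]
  have h : ∀ j, ⟪rightRep ρ (pairing κ e (g (gen κ j))) ξ, Γ (connOp hT hnabla f j u)⟫_ℂ =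
      ⟪(star (connOp hT hnabla f j) * Γ * rightRep ρ (pairing κ e (g (gen κ j)))) ξ, u⟫_ℂ := by
    intro j
    rw [← hT.grading_star.inner_symm]
    exact (ContinuousLinearMap.adjoint_inner_left _ _ _).symm
  simp only [h, sub_add_cancel]
  rfl

theorem adjoint_connPart_tensL (e f : E) (ξ : H) :
    ContinuousLinearMap.adjoint (connPart hT hnabla f) (tensL ρ κ e ξ) =
      ContinuousLinearMap.adjoint (tensL ρ κ f) (connPart hT hnabla e ξ) -
        gradedComm ρ β D (pairing κ e (g f)) ξ := by
  refine ext_inner_right ℂ fun η => ?_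
  rw [inner_sub_left, ContinuousLinearMap.adjoint_inner_left,
    ContinuousLinearMap.adjoint_inner_left, inner_connPart hT hE hnabla, add_sub_cancel_left]

/-- With b = (e | g f), the connection terms contribute [D, b^op]_± and turn the β(b)^op D ξ of the
first term into D b^op ξ. Symmetry of D then applies. -/
theorem dhat_symmetric_tensL (e f : E) {ξ η u v : H} (h : (ξ, η) ∈ D.graph)
    (h' : (u, v) ∈ D.graph) :
    ⟪tensL ρ κ (g e) η + connPart hT hnabla e ξ, tensL ρ κ f u⟫_ℂ =
      ⟪tensL ρ κ e ξ, tensL ρ κ (g f) v + connPart hT hnabla f u⟫_ℂ := by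
  rw [inner_add_left, inner_add_right, inner_connPart hT hE hnabla, inner_tensL, inner_tensL,
    ← add_assoc, ← grading_pairing_right hE, ← inner_add_left]
  congr 1
  exact (hT.triple.selfAdjoint.graph_symm (isComm_iff_graph.1
    (hT.isComm_right (pairing κ e (g f))) ξ η h) h')

theorem dhat_symmetric {x y u v : TwistSpace ρ q} (h : (x, y) ∈ (dhat hT hnabla).graph)
    (h' : (u, v) ∈ (dhat hT hnabla).graph) : ⟪y, u⟫_ℂ = ⟪x, v⟫_ℂ := by
  have h1 : (dhat hT hnabla).graph ≤ (dhat hT hnabla).graph.adjoint := by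
    refine dhat_graph_le hT hnabla fun j ξ η hξ => ?_
    rw [Submodule.mem_adjoint_iff]
    intro a b hab
    -- Extending symmetry from frame elements to the graph goes one variable at a time; here one
    -- element is fixed and the other varies.
    let p := (tensL ρ κ (gen κ j) ξ, tensL ρ κ (g (gen κ j)) η + connPart hT hnabla (gen κ j) ξ)
    have h2 : (dhat hT hnabla).graph ≤ (Submodule.span ℂ {p}).adjoint := by
      refine dhat_graph_le hT hnabla fun k ξ' η' hξ' => ?_
      rw [Submodule.mem_adjoint_iff]
      intro c d hcd
      obtain ⟨r, hr⟩ := Submodule.mem_span_singleton.1 hcd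
      have hc : c = r • p.1 := (congrArg Prod.fst hr).symm
      have hd : d = r • p.2 := (congrArg Prod.snd hr).symm
      rw [hc, hd]
      exact sub_eq_zero.2 ((inner_smul_left p.2 _ r).trans ((congrArg _
        (dhat_symmetric_tensL hT hE hnabla _ _ hξ hξ')).trans (inner_smul_left p.1 _ r).symm))
    have h3 := (Submodule.mem_adjoint_iff _ _).1 (h2 hab) p.1 p.2
      (Submodule.mem_span_singleton_self p)
    have h4 := congrArg (starRingEnd ℂ) (sub_eq_zero.1 h3)
    rw [inner_conj_symm, inner_conj_symm] at h4
    exact sub_eq_zero.2 h4.symm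
  exact sub_eq_zero.1 ((Submodule.mem_adjoint_iff _ _).1 (h1 h') x y h)

/-- Since g² = 1, D̂(ξ ⊗ g e_j) is D ξ ⊗ e_j plus a bounded term. Pairing with x isolates ⟨D ξ,
x_j⟩, so selfadjointness of D puts x_j into Dom D. -/
theorem coord_mem_graph {x y : TwistSpace ρ q}
    (h : ∀ u v, (u, v) ∈ (dhat hT hnabla).graph → ⟪v, x⟫_ℂ = ⟪u, y⟫_ℂ) (j : Fin n) :
    (coord ρ q j x, ContinuousLinearMap.adjoint (tensL ρ κ (g (gen κ j))) y -
      ContinuousLinearMap.adjoint (connPart hT hnabla (g (gen κ j))) x) ∈ D.graph := by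
  refine (hT.triple.selfAdjoint.mem_graph_iff_inner).2 fun ξ η hξ => ?_
  have h2 := h _ _ (tensL_mem_dhat_graph hT hE hnabla (g (gen κ j)) hξ)
  rw [hE.invol, inner_add_left] at h2
  rw [inner_sub_right, ContinuousLinearMap.adjoint_inner_right,
    ContinuousLinearMap.adjoint_inner_right, ← h2, add_sub_cancel_right,
    ← adjoint_tensL_gen ρ κ, ContinuousLinearMap.adjoint_inner_right]

theorem isSelfAdjoint_dhat : IsSelfAdjoint (dhat hT hnabla) := by
  refine (isSelfAdjoint_iff_graph (dense_dhat_domain hT hnabla)).2 fun x y =>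
    ⟨fun h u v h' => dhat_symmetric hT hE hnabla h' h, fun h => ?_⟩
  have h1 : x ∈ (dhat hT hnabla).domain := (mem_dhat_domain hT hnabla).2 fun j =>
    LinearPMap.mem_domain_iff.2 ⟨_, coord_mem_graph hT hE hnabla h j⟩
  obtain ⟨y', h2⟩ := LinearPMap.mem_domain_iff.1 h1
  have h3 : y = y' := by
    refine (dense_dhat_domain hT hnabla).eq_of_inner_right ℂ fun u hu => ?_
    obtain ⟨v, hv⟩ := LinearPMap.mem_domain_iff.1 hu
    rw [← h _ _ hv, dhat_symmetric hT hE hnabla hv h2]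
  rwa [h3]

theorem dhat_graph_eq_twistGraph :
    (dhat hT hnabla).graph = twistGraph ρ β D Γ κ g nabla := by
  apply le_antisymm
  · refine dhat_graph_le hT hnabla fun j ξ η hξ => ?_
    have h := mem_closure_smooth_graph hT.triple.selfAdjoint hξ
    refine map_mem_closure (f := fun z : H × H => ((tensL ρ κ (gen κ j) z.1,
        tensL ρ κ (g (gen κ j)) z.2 + connPart hT hnabla (gen κ j) z.1) :
        TwistSpace ρ q × TwistSpace ρ q)) (x := (ξ, η)) (by fun_prop) h ?_
    rintro ⟨u, v⟩ ⟨hu, huv⟩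
    refine Submodule.subset_span ⟨u, hu, v, gen κ j, connOp hT hnabla (gen κ j), huv,
      isFormAction_connOp hT hnabla _, ?_⟩
    change (_, _ + connPart hT hnabla (gen κ j) u) = _
    rw [connPart_apply]
    rfl
  · refine Submodule.topologicalClosure_minimal _ (Submodule.span_le.2 ?_)
      (isSelfAdjoint_dhat hT hE hnabla).isClosed_graph
    rintro _ ⟨ξ, -, η, e, S, h1, h2, rfl⟩
    have : S = connOp hT hnabla e := funext fun j =>
      (hT.acts_of_isFormAction (h2 j)).unique (acts_connOp hT hnabla e j)
    subst this
    have := tensL_mem_dhat_graph hT hE hnabla e h1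
    rw [connPart_apply] at this
    exact this

end Twist

/-! ## The actions of `A` and `C^op` on `H ⊗_B E` -/

section Actions

variable {A B C E H : Type*} [Ring A] [StarRing A] [Algebra ℂ A]
  [Ring B] [StarRing B] [Algebra ℂ B] [StarModule ℂ B] [TopologicalSpace B]
  [IsTopologicalRing B] [ContinuousStar B] [Ring C] [StarRing C] [Algebra ℂ C]
  [AddCommGroup E] [Module ℂ E] [Module B E] [Module Cᵐᵒᵖ E]
  [NormedAddCommGroup H] [InnerProductSpace ℂ H] [CompleteSpace H] {n : ℕ} {q : Projector B n}
  {π : A →⋆ₐ[ℂ] (H →L[ℂ] H)} {ρ : Bᵐᵒᵖ →⋆ₐ[ℂ] (H →L[ℂ] H)} {β : AlgGrading B}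
  {D : H →ₗ.[ℂ] H} {Γ : H →L[ℂ] H}

theorem sum_tensL_gen_rightRep (κ : E ≃ₗ[B] rowModule q.mat) (e : E) (ξ : H) :
    ∑ j, tensL ρ κ (gen κ j) (rightRep ρ ((κ e).1 j) ξ) = tensL ρ κ e ξ :=
  sum_tensL_coord ρ κ (tensL ρ κ e ξ)

theorem twist_ext_inner (κ : E ≃ₗ[B] rowModule q.mat)
    {S T : TwistSpace ρ q →L[ℂ] TwistSpace ρ q}
    (h : ∀ e f ξ η, ⟪S (tensL ρ κ e ξ), tensL ρ κ f η⟫_ℂ = ⟪T (tensL ρ κ e ξ), tensL ρ κ f η⟫_ℂ) :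
    S = T := by
  refine twist_ext ρ κ fun j ξ => ext_inner_right ℂ fun y => ?_
  rw [← sum_tensL_coord ρ κ y, inner_sum, inner_sum]
  exact Finset.sum_congr rfl fun i _ => h _ _ _ _

theorem eq_star_of_inner (κ : E ≃ₗ[B] rowModule q.mat)
    {S T : TwistSpace ρ q →L[ℂ] TwistSpace ρ q}
    (h : ∀ e f ξ η, ⟪S (tensL ρ κ e ξ), tensL ρ κ f η⟫_ℂ = ⟪tensL ρ κ e ξ, T (tensL ρ κ f η)⟫_ℂ) :
    S = star T :=
  twist_ext_inner κ fun e f ξ η =>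
    (h e f ξ η).trans (ContinuousLinearMap.adjoint_inner_left _ _ _).symm

/-- The operator `ξ ⊗ e ↦ T ξ ⊗ e`, for `T` commuting with `B^op`. -/
noncomputable def tensOp (κ : E ≃ₗ[B] rowModule q.mat) (T : H →L[ℂ] H) :
    TwistSpace ρ q →L[ℂ] TwistSpace ρ q :=
  ofColumns ρ q fun j => tensL ρ κ (gen κ j) ∘L T

theorem tensOp_tensL (κ : E ≃ₗ[B] rowModule q.mat) {T : H →L[ℂ] H}
    (hT : ∀ b, Commute T (rightRep ρ b)) (e : E) (ξ : H) :
    tensOp κ T (tensL ρ κ e ξ) = tensL ρ κ e (T ξ) := by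
  rw [tensOp, ofColumns_tensL, ← sum_tensL_gen_rightRep κ e (T ξ)]
  exact Finset.sum_congr rfl fun j _ =>
    congrArg (fun S : H →L[ℂ] H => tensL ρ κ (gen κ j) (S ξ)) (hT _).eq

section Left

variable (hT : GradedEvenTriple π ρ β D Γ) (κ : E ≃ₗ[B] rowModule q.mat)
include hT

theorem tensOp_rep_tensL (a : A) (e : E) (ξ : H) :
    tensOp κ (π a) (tensL ρ κ e ξ) = tensL ρ κ e (π a ξ) :=
  tensOp_tensL κ (hT.commute_rightRep a) e ξ

theorem tensOp_rep_star (a : A) :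
    tensOp (ρ := ρ) κ (π (star a)) = star (tensOp (ρ := ρ) κ (π a)) :=
  eq_star_of_inner κ fun e f ξ η => by
    have h : rightRep ρ (pairing κ e f) (π (star a) ξ) =
        ContinuousLinearMap.adjoint (π a) (rightRep ρ (pairing κ e f) ξ) := by
      have h := congrArg (fun S : H →L[ℂ] H => S ξ)
        (hT.commute_rightRep (star a) (pairing κ e f)).eq.symm
      refine h.trans ?_
      rw [map_star]
      rfl
    rw [tensOp_rep_tensL hT, tensOp_rep_tensL hT, inner_tensL, inner_tensL, h,
      ContinuousLinearMap.adjoint_inner_left]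

/-- The representation of `A` on `H ⊗_B E`. -/
noncomputable def leftHat : A →⋆ₐ[ℂ] (TwistSpace ρ q →L[ℂ] TwistSpace ρ q) where
  toFun a := tensOp κ (π a)
  map_one' := twist_ext ρ κ fun j ξ => by
    rw [tensOp_rep_tensL hT, map_one]
    rfl
  map_mul' a a' := twist_ext ρ κ fun j ξ => by
    rw [_root_.mul_apply_eq_comp, tensOp_rep_tensL hT, tensOp_rep_tensL hT, tensOp_rep_tensL hT,
      map_mul]
    rfl
  map_zero' := twist_ext ρ κ fun j ξ => by
    rw [tensOp_rep_tensL hT, map_zero]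
    simp
  map_add' a a' := twist_ext ρ κ fun j ξ => by
    rw [_root_.add_apply, tensOp_rep_tensL hT, tensOp_rep_tensL hT, tensOp_rep_tensL hT, map_add,
      _root_.add_apply, map_add]
  commutes' c := twist_ext ρ κ fun j ξ => by
    rw [tensOp_rep_tensL hT, AlgHomClass.commutes, Algebra.algebraMap_eq_smul_one,
      Algebra.algebraMap_eq_smul_one, _root_.smul_apply, _root_.smul_apply, map_smul]
    rfl
  map_star' a := tensOp_rep_star hT κ a

theorem leftHat_tensL (a : A) (e : E) (ξ : H) :
    leftHat hT κ a (tensL ρ κ e ξ) = tensL ρ κ e (π a ξ) :=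
  tensOp_rep_tensL hT κ a e ξ

/-- If a acts as zero, then (e|f)^op a = 0 for all e, f. By fullness 1 is a norm limit of sums of
the (e|f)^op. -/
theorem leftHat_injective (hf : IsFull ρ κ) : Function.Injective (leftHat hT κ) := by
  rw [injective_iff_map_eq_zero]
  intro a ha
  have h1 : ∀ e f, rightRep ρ (pairing κ e f) * π a = 0 := fun e f => by
    ext ξ
    have h := leftHat_tensL hT κ a e ξ
    rw [ha] at h
    change rightRep ρ (pairing κ e f) (π a ξ) = 0
    rw [← adjoint_tensL_comp, ← h]
    exact map_zero _
  have h2 : ∀ z ∈ Submodule.span ℂ {z | ∃ e f, z = pairing κ e f}, rightRep ρ z * π a = 0 := by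
    intro z hz
    induction hz using Submodule.span_induction with
    | mem z h => obtain ⟨e, f, rfl⟩ := h; exact h1 e f
    | zero => rw [map_zero, zero_mul]
    | add x y _ _ hx hy => rw [map_add, add_mul, hx, hy, add_zero]
    | smul c x _ hx => rw [map_smul, smul_mul_assoc, hx, smul_zero]
  have h3 : IsClosed {T : H →L[ℂ] H | T * π a = 0} :=
    isClosed_eq (continuous_id.mul continuous_const) continuous_const
  have h4 : ρ (op 1) ∈ {T : H →L[ℂ] H | T * π a = 0} := by
    refine closure_minimal ?_ h3 (hf 1)
    rintro _ ⟨z, hz, rfl⟩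
    exact h2 z hz
  refine hT.faithful_left ?_
  rw [map_zero]
  simpa using h4

end Left

section Right

variable {g : E →ₗ[ℂ] E} {κ : E ≃ₗ[B] rowModule q.mat} (hE : GradedBimodule C β κ g)
  [IsScalarTower ℂ B E] [IsScalarTower ℂ Cᵐᵒᵖ E] [SMulCommClass B Cᵐᵒᵖ E]

variable (κ) in
/-- The operator `ξ ⊗ e ↦ ξ ⊗ e c`. -/
noncomputable def rightOp (c : Cᵐᵒᵖ) : TwistSpace ρ q →L[ℂ] TwistSpace ρ q :=
  ofColumns ρ q fun j => tensL ρ κ (c • gen κ j)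

omit [Algebra ℂ C] [IsScalarTower ℂ Cᵐᵒᵖ E] [IsScalarTower ℂ B E] in
theorem rightOp_tensL (c : Cᵐᵒᵖ) (e : E) (ξ : H) :
    rightOp κ c (tensL ρ κ e ξ) = tensL ρ κ (c • e) ξ := by
  rw [rightOp, ofColumns_tensL]
  conv_rhs => rw [← sum_smul_gen κ e, Finset.smul_sum, tensL_sum, _root_.sum_apply]
  refine Finset.sum_congr rfl fun j _ => ?_
  rw [← tensL_smul, smul_comm]

theorem tensL_complex_smul (r : ℂ) (e : E) (ξ : H) :
    tensL ρ κ (r • e) ξ = r • tensL ρ κ e ξ := by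
  rw [← algebraMap_smul B r e, tensL_smul, Algebra.algebraMap_eq_smul_one, map_smul, rightRep_one,
    _root_.smul_apply, map_smul]
  rfl

include hE in
variable (ρ) in
/-- The representation of `C^op` on `H ⊗_B E`. -/
noncomputable def rightHat : Cᵐᵒᵖ →⋆ₐ[ℂ] (TwistSpace ρ q →L[ℂ] TwistSpace ρ q) where
  toFun c := rightOp κ c
  map_one' := twist_ext ρ κ fun j ξ => by
    rw [rightOp_tensL, one_smul]
    rfl
  map_mul' c c' := twist_ext ρ κ fun j ξ => by
    rw [_root_.mul_apply_eq_comp, rightOp_tensL, rightOp_tensL, rightOp_tensL, mul_smul]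
  map_zero' := twist_ext ρ κ fun j ξ => by
    rw [rightOp_tensL, zero_smul, tensL_zero]
    rfl
  map_add' c c' := twist_ext ρ κ fun j ξ => by
    rw [_root_.add_apply, rightOp_tensL, rightOp_tensL, rightOp_tensL, add_smul, tensL_add]
    rfl
  commutes' r := twist_ext ρ κ fun j ξ => by
    rw [rightOp_tensL, algebraMap_smul, tensL_complex_smul, Algebra.algebraMap_eq_smul_one]
    rfl
  map_star' c := eq_star_of_inner κ fun e f ξ η => by
    rw [rightOp_tensL, rightOp_tensL, inner_tensL, inner_tensL]
    have h := hE.adjointable (star (unop c)) e f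
    rw [star_star] at h
    exact congrArg (fun b => ⟪rightRep ρ b ξ, η⟫_ℂ) h

theorem rightHat_tensL (c : Cᵐᵒᵖ) (e : E) (ξ : H) :
    rightHat ρ hE c (tensL ρ κ e ξ) = tensL ρ κ (c • e) ξ :=
  rightOp_tensL c e ξ

theorem rightHat_injective (hρ : Function.Injective ρ)
    (h : ∀ c : C, (∀ e : E, op c • e = 0) → c = 0) : Function.Injective (rightHat ρ hE) := by
  rw [injective_iff_map_eq_zero]
  intro c hc
  have : unop c = 0 := by
    refine h _ fun e => κ.injective ?_
    rw [map_zero]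
    ext j
    have h1 : ∀ ξ, rightRep ρ ((κ (c • e)).1 j) ξ = 0 := fun ξ => by
      rw [← coord_tensL, ← rightHat_tensL hE, hc]
      rfl
    have h2 : ρ (op ((κ (c • e)).1 j)) = 0 := ContinuousLinearMap.ext h1
    exact op_injective (hρ (h2.trans (map_zero ρ).symm))
  exact unop_injective this

theorem commute_leftHat_rightHat (hT : GradedEvenTriple π ρ β D Γ) (a : A) (c : Cᵐᵒᵖ) :
    Commute (leftHat hT κ a) (rightHat ρ hE c) :=
  twist_ext ρ κ fun j ξ => by
    rw [_root_.mul_apply_eq_comp, _root_.mul_apply_eq_comp, leftHat_tensL, rightHat_tensL, rightHat_tensL,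
      leftHat_tensL]

end Right

/-! ### Commutators of the twisted operator with both actions -/

section Commutators

variable (hT : GradedEvenTriple π ρ β D Γ)
  {κ : E ≃ₗ[B] rowModule q.mat} {g : E →ₗ[ℂ] E} (hE : GradedBimodule C β κ g)
  {nabla : E →ₗ[ℂ] (Fin n → BilinDual B)} (hnabla : HermitianConnection β κ g nabla)

include hT

theorem GradedEvenTriple.isComm_left (a : A) : IsComm D (π a) (π a) (bddComm D (π a) (π a)) := by
  obtain ⟨S, hS⟩ := hT.triple.comm a
  rwa [hS.bddComm_eq hT.dense]

/-- Expand the commutator of D with a b^op = b^op a in both orders; the first order condition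
cancels the [D, b^op]_± terms. Hence [D, a] ⊗ g is balanced over B. -/
theorem GradedEvenTriple.bddComm_mul_rightRep (a : A) (b : B) :
    bddComm D (π a) (π a) * rightRep ρ b = rightRep ρ (β.hom b) * bddComm D (π a) (π a) := by
  have h1 := (hT.isComm_left a).mul (hT.isComm_right b)
  have h2 := (hT.isComm_right b).mul (hT.isComm_left a)
  rw [← (hT.commute_rightRep a b).eq, ← (hT.commute_rightRep a (β.hom b)).eq] at h2
  have h3 := h1.unique hT.dense h2
  rw [(hT.firstOrder a b).eq, add_comm] at h3
  exact add_left_cancel h3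

omit hT

variable (D π κ g) in
/-- The operator `ξ ⊗ e ↦ [D, a] ξ ⊗ g e`. -/
noncomputable def commHat (a : A) : TwistSpace ρ q →L[ℂ] TwistSpace ρ q :=
  ofColumns ρ q fun j => tensL ρ κ (g (gen κ j)) ∘L bddComm D (π a) (π a)

include hT hE

theorem commHat_tensL (a : A) (e : E) (ξ : H) :
    commHat π D κ g a (tensL ρ κ e ξ) = tensL ρ κ (g e) (bddComm D (π a) (π a) ξ) := by
  rw [commHat, ofColumns_tensL, ← sum_smul_grading_gen hE e, tensL_sum, _root_.sum_apply]
  refine Finset.sum_congr rfl fun j _ => ?_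
  rw [tensL_smul]
  exact congrArg (fun S : H →L[ℂ] H => tensL ρ κ (g (gen κ j)) (S ξ))
    (hT.bddComm_mul_rightRep a _)

omit hE in
theorem leftHat_connPart (a : A) (e : E) (ξ : H) :
    leftHat hT κ a (connPart hT hnabla e ξ) = connPart hT hnabla e (π a ξ) := by
  rw [connPart_apply, connPart_apply, map_sum]
  refine Finset.sum_congr rfl fun j _ => ?_
  rw [leftHat_tensL]
  exact congrArg (fun S : H →L[ℂ] H => tensL ρ κ (g (gen κ j)) (S ξ))
    ((hT.grading_left a).mul_left (commute_connOp hT hnabla e j a)).eq.symm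

theorem isComm_leftHat (a : A) :
    IsComm (dhat hT hnabla) (leftHat hT κ a) (leftHat hT κ a) (commHat π D κ g a) := by
  refine dhat_isComm hT hnabla fun j ξ η h => ?_
  rw [commHat_tensL hT hE, leftHat_tensL, map_add, leftHat_tensL, leftHat_connPart,
    add_right_comm, ← map_add]
  exact tensL_mem_dhat_graph hT hE hnabla _ (isComm_iff_graph.1 (hT.isComm_left a) ξ η h)

theorem bddComm_leftHat (a : A) :
    bddComm (dhat hT hnabla) (leftHat hT κ a) (leftHat hT κ a) = commHat π D κ g a :=
  (isComm_leftHat hT hE hnabla a).bddComm_eq (dense_dhat_domain hT hnabla)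

variable [IsScalarTower ℂ B E] [IsScalarTower ℂ Cᵐᵒᵖ E] [SMulCommClass B Cᵐᵒᵖ E]

theorem commute_commHat_rightHat (a : A) (c : Cᵐᵒᵖ) :
    Commute (commHat π D κ g a) (rightHat ρ hE c) :=
  twist_ext ρ κ fun j ξ => by
    rw [_root_.mul_apply_eq_comp, _root_.mul_apply_eq_comp, rightHat_tensL, commHat_tensL hT hE,
      commHat_tensL hT hE, rightHat_tensL]
    exact congrArg (fun e => tensL ρ κ e _) (hE.grading_right (unop c) _)

/-- In the difference between ∇(ec) and (∇e)c the Leibniz terms cancel. What remains is B-linear in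
e and so defines a bounded operator from its values on the frame. -/
theorem exists_isComm_rightHat (c : Cᵐᵒᵖ) :
    ∃ S, IsComm (dhat hT hnabla) (rightHat ρ hE c) (rightHat ρ hE c) S := by
  let W : E → H →L[ℂ] TwistSpace ρ q := fun e =>
    connPart hT hnabla (c • e) - rightHat ρ hE c ∘L connPart hT hnabla e
  have hW : ∀ e ξ, W e ξ =
      connPart hT hnabla (c • e) ξ - rightHat ρ hE c (connPart hT hnabla e ξ) := fun _ _ => rfl
  have h1 : ∀ (b : B) e ξ, W (b • e) ξ = W e (rightRep ρ b ξ) := fun b e ξ => by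
    have h : g (c • e) = c • g e := hE.grading_right (unop c) e
    rw [hW, hW, ← smul_comm b c e, connPart_smul hT hE, connPart_smul hT hE, map_add, rightHat_tensL, h,
      add_sub_add_left_eq_sub]
  have h2 : ∀ e ξ, W e ξ = ∑ j, W (gen κ j) (rightRep ρ ((κ e).1 j) ξ) := fun e ξ => by
    simp only [← h1, hW, Finset.sum_sub_distrib, ← map_sum, ← _root_.sum_apply, ← connPart_sum,
      ← Finset.smul_sum, sum_smul_gen]
  refine ⟨ofColumns ρ q fun j => W (gen κ j), dhat_isComm hT hnabla fun j ξ η h => ?_⟩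
  rw [ofColumns_tensL, ← h2, hW, map_add, rightHat_tensL, rightHat_tensL, add_assoc,
    add_sub_cancel, ← show g (c • gen κ j) = c • g (gen κ j) from hE.grading_right (unop c) _]
  exact tensL_mem_dhat_graph hT hE hnabla _ h

theorem isComm_rightHat (c : Cᵐᵒᵖ) : IsComm (dhat hT hnabla) (rightHat ρ hE c) (rightHat ρ hE c)
    (bddComm (dhat hT hnabla) (rightHat ρ hE c) (rightHat ρ hE c)) := by
  obtain ⟨S, hS⟩ := exists_isComm_rightHat hT hE hnabla c
  rwa [hS.bddComm_eq (dense_dhat_domain hT hnabla)]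

end Commutators

end Actions

/-! ## Summability -/

section Factors

universe u

variable {H K : Type u} [NormedAddCommGroup H] [InnerProductSpace ℂ H]
  [NormedAddCommGroup K] [InnerProductSpace ℂ K]

namespace FactorsThrough

variable {T T' : K →L[ℂ] K} {S : H →L[ℂ] H}

theorem of_comp (X : H →L[ℂ] K) (Z : K →L[ℂ] H) : FactorsThrough (X ∘L S ∘L Z) S :=
  ⟨1, fun _ => X, fun _ => Z, by simp⟩

theorem zero : FactorsThrough (0 : K →L[ℂ] K) S := ⟨0, 0, 0, by simp⟩

theorem add (h : FactorsThrough T S) (h' : FactorsThrough T' S) : FactorsThrough (T + T') S := by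
  obtain ⟨m, X, Z, rfl⟩ := h
  obtain ⟨n, X', Z', rfl⟩ := h'
  refine ⟨m + n, Fin.append X X', Fin.append Z Z', ?_⟩
  rw [Fin.sum_univ_add]
  simp

theorem comp_left (h : FactorsThrough T S) (Y : K →L[ℂ] K) : FactorsThrough (Y ∘L T) S := by
  obtain ⟨m, X, Z, rfl⟩ := h
  refine ⟨m, fun j => Y ∘L X j, Z, ?_⟩
  ext x
  simp

end FactorsThrough

end Factors

section Summability

universe u

variable {A B C E : Type*} {H : Type u} [Ring A] [StarRing A] [Algebra ℂ A]
  [Ring B] [StarRing B] [Algebra ℂ B] [StarModule ℂ B] [TopologicalSpace B]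
  [IsTopologicalRing B] [ContinuousStar B] [Ring C] [StarRing C] [Algebra ℂ C]
  [AddCommGroup E] [Module ℂ E] [Module B E] [Module Cᵐᵒᵖ E]
  [NormedAddCommGroup H] [InnerProductSpace ℂ H] [CompleteSpace H] {n : ℕ} {q : Projector B n}
  {π : A →⋆ₐ[ℂ] (H →L[ℂ] H)} {ρ : Bᵐᵒᵖ →⋆ₐ[ℂ] (H →L[ℂ] H)} {β : AlgGrading B}
  {D : H →ₗ.[ℂ] H} {Γ : H →L[ℂ] H} (hT : GradedEvenTriple π ρ β D Γ)
  {κ : E ≃ₗ[B] rowModule q.mat} {g : E →ₗ[ℂ] E} (hE : GradedBimodule C β κ g)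
  {nabla : E →ₗ[ℂ] (Fin n → BilinDual B)} (hnabla : HermitianConnection β κ g nabla)
  {R : H →L[ℂ] H} {Rhat : TwistSpace ρ q →L[ℂ] TwistSpace ρ q}

include hE

/-- The coordinates of R̂ x lie in Dom D = ran R, so they are R Z_j x with Z_j bounded; reassemble
them with the frame. -/
theorem factorsThrough_regInv (hR : IsRegInv D R) (hRhat : IsRegInv (dhat hT hnabla) Rhat) :
    FactorsThrough Rhat R := by
  obtain ⟨F, hF⟩ := hR.exists_isBoundedTransform hT.triple.selfAdjoint
  obtain ⟨Fhat, hFhat⟩ := hRhat.exists_isBoundedTransform (isSelfAdjoint_dhat hT hE hnabla)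
  have h : ∀ j, ∃ Z, R ∘L Z = coord ρ q j ∘L Rhat := fun j => by
    refine exists_comp_eq hF.inj _ fun x => hF.mem_domain_iff.1 ?_
    exact (mem_dhat_domain hT hnabla).1 (hFhat.mem_domain_iff.2 ⟨x, rfl⟩) j
  choose Z hZ using h
  refine ⟨n, fun j => tensL ρ κ (gen κ j), Z, ?_⟩
  ext1 x
  simp only [hZ]
  rw [_root_.sum_apply]
  exact (sum_tensL_coord ρ κ (Rhat x)).symm

/-- As R ξ ⊗ e lies in Dom D̂, each (e|f)^op R factors through R̂. Fullness gives a combination of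
the (e|f)^op within distance 1 of the identity, hence invertible. -/
theorem factorsThrough_regInv_of_isFull (hf : IsFull ρ κ) (hR : IsRegInv D R)
    (hRhat : IsRegInv (dhat hT hnabla) Rhat) : FactorsThrough R Rhat := by
  obtain ⟨F, hF⟩ := hR.exists_isBoundedTransform hT.triple.selfAdjoint
  obtain ⟨Fhat, hFhat⟩ := hRhat.exists_isBoundedTransform (isSelfAdjoint_dhat hT hE hnabla)
  have h1 : ∀ e f, FactorsThrough (rightRep ρ (pairing κ e f) ∘L R) Rhat := fun e f => by
    obtain ⟨Z, hZ⟩ := exists_comp_eq hFhat.inj (tensL ρ κ e ∘L R) fun x =>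
      hFhat.mem_domain_iff.1 (LinearPMap.mem_domain_iff.2
        ⟨_, tensL_mem_dhat_graph hT hE hnabla e (hF.mem_graph x)⟩)
    have : rightRep ρ (pairing κ e f) ∘L R =
        ContinuousLinearMap.adjoint (tensL ρ κ f) ∘L Rhat ∘L Z := by
      rw [hZ]
      ext x
      exact (adjoint_tensL_comp ρ κ e f (R x)).symm
    rw [this]
    exact .of_comp _ _
  have h2 : ∀ z ∈ Submodule.span ℂ {z | ∃ e f, z = pairing κ e f},
      FactorsThrough (rightRep ρ z ∘L R) Rhat := by
    intro z hz
    induction hz using Submodule.span_induction with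
    | mem z h => obtain ⟨e, f, rfl⟩ := h; exact h1 e f
    | zero => rw [map_zero, ContinuousLinearMap.zero_comp]; exact .zero
    | add x y _ _ hx hy => rw [map_add, ContinuousLinearMap.add_comp]; exact hx.add hy
    | smul c x _ hx =>
      have := hx.comp_left (c • ContinuousLinearMap.id ℂ H)
      rwa [← ContinuousLinearMap.comp_assoc, ContinuousLinearMap.smul_comp,
        ContinuousLinearMap.id_comp, ← map_smul] at this
  obtain ⟨_, ⟨z, hz, rfl⟩, hlt⟩ := Metric.mem_closure_iff.1 (hf 1) 1 one_pos
  rw [op_one, map_one, dist_eq_norm] at hlt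
  let u := Units.oneSub (1 - rightRep ρ z) hlt
  have hu : (u : H →L[ℂ] H) = rightRep ρ z :=
    (Units.val_oneSub _ _).trans (sub_sub_cancel _ _)
  have h3 := (h2 z hz).comp_left (↑u⁻¹ : H →L[ℂ] H)
  have h4 : (↑u⁻¹ : H →L[ℂ] H) ∘L rightRep ρ z ∘L R = R := by
    rw [← hu]
    exact u.inv_mul_cancel_left R
  rwa [h4] at h3

theorem isSummableFor_dhat {J : (H →L[ℂ] H) → Prop}
    {J' : (TwistSpace ρ q →L[ℂ] TwistSpace ρ q) → Prop}
    (hJ : ∀ S T, FactorsThrough T S → J S → J' T) (h : IsSummableFor D J) :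
    IsSummableFor (dhat hT hnabla) J' := by
  obtain ⟨R, hR, hJR⟩ := h
  obtain ⟨Rhat, hRhat⟩ := exists_isRegInv (isSelfAdjoint_dhat hT hE hnabla)
  exact ⟨Rhat, hRhat, hJ R Rhat (factorsThrough_regInv hT hE hnabla hR hRhat) hJR⟩

theorem isSummableFor_of_dhat (hf : IsFull ρ κ) {J : (H →L[ℂ] H) → Prop}
    {J' : (TwistSpace ρ q →L[ℂ] TwistSpace ρ q) → Prop}
    (hJ : ∀ S T, FactorsThrough T S → J' S → J T) (h : IsSummableFor (dhat hT hnabla) J') :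
    IsSummableFor D J := by
  obtain ⟨Rhat, hRhat, hJR⟩ := h
  obtain ⟨R, hR⟩ := exists_isRegInv hT.triple.selfAdjoint
  exact ⟨R, hR, hJ Rhat R (factorsThrough_regInv_of_isFull hT hE hnabla hf hR hRhat) hJR⟩

theorem preSpectralTriple_leftHat : PreSpectralTriple (leftHat hT κ) (dhat hT hnabla) where
  selfAdjoint := isSelfAdjoint_dhat hT hE hnabla
  compact := isSummableFor_dhat hT hE hnabla (fun _ _ h => h.isCompactOperator) hT.triple.compact
  comm a := ⟨_, isComm_leftHat hT hE hnabla a⟩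

theorem summabilityExponents_subset :
    summabilityExponents D ⊆ summabilityExponents (dhat hT hnabla) := fun p hp =>
  ⟨hp.1, fun s hs => isSummableFor_dhat hT hE hnabla
    (fun _ _ h => h.memSchatten (by linarith [hp.1])) (hp.2 s hs)⟩

theorem summabilityExponents_eq (hf : IsFull ρ κ) :
    summabilityExponents D = summabilityExponents (dhat hT hnabla) :=
  (summabilityExponents_subset hT hE hnabla).antisymm fun p hp =>
    ⟨hp.1, fun s hs => isSummableFor_of_dhat hT hE hnabla hf
      (fun _ _ h => h.memSchatten (by linarith [hp.1])) (hp.2 s hs)⟩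

theorem exists_hasSpectralDim {d : ℝ} (h : HasSpectralDim D d) :
    ∃ d' ≤ d, HasSpectralDim (dhat hT hnabla) d' := by
  have hsub := summabilityExponents_subset hT hE hnabla
  have hne := h.1.mono hsub
  have hglb := isGLB_csInf hne ⟨1, fun p hp => hp.1⟩
  exact ⟨_, h.2.2 fun p hp => hglb.1 (hsub hp), hne, hglb⟩

theorem hasSpectralDim_iff (hf : IsFull ρ κ) (d : ℝ) :
    HasSpectralDim D d ↔ HasSpectralDim (dhat hT hnabla) d := by
  rw [HasSpectralDim, HasSpectralDim, summabilityExponents_eq hT hE hnabla hf]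

end Summability

/-! ## Expansions of commutators in powers of `D` -/

section Expansion

variable {H K L : Type*} [NormedAddCommGroup H] [InnerProductSpace ℂ H]
  [NormedAddCommGroup K] [InnerProductSpace ℂ K] [NormedAddCommGroup L] [InnerProductSpace ℂ L]

theorem SqRel.add {P : H →ₗ.[ℂ] H} {x z x' z' : H} (h : SqRel P x z) (h' : SqRel P x' z') :
    SqRel P (x + x') (z + z') := by
  obtain ⟨y, h1, h2⟩ := h
  obtain ⟨y', h1', h2'⟩ := h'
  exact ⟨y + y', P.graph.add_mem h1 h1', P.graph.add_mem h2 h2'⟩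

theorem SqRel.zero {P : H →ₗ.[ℂ] H} : SqRel P 0 0 := ⟨0, P.graph.zero_mem, P.graph.zero_mem⟩

theorem SqRel.sum {P : H →ₗ.[ℂ] H} {ι : Type*} (s : Finset ι) {x z : ι → H}
    (h : ∀ i ∈ s, SqRel P (x i) (z i)) : SqRel P (∑ i ∈ s, x i) (∑ i ∈ s, z i) := by
  classical
  induction s using Finset.induction_on with
  | empty => simpa using SqRel.zero
  | insert a s ha ih =>
    rw [Finset.sum_insert ha, Finset.sum_insert ha]
    exact (h a (by simp)).add (ih fun i hi => h i (Finset.mem_insert_of_mem hi))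

theorem SqRel.functional {P : H →ₗ.[ℂ] H} {x z z' : H} (h : SqRel P x z) (h' : SqRel P x z') :
    z = z' := by
  obtain ⟨y, h1, h2⟩ := h
  obtain ⟨y', h1', h2'⟩ := h'
  rw [LinearPMap.graph_unique h1 h1'] at h2
  exact LinearPMap.graph_unique h2 h2'

/-- `Q Y = Y₁ P + Y₀` on `Dom P` and `Q² Y = Y P² + Y₁' P + Y₀'` on `Dom P²`, with coefficients in
the space `V`. -/
structure HasExpansion (P : H →ₗ.[ℂ] H) (Q : K →ₗ.[ℂ] K) (V : Submodule ℂ (H →L[ℂ] K))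
    (Y : H →L[ℂ] K) : Prop where
  mem : Y ∈ V
  first : ∃ Y₁ ∈ V, ∃ Y₀ ∈ V, ∀ x y, (x, y) ∈ P.graph → (Y x, Y₁ y + Y₀ x) ∈ Q.graph
  second : ∃ Y₁ ∈ V, ∃ Y₀ ∈ V, ∀ x y w, (x, y) ∈ P.graph → (y, w) ∈ P.graph →
    SqRel Q (Y x) (Y w + Y₁ y + Y₀ x)

namespace HasExpansion

variable {P : H →ₗ.[ℂ] H} {Q : K →ₗ.[ℂ] K} {S : L →ₗ.[ℂ] L} {V : Submodule ℂ (H →L[ℂ] K)}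
  {W : Submodule ℂ (K →L[ℂ] L)} {U : Submodule ℂ (H →L[ℂ] L)} {Y Y' : H →L[ℂ] K} {Z : K →L[ℂ] L}

theorem comp (hZ : HasExpansion Q S W Z) (hY : HasExpansion P Q V Y)
    (hU : ∀ Z ∈ W, ∀ Y ∈ V, Z ∘L Y ∈ U) : HasExpansion P S U (Z ∘L Y) := by
  obtain ⟨Z₁, hZ₁, Z₀, hZ₀, hZf⟩ := hZ.first
  obtain ⟨Z₁', hZ₁', Z₀', hZ₀', hZs⟩ := hZ.second
  obtain ⟨Y₁, hY₁, Y₀, hY₀, hYf⟩ := hY.first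
  obtain ⟨Y₁', hY₁', Y₀', hY₀', hYs⟩ := hY.second
  refine ⟨hU _ hZ.mem _ hY.mem, ⟨Z₁ ∘L Y₁, hU _ hZ₁ _ hY₁, Z₁ ∘L Y₀ + Z₀ ∘L Y,
      U.add_mem (hU _ hZ₁ _ hY₀) (hU _ hZ₀ _ hY.mem), fun x y h => ?_⟩,
    ⟨Z ∘L Y₁' + Z₁' ∘L Y₁, U.add_mem (hU _ hZ.mem _ hY₁') (hU _ hZ₁' _ hY₁),
      Z ∘L Y₀' + Z₁' ∘L Y₀ + Z₀' ∘L Y, U.add_mem (U.add_mem (hU _ hZ.mem _ hY₀')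
        (hU _ hZ₁' _ hY₀)) (hU _ hZ₀' _ hY.mem), fun x y w h h' => ?_⟩⟩
  · have e : (Z₁ ∘L Y₁) y + (Z₁ ∘L Y₀ + Z₀ ∘L Y) x = Z₁ (Y₁ y + Y₀ x) + Z₀ (Y x) := by
      change Z₁ (Y₁ y) + (Z₁ (Y₀ x) + Z₀ (Y x)) = _
      rw [map_add, add_assoc]
    rw [e]
    exact hZf _ _ (hYf x y h)
  · obtain ⟨u, h1, h2⟩ := hYs x y w h h'
    rw [LinearPMap.graph_unique h1 (hYf x y h)] at h2
    have e : (Z ∘L Y) w + (Z ∘L Y₁' + Z₁' ∘L Y₁) y + (Z ∘L Y₀' + Z₁' ∘L Y₀ + Z₀' ∘L Y) x =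
        Z (Y w + Y₁' y + Y₀' x) + Z₁' (Y₁ y + Y₀ x) + Z₀' (Y x) := by
      change Z (Y w) + (Z (Y₁' y) + Z₁' (Y₁ y)) + (Z (Y₀' x) + Z₁' (Y₀ x) + Z₀' (Y x)) = _
      simp only [map_add]
      abel
    rw [e]
    exact hZs _ _ _ (hYf x y h) h2

theorem add (hY : HasExpansion P Q V Y) (hY' : HasExpansion P Q V Y') :
    HasExpansion P Q V (Y + Y') := by
  obtain ⟨Z₁, hZ₁, Z₀, hZ₀, hZf⟩ := hY'.first
  obtain ⟨Z₁', hZ₁', Z₀', hZ₀', hZs⟩ := hY'.second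
  obtain ⟨Y₁, hY₁, Y₀, hY₀, hYf⟩ := hY.first
  obtain ⟨Y₁', hY₁', Y₀', hY₀', hYs⟩ := hY.second
  refine ⟨V.add_mem hY.mem hY'.mem, ⟨Y₁ + Z₁, V.add_mem hY₁ hZ₁, Y₀ + Z₀, V.add_mem hY₀ hZ₀,
    fun x y h => ?_⟩, ⟨Y₁' + Z₁', V.add_mem hY₁' hZ₁', Y₀' + Z₀', V.add_mem hY₀' hZ₀',
    fun x y w h h' => ?_⟩⟩
  · convert Q.graph.add_mem (hYf x y h) (hZf x y h) using 1
    ext1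
    · rfl
    · change _ = _ + _
      simp only [_root_.add_apply]
      abel
  · have e : (Y + Y') w + (Y₁' + Z₁') y + (Y₀' + Z₀') x =
        (Y w + Y₁' y + Y₀' x) + (Y' w + Z₁' y + Z₀' x) := by
      simp only [_root_.add_apply]
      abel
    rw [e]
    exact (hYs x y w h h').add (hZs x y w h h')

theorem zero : HasExpansion P Q V 0 :=
  ⟨V.zero_mem, ⟨0, V.zero_mem, 0, V.zero_mem, fun x y _ => by simp⟩,
    ⟨0, V.zero_mem, 0, V.zero_mem, fun x y w _ _ => by simpa using SqRel.zero⟩⟩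

theorem sum {ι : Type*} (s : Finset ι) {Y : ι → H →L[ℂ] K}
    (h : ∀ i ∈ s, HasExpansion P Q V (Y i)) : HasExpansion P Q V (∑ i ∈ s, Y i) := by
  classical
  induction s using Finset.induction_on with
  | empty => simpa using HasExpansion.zero
  | insert a s ha ih =>
    rw [Finset.sum_insert ha]
    exact (h a (by simp)).add (ih fun i hi => h i (Finset.mem_insert_of_mem hi))

end HasExpansion

/-- A class of operators all of which have expansions with coefficients in the class consists of
smooth operators. -/
theorem IsBoundedTransform.sqSmooth_of_hasExpansion [CompleteSpace H] {D : H →ₗ.[ℂ] H}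
    {r F : H →L[ℂ] H} (h : IsBoundedTransform D r F) {V : Submodule ℂ (H →L[ℂ] H)}
    (hV : ∀ T ∈ V, HasExpansion D D V T) {T : H →L[ℂ] H} (hT : T ∈ V) : SqSmooth r T := by
  -- From [r⁻², T] r = T₁ F + T₀ r, the coefficients acquire right factors F and r that commute with
  -- r. Allowing such factors makes the class stable.
  let W : Submodule ℂ (H →L[ℂ] H) :=
    Submodule.span ℂ {X | ∃ T ∈ V, ∃ Y, Commute r Y ∧ X = T * Y}
  have key : ∀ X ∈ W, ∃ X' ∈ W, X * (r * r) - r * r * X = r * r * X' * r := by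
    intro X hX
    induction hX using Submodule.span_induction with
    | mem X hX =>
      obtain ⟨T, hT, Y, hY, rfl⟩ := hX
      obtain ⟨T₁, hT₁, T₀, hT₀, hs⟩ := (hV T hT).second
      refine ⟨T₁ * (F * Y) + T₀ * (r * Y), W.add_mem
        (Submodule.subset_span ⟨_, hT₁, _, h.comm.mul_right hY, rfl⟩)
        (Submodule.subset_span ⟨_, hT₀, _, (Commute.refl r).mul_right hY, rfl⟩), ?_⟩
      have e : T * (r * r) - r * r * T = r * r * (T₁ * F + T₀ * r) * r := by
        ext z
        have h1 := hs (r (r z)) (F (r z)) (F (F z)) (h.mem_graph _)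
          (by rw [← h.comm_apply]; exact h.mem_graph _)
        obtain ⟨w, hw1, hw2⟩ := h.sqRel_iff.1 h1
        change T (r (r z)) - r (r (T z)) = r (r (T₁ (F (r z)) + T₀ (r (r z))))
        rw [← hw1, ← map_sub, ← map_sub]
        have h3 : T (F (F z)) + T (r (r z)) = T z := by rw [← map_add, h.sq_apply]
        have h2 := h.sq_apply w
        rw [hw1, hw2] at h2
        rw [← h2, ← h3]
        congr 2
        abel
      have hYr : Y * r = r * Y := hY.eq.symm
      calc T * Y * (r * r) - r * r * (T * Y) = (T * (r * r) - r * r * T) * Y := by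
            rw [sub_mul, mul_assoc T, ← mul_assoc Y, hYr, mul_assoc r, hYr]
            simp only [mul_assoc]
        _ = _ := by
            rw [e]
            simp only [mul_assoc, add_mul, hYr]
    | zero => exact ⟨0, W.zero_mem, by simp⟩
    | add x y _ _ hx hy =>
      obtain ⟨x', hx', ex⟩ := hx
      obtain ⟨y', hy', ey⟩ := hy
      refine ⟨x' + y', W.add_mem hx' hy', ?_⟩
      calc _ = (x * (r * r) - r * r * x) + (y * (r * r) - r * r * y) := by noncomm_ring
        _ = _ := by rw [ex, ey, mul_add, add_mul]
    | smul c x _ hx =>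
      obtain ⟨x', hx', ex⟩ := hx
      refine ⟨c • x', W.smul_mem c hx', ?_⟩
      rw [mul_smul_comm, smul_mul_assoc, mul_smul_comm, smul_mul_assoc, ← ex, smul_sub]
  choose! f hf hc using key
  have hTW : T ∈ W := Submodule.subset_span ⟨T, hT, 1, Commute.one_right r, (mul_one T).symm⟩
  have hm : ∀ m, f^[m] T ∈ W := by
    intro m
    induction m with
    | zero => exact hTW
    | succ m ih => rw [Function.iterate_succ_apply']; exact hf _ ih
  refine ⟨fun m => f^[m] T, rfl, fun k => ?_⟩
  simp only [Function.iterate_succ_apply']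
  exact hc _ (hm k)

end Expansion

/-! ## Smooth operators and the modulus -/

section Modulus

variable {H : Type*} [NormedAddCommGroup H] [InnerProductSpace ℂ H] [CompleteSpace H]

/-- Anticommuting with D, Γ commutes with D², hence with (1 + D²)⁻¹ and with its square root. -/
theorem IsBoundedTransform.commute_of_anti {D : H →ₗ.[ℂ] H} {R F Γ : H →L[ℂ] H}
    (h : IsBoundedTransform D R F) (hΓ : IsComm D Γ (-Γ) 0) : Commute R Γ := by
  rw [isComm_iff_graph] at hΓ
  have hΓ' : ∀ x y, (x, y) ∈ D.graph → (Γ x, -Γ y) ∈ D.graph := fun x y hxy => by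
    simpa using hΓ x y hxy
  refine commute_of_commute_mul_self h.nonneg ?_
  ext x
  have h1 : SqRel D (Γ (R (R x))) (Γ (F (F x))) := by
    obtain ⟨y, h1, h2⟩ := h.sqRel_iff.2 ⟨x, rfl, rfl⟩
    exact ⟨_, hΓ' _ _ h1, by simpa using D.graph.neg_mem (hΓ' _ _ h2)⟩
  obtain ⟨w, hw1, hw2⟩ := h.sqRel_iff.1 h1
  have h2 := h.sq_apply w
  rw [hw1, hw2, ← map_add, h.sq_apply] at h2
  change R (R (Γ x)) = Γ (R (R x))
  rw [h2, hw1]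

/-- The bounded transforms of `D` and of its modulus `P`. -/
structure IsModulusTransform (D P : H →ₗ.[ℂ] H) (R F G : H →L[ℂ] H) : Prop where
  left : IsBoundedTransform D R F
  right : IsBoundedTransform P R G
  nonneg : 0 ≤ G

theorem IsModulus.exists_isModulusTransform {D P : H →ₗ.[ℂ] H} (hD : IsSelfAdjoint D)
    (hP : IsModulus D P) : ∃ R F G, IsModulusTransform D P R F G := by
  obtain ⟨R, F, h⟩ := _root_.exists_isBoundedTransform hD
  obtain ⟨G, hG, h'⟩ := hP.exists_isBoundedTransform h
  exact ⟨R, F, G, h, h', hG⟩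

namespace IsModulusTransform

variable {D P : H →ₗ.[ℂ] H} {R F G : H →L[ℂ] H} (h : IsModulusTransform D P R F G)
include h

theorem mul_self_eq : G * G = F * F :=
  add_right_cancel (h.right.sq.trans h.left.sq.symm)

theorem mul_self_apply (z : H) : G (G z) = F (F z) :=
  congrArg (fun T : H →L[ℂ] H => T z) h.mul_self_eq

theorem mul_self_eq_one_sub : G * G = 1 - R * R := eq_sub_of_add_eq h.right.sq

theorem commute_of_commute {X : H →L[ℂ] H} (hX : Commute R X) : Commute G X := by
  refine commute_of_commute_mul_self h.nonneg ?_
  rw [h.mul_self_eq_one_sub]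
  exact (Commute.one_left X).sub_left (hX.mul_left hX)

theorem mem_of_commute {X : H →L[ℂ] H} (hX : Commute R X) : X ∈ smoothAlgebra P :=
  MemDomInf.of_isComm_zero (h.right.isComm_of_commute hX (h.commute_of_commute hX))

theorem unique {P' : H →ₗ.[ℂ] H} (hP' : IsModulus D P') : P' = P := by
  obtain ⟨G', hG', h'⟩ := hP'.exists_isBoundedTransform h.left
  have e : G' = G := by
    have e1 : G' * G' = G * G := add_right_cancel (h'.sq.trans h.right.sq.symm)
    rw [← CFC.sqrt_mul_self G' hG', e1, CFC.sqrt_mul_self G h.nonneg]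
  subst e
  refine LinearPMap.eq_of_eq_graph ?_
  ext ⟨x, y⟩
  rw [h'.graph, h.right.graph]

theorem sqRel_iff {x z : H} : SqRel P x z ↔ SqRel D x z := by
  rw [h.right.sqRel_iff, h.left.sqRel_iff]
  simp only [h.mul_self_apply]

theorem mem_graph_modulus {x y : H} (hxy : (x, y) ∈ D.graph) : (x, G (R x + F y)) ∈ P.graph := by
  have := h.right.mem_graph (R x + F y)
  rwa [(h.left.eq_of_mem_graph hxy).1] at this

/-- Here |D| + b = R⁻¹, so that D = F R⁻¹ = F (|D| + b). -/
theorem exists_mem_graph : ∃ b, Commute R b ∧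
    ∀ x p, (x, p) ∈ P.graph → (x, F (p + b x)) ∈ D.graph := by
  obtain ⟨b, hb, -, he⟩ := h.right.exists_one_sub_eq h.nonneg
  refine ⟨b, hb, fun x p hp => ?_⟩
  obtain ⟨z, rfl, rfl⟩ := (h.right.graph _ _).1 hp
  have : G z + b (R z) = z := by
    have h1 : z - G z = R (b z) := congrArg (fun T : H →L[ℂ] H => T z) he
    have h2 : R (b z) = b (R z) := congrArg (fun T : H →L[ℂ] H => T z) hb.eq
    rw [← h2, ← h1, add_sub_cancel]
  rw [this]
  exact h.left.mem_graph z

theorem mem_smoothAlgebra_left : F ∈ smoothAlgebra P := h.mem_of_commute h.left.comm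

theorem mem_smoothAlgebra_regInv : R ∈ smoothAlgebra P := h.mem_of_commute (Commute.refl R)

theorem mem_smoothAlgebra_right : G ∈ smoothAlgebra P := h.mem_of_commute h.right.comm

/-- Commutators with |D| become expansions in D through D = F (|D| + b) and |D| = G (R + F D). For
the square, D² X = X D² + 2 X' |D| + X'' with X' and X'' the iterated commutators. -/
theorem hasExpansion {X : H →L[ℂ] H} (hX : X ∈ smoothAlgebra P) :
    HasExpansion D D (Subalgebra.toSubmodule (smoothAlgebra P)) X := by
  obtain ⟨X', hX', hc⟩ := (mem_smoothAlgebra.1 hX).exists_isComm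
  obtain ⟨X'', hX'', hc'⟩ := hX'.exists_isComm
  rw [isComm_iff_graph] at hc hc'
  obtain ⟨b, hb, hbD⟩ := h.exists_mem_graph
  have hF := h.mem_smoothAlgebra_left
  have hG := h.mem_smoothAlgebra_right
  have hR := h.mem_smoothAlgebra_regInv
  have hbm := h.mem_of_commute hb
  replace hX' : X' ∈ smoothAlgebra P := hX'
  replace hX'' : X'' ∈ smoothAlgebra P := hX''
  have hGF := mul_mem hG hF
  have hGR := mul_mem hG hR
  have h2X := add_mem hX' hX'
  have m1 := mul_mem hF (mul_mem hX hGF)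
  have m2 := mul_mem hF (add_mem (add_mem (mul_mem hX hGR) hX') (mul_mem hbm hX))
  have m3 := mul_mem h2X hGF
  have m4 := add_mem (mul_mem h2X hGR) hX''
  refine ⟨hX, ⟨_, m1, _, m2, fun x y hxy => ?_⟩, ⟨_, m3, _, m4, fun x y w hxy hyw => ?_⟩⟩
  · convert hbD _ _ (hc _ _ (h.mem_graph_modulus hxy)) using 2
    simp only [_root_.mul_apply_eq_comp, _root_.add_apply, map_add]
    abel
  · obtain ⟨p, h1, h2⟩ := h.sqRel_iff.2 ⟨y, hxy, hyw⟩
    have h3 : p = G (R x + F y) := LinearPMap.graph_unique h1 (h.mem_graph_modulus hxy)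
    rw [← h.sqRel_iff]
    refine ⟨_, hc _ _ h1, ?_⟩
    convert P.graph.add_mem (hc _ _ h2) (hc' _ _ h1) using 1
    rw [h3]
    ext1
    · rfl
    · change _ = _ + _
      simp only [_root_.mul_apply_eq_comp, _root_.add_apply, map_add]
      abel

end IsModulusTransform

end Modulus

/-! ## Operators on `H ⊗_B E` with smooth matrix entries -/

section Spaces

variable {B E H : Type*} [Ring B] [StarRing B] [Algebra ℂ B] [StarModule ℂ B] [TopologicalSpace B]
  [IsTopologicalRing B] [ContinuousStar B] [AddCommGroup E] [Module ℂ E] [Module B E]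
  [NormedAddCommGroup H] [InnerProductSpace ℂ H] [CompleteSpace H] {n : ℕ} {q : Projector B n}
  {ρ : Bᵐᵒᵖ →⋆ₐ[ℂ] (H →L[ℂ] H)} {κ : E ≃ₗ[B] rowModule q.mat} {O : Subalgebra ℂ (H →L[ℂ] H)}

variable (ρ q O) in
/-- The operators `H → H ⊗_B E` whose coordinates lie in `O`. -/
def colSpace : Submodule ℂ (H →L[ℂ] TwistSpace ρ q) where
  carrier := {Z | ∀ j, coord ρ q j ∘L Z ∈ O}
  zero_mem' j := by
    rw [ContinuousLinearMap.comp_zero]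
    exact O.zero_mem
  add_mem' h h' j := by
    rw [ContinuousLinearMap.comp_add]
    exact O.add_mem (h j) (h' j)
  smul_mem' c Z h j := by
    rw [ContinuousLinearMap.comp_smul]
    exact O.smul_mem (h j) c

variable (ρ κ O) in
/-- The operators `H ⊗_B E → H` whose columns lie in `O`. -/
def rowSpace : Submodule ℂ (TwistSpace ρ q →L[ℂ] H) where
  carrier := {Y | ∀ j, Y ∘L tensL ρ κ (gen κ j) ∈ O}
  zero_mem' j := by
    rw [ContinuousLinearMap.zero_comp]
    exact O.zero_mem
  add_mem' h h' j := by
    rw [ContinuousLinearMap.add_comp]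
    exact O.add_mem (h j) (h' j)
  smul_mem' c Z h j := by
    rw [ContinuousLinearMap.smul_comp]
    exact O.smul_mem (h j) c

variable (ρ κ O) in
/-- The operators on `H ⊗_B E` whose matrix entries lie in `O`. -/
def matSpace : Submodule ℂ (TwistSpace ρ q →L[ℂ] TwistSpace ρ q) where
  carrier := {T | ∀ i j, coord ρ q i ∘L T ∘L tensL ρ κ (gen κ j) ∈ O}
  zero_mem' i j := by
    rw [ContinuousLinearMap.zero_comp, ContinuousLinearMap.comp_zero]
    exact O.zero_mem
  add_mem' h h' i j := by
    rw [ContinuousLinearMap.add_comp, ContinuousLinearMap.comp_add]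
    exact O.add_mem (h i j) (h' i j)
  smul_mem' c Z h i j := by
    rw [ContinuousLinearMap.smul_comp, ContinuousLinearMap.comp_smul]
    exact O.smul_mem (h i j) c

theorem comp_mem_matSpace {Z : H →L[ℂ] TwistSpace ρ q} {Y : TwistSpace ρ q →L[ℂ] H}
    (hZ : Z ∈ colSpace q ρ O) (hY : Y ∈ rowSpace ρ κ O) : Z ∘L Y ∈ matSpace ρ κ O :=
  fun i j => O.mul_mem (hZ i) (hY j)

theorem comp_mem_colSpace {Z : H →L[ℂ] TwistSpace ρ q} {X : H →L[ℂ] H}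
    (hZ : Z ∈ colSpace q ρ O) (hX : X ∈ O) : Z ∘L X ∈ colSpace q ρ O :=
  fun j => O.mul_mem (hZ j) hX

theorem comp_mem_rowSpace {X : H →L[ℂ] H} {Y : TwistSpace ρ q →L[ℂ] H}
    (hX : X ∈ O) (hY : Y ∈ rowSpace ρ κ O) : X ∘L Y ∈ rowSpace ρ κ O :=
  fun j => O.mul_mem hX (hY j)

theorem eq_sum_comp_coord (Y : TwistSpace ρ q →L[ℂ] H) :
    Y = ∑ j, (Y ∘L tensL ρ κ (gen κ j)) ∘L coord ρ q j := by
  ext x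
  rw [_root_.sum_apply]
  conv_lhs => rw [← sum_tensL_coord ρ κ x, map_sum]
  rfl

theorem comp_mem_of_rowSpace_of_colSpace {Z : H →L[ℂ] TwistSpace ρ q}
    {Y : TwistSpace ρ q →L[ℂ] H} (hY : Y ∈ rowSpace ρ κ O) (hZ : Z ∈ colSpace q ρ O) :
    Y ∘L Z ∈ O := by
  have : Y ∘L Z = ∑ j, (Y ∘L tensL ρ κ (gen κ j)) * (coord ρ q j ∘L Z) := by
    ext x
    rw [_root_.sum_apply]
    conv_lhs => rw [eq_sum_comp_coord (κ := κ) Y]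
    rw [ContinuousLinearMap.comp_apply, _root_.sum_apply]
    rfl
  rw [this]
  exact O.sum_mem fun j _ => O.mul_mem (hY j) (hZ j)

variable (hρ : ∀ b, rightRep ρ b ∈ O)
include hρ

theorem tensL_mem_colSpace (e : E) : tensL ρ κ e ∈ colSpace q ρ O := fun _ => hρ _

theorem coord_mem_rowSpace (j : Fin n) : coord ρ q j ∈ rowSpace ρ κ O := fun _ => hρ _

theorem adjoint_tensL_mem_rowSpace (e : E) :
    ContinuousLinearMap.adjoint (tensL ρ κ e) ∈ rowSpace ρ κ O := fun j => by
  have : ContinuousLinearMap.adjoint (tensL ρ κ e) ∘L tensL ρ κ (gen κ j) =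
      rightRep ρ (pairing κ (gen κ j) e) :=
    ContinuousLinearMap.ext fun ξ => adjoint_tensL_comp ρ κ _ _ ξ
  rw [this]
  exact hρ _

end Spaces

/-! ### Expansions of operators on H ⊗_B E in powers of the twisted operator -/

section Expansion

variable {A B C E H : Type*} [Ring A] [StarRing A] [Algebra ℂ A]
  [Ring B] [StarRing B] [Algebra ℂ B] [StarModule ℂ B] [TopologicalSpace B]
  [IsTopologicalRing B] [ContinuousStar B] [Ring C] [StarRing C]
  [AddCommGroup E] [Module ℂ E] [Module B E] [Module Cᵐᵒᵖ E]
  [NormedAddCommGroup H] [InnerProductSpace ℂ H] [CompleteSpace H] {n : ℕ} {q : Projector B n}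
  {π : A →⋆ₐ[ℂ] (H →L[ℂ] H)} {ρ : Bᵐᵒᵖ →⋆ₐ[ℂ] (H →L[ℂ] H)} {β : AlgGrading B}
  {D : H →ₗ.[ℂ] H} {Γ : H →L[ℂ] H} {hT : GradedEvenTriple π ρ β D Γ}
  {κ : E ≃ₗ[B] rowModule q.mat} {g : E →ₗ[ℂ] E}
  {nabla : E →ₗ[ℂ] (Fin n → BilinDual B)} {hnabla : HermitianConnection β κ g nabla}
  {O : Subalgebra ℂ (H →L[ℂ] H)}

variable (hT hnabla O) in
/-- The algebra `O` contains the operators from which `D̂` is built, and its elements have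
expansions with coefficients in `O`. -/
structure IsExpansionAlgebra : Prop where
  rep : ∀ b, rightRep ρ b ∈ O
  gradedComm : ∀ b, gradedComm ρ β D b ∈ O
  grading : Γ ∈ O
  connOp : ∀ e j, connOp hT hnabla e j ∈ O
  expansion : ∀ X ∈ O, HasExpansion D D (Subalgebra.toSubmodule O) X

namespace IsExpansionAlgebra

variable (hO : IsExpansionAlgebra hT hnabla O)
include hO

theorem connPart_mem (e : E) : connPart hT hnabla e ∈ colSpace q ρ O :=
  Submodule.sum_mem _ fun _ _ => comp_mem_colSpace (tensL_mem_colSpace hO.rep _)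
    (O.mul_mem hO.grading (hO.connOp _ _))

variable (hE : GradedBimodule C β κ g)
include hE

/-- `O` is not assumed closed under adjoints; the symmetry relation for `connPart` rewrites this
adjoint through elements of `O`. -/
theorem adjoint_connPart_mem (e : E) :
    ContinuousLinearMap.adjoint (connPart hT hnabla e) ∈ rowSpace ρ κ O := fun j => by
  have : ContinuousLinearMap.adjoint (connPart hT hnabla e) ∘L tensL ρ κ (gen κ j) =
      ContinuousLinearMap.adjoint (tensL ρ κ e) ∘L connPart hT hnabla (gen κ j) -
        _root_.gradedComm ρ β D (pairing κ (gen κ j) (g e)) :=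
    ContinuousLinearMap.ext fun ξ => adjoint_connPart_tensL hT hE hnabla _ _ ξ
  rw [this]
  exact O.sub_mem (comp_mem_of_rowSpace_of_colSpace (adjoint_tensL_mem_rowSpace hO.rep e)
    (hO.connPart_mem _)) (hO.gradedComm _)

/-- Apply D̂ twice to x ⊗ e. As g² = 1 the leading term is D² x ⊗ e, and in the rest D is moved to
the right through elements of `O`. -/
theorem hasExpansion_tensL (e : E) :
    HasExpansion D (dhat hT hnabla) (colSpace q ρ O) (tensL ρ κ e) := by
  have hτ : ∀ f, tensL ρ κ f ∈ colSpace q ρ O := fun f => tensL_mem_colSpace hO.rep f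
  have hM := hO.connPart_mem
  have hc : ∀ j, Γ * _root_.connOp hT hnabla e j ∈ O := fun j =>
    O.mul_mem hO.grading (hO.connOp e j)
  choose X₁ hX₁ X₀ hX₀ hX using fun j => (hO.expansion _ (hc j)).first
  refine ⟨hτ e, ⟨_, hτ (g e), _, hM e, fun x y h => tensL_mem_dhat_graph hT hE hnabla e h⟩,
    ⟨connPart hT hnabla (g e) + ∑ j, tensL ρ κ (gen κ j) ∘L X₁ j,
      Submodule.add_mem _ (hM _) (Submodule.sum_mem _ fun j _ =>
        comp_mem_colSpace (hτ _) (hX₁ j)),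
      ∑ j, (tensL ρ κ (gen κ j) ∘L X₀ j +
        connPart hT hnabla (g (gen κ j)) ∘L (Γ * _root_.connOp hT hnabla e j)),
      Submodule.sum_mem _ fun j _ => Submodule.add_mem _ (comp_mem_colSpace (hτ _) (hX₀ j))
        (comp_mem_colSpace (hM _) (hc j)), fun x y w hxy hyw => ?_⟩⟩
  refine ⟨_, tensL_mem_dhat_graph hT hE hnabla e hxy, ?_⟩
  have h1 := tensL_mem_dhat_graph hT hE hnabla (g e) hyw
  have h2 := fun j => tensL_mem_dhat_graph hT hE hnabla (g (gen κ j)) (hX j x y hxy)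
  have h3 := (dhat hT hnabla).graph.add_mem h1
    ((dhat hT hnabla).graph.sum_mem fun j (_ : j ∈ Finset.univ) => h2 j)
  simp only [hE.invol] at h3
  convert h3 using 1
  ext1
  · rw [Prod.fst_add, Prod.fst_sum, connPart_apply]
    rfl
  · rw [Prod.snd_add, Prod.snd_sum]
    simp only [_root_.add_apply, _root_.sum_apply, ContinuousLinearMap.comp_apply, map_add,
      Finset.sum_add_distrib]
    abel

theorem first_coord (j : Fin n) : ∃ Y₁ ∈ rowSpace ρ κ O, ∃ Y₀ ∈ rowSpace ρ κ O,
    ∀ x y, (x, y) ∈ (dhat hT hnabla).graph → (coord ρ q j x, Y₁ y + Y₀ x) ∈ D.graph := by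
  refine ⟨_, adjoint_tensL_mem_rowSpace hO.rep (g (gen κ j)), _,
    Submodule.neg_mem _ (hO.adjoint_connPart_mem hE (g (gen κ j))), fun x y h => ?_⟩
  have := coord_mem_graph hT hE hnabla (x := x) (y := y)
    (fun u v h' => dhat_symmetric hT hE hnabla h' h) j
  rw [sub_eq_add_neg] at this
  exact this

omit hE in
theorem mem_domain_of_mem_rowSpace {Y : TwistSpace ρ q →L[ℂ] H} (hY : Y ∈ rowSpace ρ κ O)
    {x : TwistSpace ρ q} (hx : x ∈ (dhat hT hnabla).domain) : Y x ∈ D.domain := by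
  rw [eq_sum_comp_coord (κ := κ) Y, _root_.sum_apply]
  refine Submodule.sum_mem _ fun j _ => ?_
  obtain ⟨X₁, -, X₀, -, h⟩ := (hO.expansion _ (hY j)).first
  obtain ⟨u, hu⟩ := LinearPMap.mem_domain_iff.1 ((mem_dhat_domain hT hnabla).1 hx j)
  exact LinearPMap.mem_domain_iff.2 ⟨_, h _ _ hu⟩

/-- D̂² x is expanded through the D² x_k, and so is D² of x_j, the sum of the q_kj^op x_k. The j-th
coordinate of the first expansion has the same second order terms q_kj^op D² x_k, which are thereby
eliminated. -/
theorem hasExpansion_coord (j : Fin n) :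
    HasExpansion (dhat hT hnabla) D (rowSpace ρ κ O) (coord ρ q j) := by
  choose Y₁ hY₁ Y₀ hY₀ hY using hO.first_coord hE
  choose Z₁ hZ₁ Z₀ hZ₀ hZ using fun k => (hO.hasExpansion_tensL hE (gen κ k)).second
  choose X₁ hX₁ X₀ hX₀ hX using fun k => (hO.expansion _ (hO.rep (q.mat k j))).second
  have hU : ∀ k, coord ρ q k ∈ rowSpace ρ κ O := fun k => coord_mem_rowSpace hO.rep k
  have h1 : ∀ k, X₁ k - coord ρ q j ∘L Z₁ k ∈ O := fun k =>
    O.sub_mem (hX₁ k) (comp_mem_of_rowSpace_of_colSpace (hU j) (hZ₁ k))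
  have h0 : ∀ k, X₀ k - coord ρ q j ∘L Z₀ k ∈ O := fun k =>
    O.sub_mem (hX₀ k) (comp_mem_of_rowSpace_of_colSpace (hU j) (hZ₀ k))
  refine ⟨hU j, ⟨_, hY₁ j, _, hY₀ j, hY j⟩,
    ⟨∑ k, (X₁ k - coord ρ q j ∘L Z₁ k) ∘L Y₁ k,
      Submodule.sum_mem _ fun k _ => comp_mem_rowSpace (h1 k) (hY₁ k),
      ∑ k, ((X₁ k - coord ρ q j ∘L Z₁ k) ∘L Y₀ k + (X₀ k - coord ρ q j ∘L Z₀ k) ∘L coord ρ q k),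
      Submodule.sum_mem _ fun k _ => Submodule.add_mem _ (comp_mem_rowSpace (h1 k) (hY₀ k))
        (comp_mem_rowSpace (h0 k) (hU k)), fun x y w hxy hyw => ?_⟩⟩
  let u : Fin n → H := fun k => Y₁ k y + Y₀ k x
  have hu : ∀ k, (coord ρ q k x, u k) ∈ D.graph := fun k => hY k x y hxy
  have hs : ∀ k, ∃ s, (u k, s) ∈ D.graph := fun k => by
    refine LinearPMap.mem_domain_iff.1 (D.domain.add_mem ?_ ?_)
    · exact hO.mem_domain_of_mem_rowSpace (hY₁ k) (LinearPMap.mem_domain_iff.2 ⟨_, hyw⟩)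
    · exact hO.mem_domain_of_mem_rowSpace (hY₀ k) (LinearPMap.mem_domain_iff.2 ⟨_, hxy⟩)
  choose s hs using hs
  have e1 := SqRel.sum Finset.univ fun k _ => hZ k _ _ _ (hu k) (hs k)
  rw [sum_tensL_coord] at e1
  have e2 := SqRel.functional ⟨y, hxy, hyw⟩ e1
  have e3 := SqRel.sum Finset.univ fun k _ => hX k _ _ _ (hu k) (hs k)
  have e4 : ∑ k, rightRep ρ (q.mat k j) (coord ρ q k x) = coord ρ q j x := x.2 j
  rw [e4] at e3
  have e5 : ∑ k, (rightRep ρ (q.mat k j) (s k) + X₁ k (u k) + X₀ k (coord ρ q k x)) =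
      coord ρ q j w + (∑ k, (X₁ k - coord ρ q j ∘L Z₁ k) ∘L Y₁ k) y +
      (∑ k, ((X₁ k - coord ρ q j ∘L Z₁ k) ∘L Y₀ k +
        (X₀ k - coord ρ q j ∘L Z₀ k) ∘L coord ρ q k)) x := by
    have e6 : ∀ k, coord ρ q j (tensL ρ κ (gen κ k) (s k)) = rightRep ρ (q.mat k j) (s k) :=
      fun k => by rw [coord_tensL, coe_gen]
    rw [e2, map_sum, _root_.sum_apply, _root_.sum_apply, ← Finset.sum_add_distrib,
      ← Finset.sum_add_distrib]
    refine Finset.sum_congr rfl fun k _ => ?_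
    simp only [u, map_add, e6, _root_.add_apply, ContinuousLinearMap.comp_apply,
      _root_.sub_apply]
    abel
  rwa [e5] at e3

theorem hasExpansion {T : TwistSpace ρ q →L[ℂ] TwistSpace ρ q} (hT' : T ∈ matSpace ρ κ O) :
    HasExpansion (dhat hT hnabla) (dhat hT hnabla) (matSpace ρ κ O) T := by
  have e : T = ∑ i, ∑ j, tensL ρ κ (gen κ i) ∘L
      (coord ρ q i ∘L T ∘L tensL ρ κ (gen κ j)) ∘L coord ρ q j := by
    ext1 x
    simp only [_root_.sum_apply, ContinuousLinearMap.comp_apply, ← map_sum, sum_tensL_coord]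
  rw [e]
  refine HasExpansion.sum _ fun i _ => HasExpansion.sum _ fun j _ => ?_
  exact (hO.hasExpansion_tensL hE _).comp ((hO.expansion _ (hT' i j)).comp
    (hO.hasExpansion_coord hE j) fun _ hZ _ hY => comp_mem_rowSpace hZ hY)
    fun _ hZ _ hY => comp_mem_matSpace hZ hY

end IsExpansionAlgebra

end Expansion

/-! ## Smoothness of the twisted triple -/

section Smooth

variable {H : Type*} [NormedAddCommGroup H] [InnerProductSpace ℂ H]

theorem IsComm.hasSum {ι : Type*} {P : H →ₗ.[ℂ] H} (hP : IsClosed (P.graph : Set (H × H)))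
    {T S : ι → H →L[ℂ] H} {X Y : H →L[ℂ] H} (h : ∀ k, IsComm P (T k) (T k) (S k))
    (hT : HasSum T X) (hS : HasSum S Y) : IsComm P X X Y := by
  rw [isComm_iff_graph]
  intro x y hxy
  have h1 : ∀ (Z : ι → H →L[ℂ] H) (W : H →L[ℂ] H) (v : H), HasSum Z W →
      HasSum (fun k => Z k v) (W v) := fun Z W v hZ =>
    hZ.mapL (ContinuousLinearMap.apply ℂ H v)
  have h2 := (h1 T X x hT).prodMk ((h1 T X y hT).add (h1 S Y x hS))
  refine hP.mem_of_tendsto h2 (Filter.Eventually.of_forall fun s => ?_)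
  exact P.graph.sum_mem fun k _ => isComm_iff_graph.1 (h k) x y hxy

/-- The iterated commutators of the values of a linear map are linear. -/
theorem exists_linearMap_of_isComm {B : Type*} [AddCommGroup B] [Module ℂ B] {P : H →ₗ.[ℂ] H}
    (hd : Dense (P.domain : Set H)) (f : B →ₗ[ℂ] (H →L[ℂ] H)) {S : ℕ → B → (H →L[ℂ] H)}
    (h0 : ∀ b, S 0 b = f b) (h : ∀ m b, IsComm P (S m b) (S m b) (S (m + 1) b)) (m : ℕ) :
    ∃ F : B →ₗ[ℂ] (H →L[ℂ] H), ∀ b, F b = S m b := by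
  induction m with
  | zero => exact ⟨f, fun b => (h0 b).symm⟩
  | succ m ih =>
    obtain ⟨F, hF⟩ := ih
    refine ⟨⟨⟨S (m + 1), fun b b' => ?_⟩, fun c b => ?_⟩, fun b => rfl⟩
    · refine (h m (b + b')).unique hd ?_
      have := (h m b).add (h m b')
      rwa [← hF, ← hF, ← map_add, hF] at this
    · refine (h m (c • b)).unique hd ?_
      have := (h m b).smul c
      rwa [← hF, ← map_smul, hF] at this

end Smooth

/-! ### Smoothness of the connection operators and QC^∞ for the twisted triple -/

section SmoothTwist

variable {A B C E H : Type*} [Ring A] [StarRing A] [Algebra ℂ A]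
  [Ring B] [StarRing B] [Algebra ℂ B] [StarModule ℂ B] [TopologicalSpace B]
  [IsTopologicalRing B] [ContinuousStar B] [Ring C] [StarRing C] [Algebra ℂ C]
  [AddCommGroup E] [Module ℂ E] [Module B E] [Module Cᵐᵒᵖ E]
  [NormedAddCommGroup H] [InnerProductSpace ℂ H] [CompleteSpace H] {n : ℕ} {q : Projector B n}
  {π : A →⋆ₐ[ℂ] (H →L[ℂ] H)} {ρ : Bᵐᵒᵖ →⋆ₐ[ℂ] (H →L[ℂ] H)} {β : AlgGrading B}
  {D : H →ₗ.[ℂ] H} {Γ : H →L[ℂ] H} (hT : GradedEvenTriple π ρ β D Γ)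
  {κ : E ≃ₗ[B] rowModule q.mat} {g : E →ₗ[ℂ] E} (hE : GradedBimodule C β κ g)
  {nabla : E →ₗ[ℂ] (Fin n → BilinDual B)} (hnabla : HermitianConnection β κ g nabla)

include hT in
-- Continuity of the iterated commutators makes every double series with terms Γ δ^m[D, y^op]_±
-- δ^l(x^op) converge. By the Leibniz rule, and because the graph of P is closed, δ maps the span of
-- these sums into itself.
theorem memDomInf_of_isFormAction {P : H →ₗ.[ℂ] H} (hP : IsSelfAdjoint P)
    (hΓ : IsComm P Γ Γ 0) {S S' : ℕ → B → (H →L[ℂ] H)} (hS0 : ∀ b, S 0 b = ρ (op b))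
    (hS : ∀ m b, IsComm P (S m b) (S m b) (S (m + 1) b))
    (hS0' : ∀ b, S' 0 b = gradedComm ρ β D b)
    (hS' : ∀ m b, IsComm P (S' m b) (S' m b) (S' (m + 1) b))
    (hcont : ∀ m, Continuous (S m) ∧ Continuous (S' m)) {ω : BilinDual B} {T : H →L[ℂ] H}
    (h : IsFormAction ρ β D Γ ω T) : MemDomInf P T := by
  obtain ⟨x, y, hr, hs⟩ := h
  have hd : Dense (P.domain : Set H) := hP.dense_domain
  let γ : B →ₗ[ℂ] (H →L[ℂ] H) :=
    { toFun := gradedComm ρ β D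
      map_add' := hT.gradedComm_add
      map_smul' := hT.gradedComm_smul }
  choose f hf using fun m => exists_linearMap_of_isComm hd (rightRep ρ) hS0 hS m
  choose f' hf' using fun m => exists_linearMap_of_isComm hd γ hS0' hS' m
  have hsum : ∀ m l, Summable fun k => Γ * (S' m (y k) * S l (x k)) := fun m l => by
    have h1 := hr.summable_mul (f := f l) (g := f' m)
      ((funext (hf l)) ▸ (hcont l).1) ((funext (hf' m)) ▸ (hcont m).2)
    simp only [hf, hf'] at h1
    exact h1.mul_left Γ
  let t : ℕ → ℕ → (H →L[ℂ] H) := fun m l => ∑' k, Γ * (S' m (y k) * S l (x k))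
  have ht : ∀ m l, IsComm P (t m l) (t m l) (t (m + 1) l + t m (l + 1)) := fun m l => by
    refine IsComm.hasSum hP.isClosed_graph (fun k => ?_) (hsum m l).hasSum
      ((hsum (m + 1) l).hasSum.add (hsum m (l + 1)).hasSum)
    have := hΓ.mul ((hS' m (y k)).mul (hS l (x k)))
    rwa [zero_mul, zero_add, mul_add] at this
  have hT0 : T = t 0 0 := by
    refine hs.unique ?_
    convert (hsum 0 0).hasSum using 2 with k
    rw [hS0, hS0', mul_assoc]
  let V := Submodule.span ℂ (Set.range fun p : ℕ × ℕ => t p.1 p.2)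
  have hV : ∀ m l, t m l ∈ V := fun m l => Submodule.subset_span ⟨(m, l), rfl⟩
  refine memDomInf_of_class (s := V) (fun X hX => ?_) (hT0 ▸ hV 0 0)
  induction hX using Submodule.span_induction with
  | mem X hX =>
    obtain ⟨p, rfl⟩ := hX
    exact ⟨_, V.add_mem (hV _ _) (hV _ _), ht p.1 p.2⟩
  | zero => exact ⟨0, V.zero_mem, .zero⟩
  | add X Y _ _ hX hY =>
    obtain ⟨X', hX', h1⟩ := hX
    obtain ⟨Y', hY', h2⟩ := hY
    exact ⟨X' + Y', V.add_mem hX' hY', h1.add h2⟩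
  | smul c X _ hX =>
    obtain ⟨X', hX', h1⟩ := hX
    exact ⟨c • X', V.smul_mem c hX', h1.smul c⟩

theorem isExpansionAlgebra_smoothAlgebra {P : H →ₗ.[ℂ] H} (hP : IsModulus D P)
    {R F G : H →L[ℂ] H} (hM : IsModulusTransform D P R F G) (hS : SmoothOnRight ρ β D) :
    IsExpansionAlgebra hT hnabla (smoothAlgebra P) := by
  obtain ⟨P', hP', S, S', hS0, hS, hS0', hS', hcont⟩ := hS
  obtain rfl := hM.unique hP'
  have hΓ := hM.left.commute_of_anti hT.grading_anti
  refine ⟨fun b => ⟨fun m => S m b, hS0 b, fun m => hS m b⟩,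
    fun b => ⟨fun m => S' m b, hS0' b, fun m => hS' m b⟩, hM.mem_of_commute hΓ, fun e j => ?_,
    fun X hX => hM.hasExpansion hX⟩
  exact memDomInf_of_isFormAction hT hP.1 (hM.right.isComm_of_commute hΓ (hM.commute_of_commute hΓ))
    hS0 hS hS0' hS' hcont (isFormAction_connOp hT hnabla e j)

/-- The matrix entries of a and of [D̂, a] are products of some b^op with a or [D, a], hence smooth
for |D|. The passage from smooth entries to smoothness for |D̂| runs through D̂². -/
theorem qcInf_leftHat (hA : QCInf π D) (hS : SmoothOnRight ρ β D)
    (hE : GradedBimodule C β κ g) : QCInf (leftHat hT κ) (dhat hT hnabla) := by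
  obtain ⟨P, hP, hπ⟩ := hA
  obtain ⟨R, F, G, hM⟩ := hP.exists_isModulusTransform hT.triple.selfAdjoint
  have hO := isExpansionAlgebra_smoothAlgebra hT hnabla hP hM hS
  obtain ⟨r, Fhat, h⟩ := exists_isBoundedTransform (isSelfAdjoint_dhat hT hE hnabla)
  obtain ⟨Phat, Ghat, hPhat, hGhat, h'⟩ := h.exists_isModulus
  have key : ∀ T ∈ matSpace ρ κ (smoothAlgebra P), MemDomInf Phat T := fun T hT' =>
    h'.memDomInf_of_sqSmooth hGhat (h.sqSmooth_of_hasExpansion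
      (fun X hX => hO.hasExpansion hE hX) hT')
  refine ⟨Phat, hPhat, fun a => ⟨key _ fun i j => ?_, ?_⟩⟩
  · have : coord ρ q i ∘L leftHat hT κ a ∘L tensL ρ κ (gen κ j) =
        rightRep ρ ((κ (gen κ j)).1 i) * π a := ContinuousLinearMap.ext fun ξ =>
      congrArg (coord ρ q i) (leftHat_tensL hT κ a (gen κ j) ξ)
    rw [this]
    exact mul_mem (hO.rep _) (hπ a).1
  · rw [bddComm_leftHat hT hE hnabla]
    refine key _ fun i j => ?_
    have : coord ρ q i ∘L commHat π D κ g a ∘L tensL ρ κ (gen κ j) =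
        rightRep ρ ((κ (g (gen κ j))).1 i) * bddComm D (π a) (π a) :=
      ContinuousLinearMap.ext fun ξ =>
        congrArg (coord ρ q i) (commHat_tensL hT hE a (gen κ j) ξ)
    rw [this]
    exact mul_mem (hO.rep _) (hπ a).2

end SmoothTwist

theorem mainTheorem4 {A B C E H : Type*}
    [Ring A] [StarRing A] [Algebra ℂ A] [StarModule ℂ A]
    [Ring B] [StarRing B] [Algebra ℂ B] [StarModule ℂ B]
    [TopologicalSpace B] [IsTopologicalRing B] [ContinuousStar B] [ContinuousSMul ℂ B]
    [Ring C] [StarRing C] [Algebra ℂ C] [StarModule ℂ C]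
    [NormedAddCommGroup H] [InnerProductSpace ℂ H] [CompleteSpace H]
    [AddCommGroup E] [Module ℂ E] [Module B E] [IsScalarTower ℂ B E]
    [Module Cᵐᵒᵖ E] [IsScalarTower ℂ Cᵐᵒᵖ E] [SMulCommClass B Cᵐᵒᵖ E]
    -- the triple `(A ⊗ B^op, H, D, Γ)`
    (π : A →⋆ₐ[ℂ] (H →L[ℂ] H)) (ρ : Bᵐᵒᵖ →⋆ₐ[ℂ] (H →L[ℂ] H)) (β : AlgGrading B)
    (D : H →ₗ.[ℂ] H) (Γ : H →L[ℂ] H)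
    (hT : GradedEvenTriple π ρ β D Γ) (hA : QCInf π D)
    -- the bimodule `E ≅ B^n q`, its grading `g` and its connection
    {n : ℕ} {q : Projector B n} (κ : E ≃ₗ[B] rowModule q.mat) (g : E →ₗ[ℂ] E)
    (hE : GradedBimodule C β κ g)
    (nabla : E →ₗ[ℂ] (Fin n → BilinDual B)) (hnabla : HermitianConnection β κ g nabla) :
    -- the operator and the actions of `A` and `C^op` on `H ⊗_B E`
    ∃ (Dhat : TwistSpace ρ q →ₗ.[ℂ] TwistSpace ρ q)
      (πhat : A →⋆ₐ[ℂ] (TwistSpace ρ q →L[ℂ] TwistSpace ρ q))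
      (χhat : Cᵐᵒᵖ →⋆ₐ[ℂ] (TwistSpace ρ q →L[ℂ] TwistSpace ρ q)),
      Dhat.graph = twistGraph ρ β D Γ κ g nabla ∧
      (∀ a ξ e, πhat a (tens ρ κ ξ e) = tens ρ κ (π a ξ) e) ∧
      (∀ c ξ e, χhat c (tens ρ κ ξ e) = tens ρ κ ξ (c • e)) ∧
      -- `(A, H ⊗_B E, Dhat)` is a spectral triple
      PreSpectralTriple πhat Dhat ∧
      (IsFull ρ κ → Function.Injective πhat) ∧
      -- it is `QC^∞`
      (SmoothOnRight ρ β D → QCInf πhat Dhat) ∧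
      -- it is `I`-summable
      (∀ I : TwoSidedIdeal (H →L[ℂ] H), IsSummableFor D (fun R => R ∈ I) →
        IsSummableFor Dhat (fun R => R ∈ idealOn I (TwistSpace ρ q))) ∧
      (∀ s : ℝ, 1 ≤ s → IsSummableFor D (MemSchatten s) → IsSummableFor Dhat (MemSchatten s)) ∧
      (∀ p : ℝ, 1 ≤ p → IsSummableFor D (MemZ p) → IsSummableFor Dhat (MemZ p)) ∧
      -- it has the same spectral dimension
      (∀ d, HasSpectralDim D d → ∃ d' ≤ d, HasSpectralDim Dhat d') ∧
      (IsFull ρ κ → ∀ d, HasSpectralDim D d ↔ HasSpectralDim Dhat d) ∧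
      -- `(A ⊗ C^op, H ⊗_B E, Dhat)` is a spectral triple satisfying the first order condition
      (SmoothDomainProjective π D → IsLTwoSpace π D →
        (∀ a c, Commute (πhat a) (χhat c)) ∧
        (∀ c, IsComm Dhat (χhat c) (χhat c) (bddComm Dhat (χhat c) (χhat c))) ∧
        ((∀ c : C, (∀ e : E, op c • e = 0) → c = 0) → Function.Injective χhat) ∧
        (∀ a c, Commute (bddComm Dhat (πhat a) (πhat a)) (χhat c))) := by
  refine ⟨dhat hT hnabla, leftHat hT κ, rightHat ρ hE, dhat_graph_eq_twistGraph hT hE hnabla,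
    fun a ξ e => leftHat_tensL hT κ a e ξ, fun c ξ e => rightHat_tensL hE c e ξ,
    preSpectralTriple_leftHat hT hE hnabla, leftHat_injective hT κ,
    fun hS => qcInf_leftHat hT hnabla hA hS hE,
    fun I => isSummableFor_dhat hT hE hnabla fun _ _ h => h.mem_idealOn,
    fun s hs => isSummableFor_dhat hT hE hnabla fun _ _ h => h.memSchatten (by linarith),
    fun p hp => isSummableFor_dhat hT hE hnabla fun _ _ h => h.memZ (by linarith),
    fun d => exists_hasSpectralDim hT hE hnabla, hasSpectralDim_iff hT hE hnabla,
    fun _ _ => ⟨commute_leftHat_rightHat hE hT, isComm_rightHat hT hE hnabla,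
      rightHat_injective hE hT.faithful_right, fun a c => ?_⟩⟩
  rw [bddComm_leftHat hT hE hnabla]
  exact commute_commHat_rightHat hT hE a c
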